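/- Let $N\in\{2,3\}$, let $\alpha\in\mathbb R$ and $1<p<\infty$ if $N=2$, and $\alpha<0$ and $1<p<2$ if $N=3$. Write $\langle u,v\rangle=\int_{\mathbb R^N}u\,\overline{v}\,dx$. For $\lambda>0$ let $G_\lambda\in L^2(\mathbb R^N)$ be the fundamental solution $(\lambda-\Delta)G_\lambda=\delta_0$ in $\mathcal D'(\mathbb R^N)$, that is, $G_\lambda(x)=\int_0^\infty(4\pi t)^{-N/2}e^{-\lambda t-|x|^2/(4t)}\,dt$, and let $\beta(\lambda)=\frac1{2\pi}\bigl(\gamma+\log\frac{\sqrt\lambda}2\bigr)$ if $N=2$ ($\gamma$ the Euler–Mascheroni constant) and $\beta(\lambda)=\frac{\sqrt\lambda}{4\pi}$ if $N=3$. Let $-\Delta_\alpha$ be the operator in $L^2(\mathbb R^N)$ whose domain consists of the functions $u=f+cG_\lambda$ with $f\in H^2(\mathbb R^N)$, $c\in\mathbb C$ and $(\alpha+\beta(\lambda))c=f(0)$, and which acts by $(\lambda-\Delta_\alpha)u=(\lambda-\Delta)f$ (this does not depend on $\lambda>0$). Let $H^1_\alpha$ be the domain of the closure of the quadratic form $u\mapsto\langle-\Delta_\alpha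 u,u\rangle$; for $u,v\in H^1_\alpha$ let $\langle-\Delta_\alpha u,v\rangle$ denote the closed sesquilinear form, i.e. the limit of $\langle-\Delta_\alpha u_n,v_n\rangle$ along any $u_n,v_n\in D(-\Delta_\alpha)$ with $u_n\to u$, $v_n\to v$ in $L^2$ and $\langle-\Delta_\alpha(u_n-u_m),u_n-u_m\rangle\to0$, $\langle-\Delta_\alpha(v_n-v_m),v_n-v_m\rangle\to0$ as $n,m\to\infty$. Finally let $$X_0=\{f+qG_\lambda:\ f\in L^{p+1}(\mathbb R^N),\ \nabla f\in L^2(\mathbb R^N),\ q\in\mathbb C\},\qquad \|f+qG_\lambda\|_{X_0,\lambda}=\|\nabla f\|_{L^2}+|q|+\|f+qG_\lambda\|_{L^{p+1}}.$$ **Proposition.** As a subset of $L^{p+1}(\mathbb R^N)$, the space $X_0$ does not depend on $\lambda>0$, for each $\lambda>0$ the decomposition $u=f_\lambda+cG_\lambda$ of $u\in X_0$ is unique, $u\,\overline{G_\lambda}$ is integrable for every $u\in X_0$, and $H^1_\alpha\subset X_0$. Let $X_0$ carry the norm $\|\cdot\|_{X_0,\lambda_0}$ for any fixed $\lambda_0>0$,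 and let $X_0^*$ be the space of bounded conjugate-linear functionals on it. Then there is a bounded linear map $-\widetilde\Delta_\alpha:X_0\to X_0^*$ such that for every $\lambda>0$ and all $u=f_\lambda+cG_\lambda$ and $v=g_\lambda+dG_\lambda$ in $X_0$ $$\langle-\widetilde\Delta_\alpha u,v\rangle_{X_0^*,X_0}=\langle\nabla f_\lambda,\nabla g_\lambda\rangle+\bigl(\alpha+\beta(\lambda)+\lambda\|G_\lambda\|_{L^2}^2\bigr)c\,\overline d-\lambda\,\overline d\,\langle u,G_\lambda\rangle-\lambda\,c\,\overline{\langle v,G_\lambda\rangle},$$ and $\langle-\widetilde\Delta_\alpha u,v\rangle_{X_0^*,X_0}=\langle-\Delta_\alpha u,v\rangle$ for all $u,v\in H^1_\alpha$. -/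

import Mathlib

open MeasureTheory Filter Topology Set
open scoped ContDiff ENNReal ComplexConjugate

noncomputable section

namespace PointInteraction

/-- The Euclidean space `ℝ^N`. -/
abbrev Rn (N : ℕ) : Type := EuclideanSpace ℝ (Fin N)

/-- The values of gradients of complex functions on `ℝ^N`. -/
abbrev Cn (N : ℕ) : Type := EuclideanSpace ℂ (Fin N)

/-- The complex Hilbert space `L²(ℝ^N)`. -/
abbrev L2 (N : ℕ) : Type := Lp ℂ 2 (volume : Measure (Rn N))

/-- Vector fields `ℝ^N → ℂ^N` with components in `L²(ℝ^N)`. -/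
abbrev L2vec (N : ℕ) : Type := Lp (Cn N) 2 (volume : Measure (Rn N))

/-- The exponent `p + 1`; in this form it is visibly at least `1`. -/
abbrev expo (p : ℝ) : ℝ≥0∞ := ENNReal.ofReal p + 1

instance expo_fact (p : ℝ) : Fact (1 ≤ expo p) := ⟨le_add_self⟩

/-- The space `L^{p+1}(ℝ^N)` of complex functions. -/
abbrev Lpp (N : ℕ) (p : ℝ) : Type := Lp ℂ (expo p) (volume : Measure (Rn N))

/-- Test functions: smooth with compact support. -/
def IsTest {N : ℕ} (φ : Rn N → ℝ) : Prop := ContDiff ℝ ∞ φ ∧ HasCompactSupport φ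

/-- `F` is the weak (distributional) gradient of `f`, for locally integrable `f` and `F`. -/
def HasWeakGrad {N : ℕ} (f : Rn N → ℂ) (F : Rn N → Cn N) : Prop :=
  ∀ φ : Rn N → ℝ, IsTest φ → ∀ i : Fin N,
    ∫ x, ((fderiv ℝ φ x (EuclideanSpace.single i 1) : ℝ) : ℂ) * f x
      = - ∫ x, ((φ x : ℝ) : ℂ) * F x i

/-- `⟨u, v⟩ = ∫ u(x) conj(v(x)) dx`. -/
def pairing {N : ℕ} (u v : Rn N → ℂ) : ℂ := ∫ x, u x * conj (v x)

/-- `⟨F, H⟩ = ∫ F(x) · conj(H(x)) dx` for vector fields. -/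
def gradPairing {N : ℕ} (F H : Rn N → Cn N) : ℂ := ∫ x, ∑ i, F x i * conj (H x i)

/-- The `L²` fundamental solution `G_λ` of `λ - Δ` on `ℝ^N`, as the Laplace transform
`∫_0^∞ e^{-λt} (4πt)^{-N/2} e^{-|x|²/(4t)} dt` of the heat kernel. For `N = 3` it is
`e^{-√λ|x|} / (4π|x|)`, for `N = 2` it is `K_0(√λ|x|) / (2π)`. The value at the
singularity `x = 0` is irrelevant. -/
def green (N : ℕ) (lam : ℝ) (x : Rn N) : ℂ :=
  ((∫ t in Ioi (0 : ℝ),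
    (4 * Real.pi * t) ^ (-(N : ℝ) / 2) * Real.exp (-lam * t - ‖x‖ ^ 2 / (4 * t)) : ℝ) : ℂ)

/-- `G` is an `L²` solution of `(λ - Δ) G = δ₀` in the sense of distributions. -/
def IsFundamentalSolution {N : ℕ} (lam : ℝ) (G : Rn N → ℂ) : Prop :=
  MemLp G 2 volume ∧
    ∀ φ : Rn N → ℝ, IsTest φ →
      ∫ x, G x * ((lam * φ x - Laplacian.laplacian φ x : ℝ) : ℂ) = ((φ 0 : ℝ) : ℂ)

/-- The number `‖G_λ‖²` in `L²`. -/
def greenNormSq (N : ℕ) (lam : ℝ) : ℝ := ∫ x : Rn N, ‖green N lam x‖ ^ 2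

/-- The function `β(λ)`, for `N = 2` and `N = 3`. -/
def beta (N : ℕ) (lam : ℝ) : ℝ :=
  if N = 2 then
    1 / (2 * Real.pi) * (Real.eulerMascheroniConstant + Real.log (Real.sqrt lam / 2))
  else Real.sqrt lam / (4 * Real.pi)

/-! ### The operator `-Δ_α` and its closed quadratic form -/

/-- `u` lies in the domain of `-Δ_α` and `-Δ_α u = w`: one has `u = f + c G_λ` with
`f ∈ H²` (`f` the continuous representative, `F` its gradient, `H i` the gradient of the
`i`-th component of `F`), `(α + β(λ)) c = f(0)`, and `λ u + w = λ f - Δ f`. -/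
def IsPointLaplacian {N : ℕ} (α lam : ℝ) (u w : L2 N) : Prop :=
  ∃ (f : Rn N → ℂ) (c : ℂ) (F : Rn N → Cn N) (H : Fin N → Rn N → Cn N),
    Continuous f ∧ MemLp f 2 volume ∧
    MemLp F 2 volume ∧ HasWeakGrad f F ∧
    (∀ i, MemLp (H i) 2 volume ∧ HasWeakGrad (fun x => F x i) (H i)) ∧
    (∀ᵐ x, u x = f x + c * green N lam x) ∧
    ((α + beta N lam : ℝ) : ℂ) * c = f 0 ∧
    (∀ᵐ x, (lam : ℂ) * u x + w x = (lam : ℂ) * f x - ∑ i, H i x i)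

/-- The sequence `un` in the domain of `-Δ_α`, with `wn n = -Δ_α (un n)`, converges to `u`
in the sense of the quadratic form: `un → u` in `L²` and
`⟨-Δ_α (un n - un m), un n - un m⟩ → 0` as `n, m → ∞`. -/
def FormConverges {N : ℕ} (α lam : ℝ) (un wn : ℕ → L2 N) (u : L2 N) : Prop :=
  (∀ n, IsPointLaplacian α lam (un n) (wn n)) ∧
  Tendsto un atTop (𝓝 u) ∧
  Tendsto (fun k : ℕ × ℕ => pairing (wn k.1 - wn k.2 : L2 N) (un k.1 - un k.2 : L2 N))
    atTop (𝓝 0)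

/-- The energy space `H¹_α`: the domain of the closure of the form `⟨-Δ_α u, u⟩`. -/
def energySpace (N : ℕ) (α lam : ℝ) : Set (L2 N) :=
  {u | ∃ un wn : ℕ → L2 N, FormConverges α lam un wn u}

/-- `u, v` lie in the energy space and the closed sesquilinear form `⟨-Δ_α u, v⟩` has the
value `z`: it is the limit of `⟨-Δ_α uₙ, vₙ⟩` along all sequences that converge to `u` and
`v` in the sense of the form. -/
def HasFormValue {N : ℕ} (α lam : ℝ) (u v : L2 N) (z : ℂ) : Prop :=
  u ∈ energySpace N α lam ∧ v ∈ energySpace N α lam ∧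
  ∀ un wn vn zn : ℕ → L2 N, FormConverges α lam un wn u → FormConverges α lam vn zn v →
    Tendsto (fun n => pairing (wn n) (vn n)) atTop (𝓝 z)

/-! ### The space `X₀` -/

/-- `u = f + c G_λ` with `f ∈ L^{p+1}` and `∇f = F ∈ L²`. -/
def IsDecomp {N : ℕ} {p : ℝ} (lam : ℝ) (u f : Lpp N p) (F : L2vec N) (c : ℂ) : Prop :=
  HasWeakGrad f F ∧ ∀ᵐ x, u x = f x + c * green N lam x

theorem integrable_test_mul {N : ℕ} {f : Rn N → ℂ} (hf : LocallyIntegrable f volume)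
    {ψ : Rn N → ℝ} (hc : Continuous ψ) (hs : HasCompactSupport ψ) :
    Integrable (fun x => ((ψ x : ℝ) : ℂ) * f x) := by
  have := hf.integrable_smul_left_of_hasCompactSupport hc hs
  simpa [Complex.real_smul] using this

theorem IsTest.partial {N : ℕ} {φ : Rn N → ℝ} (h : IsTest φ) (i : Fin N) :
    Continuous (fun x => fderiv ℝ φ x (EuclideanSpace.single i 1)) ∧
    HasCompactSupport (fun x => fderiv ℝ φ x (EuclideanSpace.single i 1)) := by
  refine ⟨?_, h.2.fderiv_apply (𝕜 := ℝ) _⟩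
  exact (h.1.continuous_fderiv (by simp)).clm_apply continuous_const

theorem locInt {N : ℕ} {E : Type*} [NormedAddCommGroup E] {q : ℝ≥0∞} [hq : Fact (1 ≤ q)]
    (f : Lp E q (volume : Measure (Rn N))) : LocallyIntegrable f volume :=
  (Lp.memLp f).locallyIntegrable hq.out

theorem locInt_comp {N : ℕ} (F : L2vec N) (i : Fin N) :
    LocallyIntegrable (fun x => F x i) volume := by
  have h : MemLp (fun x => F x i) 2 (volume : Measure (Rn N)) :=
    (EuclideanSpace.proj (𝕜 := ℂ) i : Cn N →L[ℂ] ℂ).comp_memLp' (Lp.memLp F)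
  exact h.locallyIntegrable (by norm_num)

theorem HasWeakGrad.congr {N : ℕ} {f f' : Rn N → ℂ} {F F' : Rn N → Cn N}
    (h : HasWeakGrad f F) (hf : f' =ᵐ[volume] f) (hF : F' =ᵐ[volume] F) :
    HasWeakGrad f' F' := by
  intro φ hφ i
  have h1 : ∫ x, ((fderiv ℝ φ x (EuclideanSpace.single i 1) : ℝ) : ℂ) * f' x
      = ∫ x, ((fderiv ℝ φ x (EuclideanSpace.single i 1) : ℝ) : ℂ) * f x :=
    integral_congr_ae (by filter_upwards [hf] with x hx; rw [hx])
  have h2 : ∫ x, ((φ x : ℝ) : ℂ) * F' x i = ∫ x, ((φ x : ℝ) : ℂ) * F x i :=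
    integral_congr_ae (by filter_upwards [hF] with x hx; rw [hx])
  rw [h1, h2]
  exact h φ hφ i

theorem IsDecomp.add {N : ℕ} {p lam : ℝ} {u u' f f' : Lpp N p} {F F' : L2vec N} {c c' : ℂ}
    (h : IsDecomp lam u f F c) (h' : IsDecomp lam u' f' F' c') :
    IsDecomp lam (u + u') (f + f') (F + F') (c + c') := by
  refine ⟨?_, ?_⟩
  · refine HasWeakGrad.congr (f := fun x => f x + f' x) (F := fun x => F x + F' x) ?_
      (Lp.coeFn_add f f') (Lp.coeFn_add F F')
    intro φ hφ i
    obtain ⟨hc, hs⟩ := hφ.partial i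
    have e1 := h.1 φ hφ i
    have e2 := h'.1 φ hφ i
    simp only [PiLp.add_apply, mul_add]
    rw [integral_add (integrable_test_mul (locInt f) hc hs)
        (integrable_test_mul (locInt f') hc hs),
      integral_add (integrable_test_mul (locInt_comp F i) hφ.1.continuous hφ.2)
        (integrable_test_mul (locInt_comp F' i) hφ.1.continuous hφ.2), e1, e2]
    ring
  · filter_upwards [h.2, h'.2, Lp.coeFn_add u u', Lp.coeFn_add f f'] with x h1 h2 h3 h4
    rw [h3, h4, Pi.add_apply, Pi.add_apply, h1, h2]
    ring

theorem IsDecomp.smul {N : ℕ} {p lam : ℝ} {u f : Lpp N p} {F : L2vec N} {c : ℂ} (a : ℂ)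
    (h : IsDecomp lam u f F c) : IsDecomp lam (a • u) (a • f) (a • F) (a * c) := by
  refine ⟨?_, ?_⟩
  · refine HasWeakGrad.congr (f := fun x => a * f x) (F := fun x => a • F x) ?_
      (Lp.coeFn_smul a f) (Lp.coeFn_smul a F)
    intro φ hφ i
    have e1 := h.1 φ hφ i
    simp only [PiLp.smul_apply, smul_eq_mul, mul_left_comm _ a]
    rw [integral_const_mul, integral_const_mul, e1]
    ring
  · filter_upwards [h.2, Lp.coeFn_smul a u, Lp.coeFn_smul a f] with x h1 h2 h3
    rw [h2, h3, Pi.smul_apply, Pi.smul_apply, h1, smul_eq_mul, smul_eq_mul]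
    ring

theorem IsDecomp.zero {N : ℕ} {p lam : ℝ} : IsDecomp lam (0 : Lpp N p) 0 (0 : L2vec N) 0 := by
  refine ⟨?_, by simp⟩
  refine HasWeakGrad.congr (f := fun _ => 0) (F := fun _ => 0) ?_
    (Lp.coeFn_zero ..) (Lp.coeFn_zero ..)
  intro φ hφ i
  simp

/-- `{f + q G_λ : f ∈ L^{p+1}, ∇f ∈ L², q ∈ ℂ}` as a subspace of `L^{p+1}`. -/
def X0Submodule (N : ℕ) (p lam : ℝ) : Submodule ℂ (Lpp N p) where
  carrier := {u | ∃ f F c, IsDecomp lam u f F c}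
  add_mem' := by
    rintro u v ⟨f, F, c, h⟩ ⟨f', F', c', h'⟩
    exact ⟨_, _, _, h.add h'⟩
  zero_mem' := ⟨0, 0, 0, IsDecomp.zero⟩
  smul_mem' := by
    rintro a u ⟨f, F, c, h⟩
    exact ⟨_, _, _, h.smul a⟩

/-- The space `X₀`, a type of its own since its norm is not that of `L^{p+1}`. -/
def X0 (N : ℕ) (p lam : ℝ) : Type := X0Submodule N p lam

namespace X0

variable {N : ℕ} {p lam : ℝ}

instance : AddCommGroup (X0 N p lam) := inferInstanceAs (AddCommGroup (X0Submodule N p lam))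

instance : Module ℂ (X0 N p lam) := inferInstanceAs (Module ℂ (X0Submodule N p lam))

/-- The inclusion of `X₀` in `L^{p+1}`. -/
def toLp : X0 N p lam →ₗ[ℂ] Lpp N p := (X0Submodule N p lam).subtype

theorem toLp_injective : Function.Injective (toLp : X0 N p lam → Lpp N p) :=
  Subtype.val_injective

theorem exists_decomp (u : X0 N p lam) : ∃ f F c, IsDecomp lam u.toLp f F c := u.2

/-- The values `‖∇f‖ + |c|` over the decompositions `u = f + c G_λ`. -/
def normSet (u : X0 N p lam) : Set ℝ :=
  {r | ∃ (f : Lpp N p) (F : L2vec N) (c : ℂ), IsDecomp lam u.toLp f F c ∧ r = ‖F‖ + ‖c‖}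

/-- The norm `‖∇f‖ + |c| + ‖u‖` (in `L²`, `ℂ`, `L^{p+1}`) of `u = f + c G_λ`. The infimum is
over a set with a single element, since the decomposition is unique. -/
instance : Norm (X0 N p lam) := ⟨fun u => sInf (normSet u) + ‖u.toLp‖⟩

theorem norm_def (u : X0 N p lam) : ‖u‖ = sInf (normSet u) + ‖u.toLp‖ := rfl

theorem normSet_nonempty (u : X0 N p lam) : (normSet u).Nonempty := by
  obtain ⟨f, F, c, h⟩ := u.exists_decomp
  exact ⟨_, f, F, c, h, rfl⟩

theorem normSet_nonneg (u : X0 N p lam) {r : ℝ} (hr : r ∈ normSet u) : 0 ≤ r := by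
  obtain ⟨f, F, c, -, rfl⟩ := hr
  positivity

theorem normSet_bddBelow (u : X0 N p lam) : BddBelow (normSet u) :=
  ⟨0, fun _ hr => normSet_nonneg u hr⟩

theorem sInf_nonneg' (u : X0 N p lam) : 0 ≤ sInf (normSet u) :=
  Real.sInf_nonneg fun _ hr => normSet_nonneg u hr

theorem smul_le (a : ℂ) (u : X0 N p lam) :
    sInf (normSet (a • u)) ≤ ‖a‖ * sInf (normSet u) := by
  rw [Real.sInf_def, ← smul_eq_mul, ← Real.sInf_def, ← Real.sInf_smul_of_nonneg (norm_nonneg a)]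
  refine le_csInf ((normSet_nonempty u).smul_set) ?_
  rintro _ ⟨_, ⟨f, F, c, h, rfl⟩, rfl⟩
  refine csInf_le (normSet_bddBelow _) ⟨a • f, a • F, a * c, ?_, ?_⟩
  · rw [map_smul]
    exact h.smul a
  · simp [norm_smul, mul_add]

theorem core : NormedSpace.Core ℂ (X0 N p lam) where
  norm_nonneg u := add_nonneg (sInf_nonneg' u) (norm_nonneg _)
  norm_smul a u := by
    have key : sInf (normSet (a • u)) = ‖a‖ * sInf (normSet u) := by
      refine le_antisymm (smul_le a u) ?_
      rcases eq_or_ne a 0 with rfl | ha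
      · simpa using sInf_nonneg' _
      · have := smul_le a⁻¹ (a • u)
        rw [inv_smul_smul₀ ha, norm_inv] at this
        have ha' : 0 < ‖a‖ := norm_pos_iff.2 ha
        rwa [inv_mul_eq_div, le_div_iff₀ ha', mul_comm] at this
    rw [norm_def, norm_def, key, map_smul, norm_smul, mul_add]
  norm_triangle u v := by
    have key : sInf (normSet (u + v)) ≤ sInf (normSet u) + sInf (normSet v) := by
      rw [← csInf_add (normSet_nonempty u) (normSet_bddBelow u) (normSet_nonempty v)
        (normSet_bddBelow v)]
      refine le_csInf ((normSet_nonempty u).add (normSet_nonempty v)) ?_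
      rintro _ ⟨_, ⟨f, F, c, h, rfl⟩, _, ⟨f', F', c', h', rfl⟩, rfl⟩
      refine (csInf_le (normSet_bddBelow _)
        ⟨f + f', F + F', c + c', by rw [map_add]; exact h.add h', rfl⟩).trans ?_
      have := norm_add_le F F'
      have := norm_add_le c c'
      simp only
      linarith
    have := norm_add_le u.toLp v.toLp
    rw [norm_def, norm_def, norm_def, map_add]
    linarith
  norm_eq_zero_iff u := by
    constructor
    · intro h
      have h1 : ‖u.toLp‖ = 0 := by
        have := sInf_nonneg' u
        have := norm_nonneg u.toLp
        rw [norm_def] at h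
        linarith
      exact toLp_injective (by rw [norm_eq_zero.1 h1, map_zero])
    · rintro rfl
      have h0 : (0 : ℝ) ∈ normSet (0 : X0 N p lam) :=
        ⟨0, 0, 0, by rw [map_zero]; exact IsDecomp.zero, by simp⟩
      have := csInf_le (normSet_bddBelow _) h0
      have := sInf_nonneg' (0 : X0 N p lam)
      rw [norm_def, map_zero, norm_zero]
      linarith

instance : NormedAddCommGroup (X0 N p lam) := NormedAddCommGroup.ofCore core

instance : NormedSpace ℂ (X0 N p lam) := NormedSpace.ofCore core

end X0

/-- The (anti-)dual space `X₀^*`: bounded conjugate-linear functionals on `X₀`, so that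
`⟨ℓ, v⟩` is conjugate-linear in `v`. -/
abbrev X0Dual (N : ℕ) (p lam : ℝ) : Type := X0 N p lam →L⋆[ℂ] ℂ

end PointInteraction

end

/-!
Everything rests on the Fourier description of `G_λ`: it is an `L²` function whose transform is
the resolvent symbol `(λ + 4π²|ξ|²)⁻¹` (`fourier_greenL2`). Three consequences follow.

* `G_λ` solves `(λ - Δ) G_λ = δ₀`, and `f(0) = ⟨(λ - Δ) f, G_λ⟩` for `f ∈ H²`
  (`inner_greenL2_eq`).
* `∇G_λ` is not in `L²` when `N ≥ 2`, so a decomposition `u = f + c G_λ` with `∇f ∈ L²` is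
  unique (`IsDecomp.unique`).
* `G_λ - G_μ` lies in `H²`, with `Δ(G_λ - G_μ) = λ G_λ - μ G_μ`
  (`exists_weakPartial_greenDiff`). Its continuous representative takes the value
  `β(μ) - β(λ)` at the origin (`greenDiff_zero`), since both sides have the same derivative in
  `λ`.

By the last point, passing from `λ` to `μ` replaces `f` by `f + c (G_λ - G_μ)` and leaves `c`
alone, so that `X₀` does not depend on `λ`. That the right-hand side of the formula for
`⟨-Δ̃_α u, v⟩` does not depend on `λ` either (`formExpr_change`) is then algebra, given the
identity `⟨∇f, ∇(G_λ - G_μ)⟩ = -⟨f, λ G_λ - μ G_μ⟩`. Here `f` is only in `L^{p+1}`, with gradient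
in `L²`; the integration by parts is justified by truncating `f` at radius `R`, where the error
`‖f ∇χ_R‖₂` tends to `0` because `p + 1 < 2N / (N - 2)` (`integral_weakGrad_mul`). For fixed `λ`
the right-hand side is a bounded sesquilinear form on `X₀`, since `G_λ` lies in the space dual to
`L^{p+1}`. The operator is the one defined by this form.

On the domain of `-Δ_α` an integration by parts gives
`⟨-Δ_α u, v⟩ + μ⟨u, v⟩ = ⟨∇f, ∇g⟩ + μ⟨f, g⟩ + (α + β(μ)) c d̄` (`IsDomainDecomp.pairing_eq`).
As `β(μ) → ∞`, some `μ` makes the right-hand side coercive. For this `μ` the functions `f`, their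
gradients and the coefficients `c` converge along every sequence that converges in the sense of
the form (`FormConverges.exists_tendsto`). The limit thus has a decomposition with `f ∈ H¹`, which
is contained in `L^{p+1}` by the Sobolev embedding (`memLp_of_hasWeakPartial`), and the limit of
the form is the claimed expression.
-/

noncomputable section

namespace PointInteraction

open scoped SchwartzMap FourierTransform LineDeriv InnerProductSpace

variable {N : ℕ}

/-! ### Weak partial derivatives -/

/-- The `i`-th coordinate vector of `ℝ^N`. -/
abbrev coordVec (i : Fin N) : Rn N := EuclideanSpace.single i 1

/-- `g` is the weak `i`-th partial derivative of `f`: one component of `HasWeakGrad`. -/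
def HasWeakPartial (i : Fin N) (f g : Rn N → ℂ) : Prop :=
  ∀ φ : Rn N → ℝ, IsTest φ →
    ∫ x, ((fderiv ℝ φ x (coordVec i) : ℝ) : ℂ) * f x = - ∫ x, ((φ x : ℝ) : ℂ) * g x

theorem hasWeakGrad_iff {f : Rn N → ℂ} {F : Rn N → Cn N} :
    HasWeakGrad f F ↔ ∀ i, HasWeakPartial i f (fun x => F x i) :=
  ⟨fun h i φ hφ => h φ hφ i, fun h φ hφ i => h i φ hφ⟩

theorem HasWeakPartial.congr {i : Fin N} {f g f' g' : Rn N → ℂ} (h : HasWeakPartial i f g)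
    (hf : f' =ᵐ[volume] f) (hg : g' =ᵐ[volume] g) : HasWeakPartial i f' g' := by
  intro φ hφ
  have h1 : ∫ x, ((fderiv ℝ φ x (coordVec i) : ℝ) : ℂ) * f' x
      = ∫ x, ((fderiv ℝ φ x (coordVec i) : ℝ) : ℂ) * f x :=
    integral_congr_ae (by filter_upwards [hf] with x hx; rw [hx])
  have h2 : ∫ x, ((φ x : ℝ) : ℂ) * g' x = ∫ x, ((φ x : ℝ) : ℂ) * g x :=
    integral_congr_ae (by filter_upwards [hg] with x hx; rw [hx])
  rw [h1, h2]
  exact h φ hφ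

/-- Weak derivatives may be tested with complex functions. -/
theorem HasWeakPartial.integral_complex {i : Fin N} {f g : Rn N → ℂ} (h : HasWeakPartial i f g)
    (hf : LocallyIntegrable f volume) (hg : LocallyIntegrable g volume)
    {φ : Rn N → ℂ} (hφ : ContDiff ℝ ∞ φ) (hs : HasCompactSupport φ) :
    ∫ x, fderiv ℝ φ x (coordVec i) * f x = - ∫ x, φ x * g x := by
  have hre : IsTest (fun x => (φ x).re) :=
    ⟨Complex.reCLM.contDiff.comp hφ, hs.comp_left (g := Complex.re) rfl⟩
  have him : IsTest (fun x => (φ x).im) :=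
    ⟨Complex.imCLM.contDiff.comp hφ, hs.comp_left (g := Complex.im) rfl⟩
  have hd : Differentiable ℝ φ := hφ.differentiable (by simp)
  have e1 : ∀ x, fderiv ℝ (fun x => (φ x).re) x (coordVec i)
      = (fderiv ℝ φ x (coordVec i)).re := fun x => by
    have := (Complex.reCLM.hasFDerivAt.comp x (hd x).hasFDerivAt).fderiv
    exact (congrArg (fun L => L (coordVec i)) this)
  have e2 : ∀ x, fderiv ℝ (fun x => (φ x).im) x (coordVec i)
      = (fderiv ℝ φ x (coordVec i)).im := fun x => by
    have := (Complex.imCLM.hasFDerivAt.comp x (hd x).hasFDerivAt).fderiv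
    exact (congrArg (fun L => L (coordVec i)) this)
  have h1 := h _ hre
  have h2 := h _ him
  obtain ⟨c1, s1⟩ := hre.partial i
  obtain ⟨c2, s2⟩ := him.partial i
  have i1 := integrable_test_mul hf c1 s1
  have i2 := (integrable_test_mul hf c2 s2).const_mul Complex.I
  have i3 := integrable_test_mul hg hre.1.continuous hre.2
  have i4 := (integrable_test_mul hg him.1.continuous him.2).const_mul Complex.I
  have k1 : (fun x => fderiv ℝ φ x (coordVec i) * f x) = fun x =>
      ((fderiv ℝ (fun x => (φ x).re) x (coordVec i) : ℝ) : ℂ) * f x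
      + Complex.I * (((fderiv ℝ (fun x => (φ x).im) x (coordVec i) : ℝ) : ℂ) * f x) := by
    ext x
    rw [e1, e2]
    conv_lhs => rw [← Complex.re_add_im (fderiv ℝ φ x (coordVec i))]
    ring
  have k2 : (fun x => φ x * g x) = fun x =>
      (((φ x).re : ℝ) : ℂ) * g x + Complex.I * ((((φ x).im : ℝ) : ℂ) * g x) := by
    ext x
    conv_lhs => rw [← Complex.re_add_im (φ x)]
    ring
  rw [k1, k2, integral_add i1 i2, integral_add i3 i4, integral_const_mul, integral_const_mul, h1,
    h2]
  ring

/-! ### Cutoff functions -/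

/-- A fixed bump function, equal to `1` on the unit ball and to `0` outside the ball of
radius `2`. -/
def unitBump (N : ℕ) : ContDiffBump (0 : Rn N) := ⟨1, 2, one_pos, one_lt_two⟩

/-- The cutoff at radius `R`. -/
def cutoff (N : ℕ) (R : ℝ) (x : Rn N) : ℝ := unitBump N (R⁻¹ • x)

theorem cutoff_isTest {R : ℝ} (hR : 0 < R) : IsTest (cutoff N R) := by
  refine ⟨(unitBump N).contDiff.comp (contDiff_const_smul _), ?_⟩
  exact (unitBump N).hasCompactSupport.comp_homeomorph
    (Homeomorph.smulOfNeZero R⁻¹ (inv_ne_zero hR.ne'))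

theorem cutoff_nonneg (R : ℝ) (x : Rn N) : 0 ≤ cutoff N R x := (unitBump N).nonneg

theorem cutoff_le_one (R : ℝ) (x : Rn N) : cutoff N R x ≤ 1 := (unitBump N).le_one

theorem cutoff_eq_one {R : ℝ} (hR : 0 < R) {x : Rn N} (hx : ‖x‖ ≤ R) : cutoff N R x = 1 := by
  refine (unitBump N).one_of_mem_closedBall ?_
  rw [mem_closedBall_zero_iff, norm_smul, norm_inv, Real.norm_eq_abs, abs_of_pos hR]
  change R⁻¹ * ‖x‖ ≤ 1
  rwa [inv_mul_le_iff₀ hR, mul_one]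

theorem fderiv_cutoff (R : ℝ) (x : Rn N) :
    fderiv ℝ (cutoff N R) x = R⁻¹ • fderiv ℝ (unitBump N) (R⁻¹ • x) :=
  fderiv_comp_smul ..

theorem tendsto_cutoff (x : Rn N) : Tendsto (fun R => cutoff N R x) atTop (𝓝 1) := by
  refine tendsto_const_nhds.congr' ?_
  filter_upwards [eventually_ge_atTop ‖x‖, eventually_gt_atTop 0] with R h1 h2
  rw [cutoff_eq_one h2 h1]

/-- The gradient of the cutoff at radius `R` is `O(1/R)`, and supported in the ball of radius
`2R`. -/
theorem exists_norm_fderiv_cutoff_le (N : ℕ) : ∃ C : ℝ, 0 ≤ C ∧ ∀ R : ℝ, 0 < R → ∀ x : Rn N,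
    ‖fderiv ℝ (cutoff N R) x‖ ≤ (Metric.closedBall (0 : Rn N) (2 * R)).indicator
      (fun _ => C / R) x := by
  obtain ⟨C, hC⟩ := ((unitBump N).contDiff (n := 1)).continuous_fderiv (by simp)
    |>.bounded_above_of_compact_support ((unitBump N).hasCompactSupport.fderiv ℝ)
  refine ⟨C, (norm_nonneg _).trans (hC 0), fun R hR x => ?_⟩
  by_cases hx : x ∈ Metric.closedBall (0 : Rn N) (2 * R)
  · rw [indicator_of_mem hx, fderiv_cutoff, norm_smul, norm_inv, Real.norm_eq_abs, abs_of_pos hR,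
      inv_mul_eq_div]
    gcongr
    exact hC _
  · rw [indicator_of_notMem hx, fderiv_cutoff]
    have : R⁻¹ • x ∉ tsupport (unitBump N) := by
      rw [(unitBump N).tsupport_eq, mem_closedBall_zero_iff, norm_smul, norm_inv,
        Real.norm_eq_abs, abs_of_pos hR, inv_mul_le_iff₀ hR]
      rw [mem_closedBall_zero_iff] at hx
      change ¬ (‖x‖ ≤ R * 2)
      linarith
    rw [fderiv_of_notMem_tsupport ℝ this, smul_zero, norm_zero]

theorem HasWeakPartial.cutoff_mul {i : Fin N} {f g : Rn N → ℂ} (h : HasWeakPartial i f g)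
    (hf : LocallyIntegrable f volume) (hg : LocallyIntegrable g volume)
    {χ : Rn N → ℝ} (hχ : IsTest χ) :
    HasWeakPartial i (fun x => (χ x : ℂ) * f x)
      (fun x => (χ x : ℂ) * g x + ((fderiv ℝ χ x (coordVec i) : ℝ) : ℂ) * f x) := by
  intro φ hφ
  have hφχ : IsTest (fun x => φ x * χ x) := ⟨hφ.1.mul hχ.1, hφ.2.mul_right⟩
  have h1 := h _ hφχ
  have hd : ∀ x, fderiv ℝ (fun x => φ x * χ x) x (coordVec i)
      = φ x * fderiv ℝ χ x (coordVec i) + χ x * fderiv ℝ φ x (coordVec i) := fun x => by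
    rw [fderiv_fun_mul (hφ.1.differentiable (by simp) x) (hχ.1.differentiable (by simp) x)]
    rfl
  obtain ⟨c1, s1⟩ := hφ.partial i
  obtain ⟨c2, s2⟩ := hχ.partial i
  have i1 : Integrable (fun x => ((χ x * fderiv ℝ φ x (coordVec i) : ℝ) : ℂ) * f x) :=
    integrable_test_mul hf (hχ.1.continuous.mul c1) s1.mul_left
  have i2 : Integrable (fun x => ((φ x * fderiv ℝ χ x (coordVec i) : ℝ) : ℂ) * f x) :=
    integrable_test_mul hf (hφ.1.continuous.mul c2) s2.mul_left
  have i3 := integrable_test_mul hg hφχ.1.continuous hφχ.2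
  have e1 : ∫ x, ((fderiv ℝ (fun x => φ x * χ x) x (coordVec i) : ℝ) : ℂ) * f x
      = (∫ x, ((φ x * fderiv ℝ χ x (coordVec i) : ℝ) : ℂ) * f x)
        + ∫ x, ((χ x * fderiv ℝ φ x (coordVec i) : ℝ) : ℂ) * f x := by
    rw [← integral_add i2 i1]
    refine integral_congr_ae (.of_forall fun x => ?_)
    simp only [hd]
    push_cast
    ring
  have e2 : ∫ x, ((φ x : ℝ) : ℂ) *
        ((χ x : ℂ) * g x + ((fderiv ℝ χ x (coordVec i) : ℝ) : ℂ) * f x)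
      = (∫ x, ((φ x * χ x : ℝ) : ℂ) * g x)
        + ∫ x, ((φ x * fderiv ℝ χ x (coordVec i) : ℝ) : ℂ) * f x := by
    rw [← integral_add i3 i2]
    refine integral_congr_ae (.of_forall fun x => ?_)
    simp only
    push_cast
    ring
  have e3 : ∫ x, ((fderiv ℝ φ x (coordVec i) : ℝ) : ℂ) * ((χ x : ℂ) * f x)
      = ∫ x, ((χ x * fderiv ℝ φ x (coordVec i) : ℝ) : ℂ) * f x := by
    refine integral_congr_ae (.of_forall fun x => ?_)
    simp only
    push_cast
    ring
  rw [e3, e2]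
  rw [e1] at h1
  linear_combination h1

theorem exists_abs_partial_cutoff_le (i : Fin N) : ∃ C : ℝ, 0 ≤ C ∧ ∀ R : ℝ, 0 < R →
    ∀ x : Rn N, |fderiv ℝ (cutoff N R) x (coordVec i)| ≤
      (Metric.closedBall (0 : Rn N) (2 * R)).indicator (fun _ => C / R) x := by
  obtain ⟨C, hC0, hC⟩ := exists_norm_fderiv_cutoff_le N
  refine ⟨C, hC0, fun R hR x => ?_⟩
  have := (fderiv ℝ (cutoff N R) x).le_opNorm (coordVec i)
  rw [PiLp.norm_single, norm_one, mul_one, Real.norm_eq_abs] at this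
  exact this.trans (hC R hR x)

theorem tendsto_partial_cutoff (i : Fin N) (x : Rn N) :
    Tendsto (fun R => ((fderiv ℝ (cutoff N R) x (coordVec i) : ℝ) : ℂ)) atTop (𝓝 0) := by
  obtain ⟨C, hC0, hC⟩ := exists_abs_partial_cutoff_le (N := N) i
  rw [tendsto_zero_iff_norm_tendsto_zero]
  refine squeeze_zero' (.of_forall fun _ => norm_nonneg _) ?_
    (tendsto_const_nhds (x := C).div_atTop tendsto_id)
  filter_upwards [eventually_gt_atTop 0] with R hR0
  rw [Complex.norm_real]
  exact (hC R hR0 x).trans (indicator_le_self' (fun _ _ => by positivity) x)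

theorem tendsto_cutoff_complex (x : Rn N) :
    Tendsto (fun R => ((cutoff N R x : ℝ) : ℂ)) atTop (𝓝 1) := by
  exact_mod_cast (Complex.continuous_ofReal.tendsto 1).comp (tendsto_cutoff x)

theorem norm_cutoff_mul_le (R : ℝ) (x : Rn N) (z : ℂ) : ‖(cutoff N R x : ℂ) * z‖ ≤ ‖z‖ := by
  rw [norm_mul, Complex.norm_real, Real.norm_eq_abs, abs_of_nonneg (cutoff_nonneg R x)]
  exact mul_le_of_le_one_left (norm_nonneg _) (cutoff_le_one R x)

/-- Multiplication by the cutoffs converges in `L¹`. -/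
theorem tendsto_integral_cutoff_mul {h : Rn N → ℂ} (hh : Integrable h) :
    Tendsto (fun R : ℝ => ∫ x, (cutoff N R x : ℂ) * h x) atTop (𝓝 (∫ x, h x)) := by
  refine tendsto_integral_filter_of_dominated_convergence (fun x => ‖h x‖) ?_ ?_ hh.norm ?_
  · filter_upwards [eventually_gt_atTop 0] with R hR
    have c1 := (cutoff_isTest (N := N) hR).1.continuous
    exact (by fun_prop : Continuous fun x => (cutoff N R x : ℂ)).aestronglyMeasurable.mul hh.1
  · exact .of_forall fun R => .of_forall fun x => norm_cutoff_mul_le R x _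
  · refine .of_forall fun x => ?_
    simpa using (tendsto_cutoff_complex x).mul_const (h x)

theorem tendsto_integral_partial_cutoff_mul (i : Fin N) {h : Rn N → ℂ} (hh : Integrable h) :
    Tendsto (fun R : ℝ => ∫ x, ((fderiv ℝ (cutoff N R) x (coordVec i) : ℝ) : ℂ) * h x) atTop
      (𝓝 0) := by
  obtain ⟨C, hC0, hC⟩ := exists_abs_partial_cutoff_le (N := N) i
  have h0 : (0 : ℂ) = ∫ _ : Rn N, (0 : ℂ) := by simp
  rw [h0]
  refine tendsto_integral_filter_of_dominated_convergence (fun x => C * ‖h x‖) ?_ ?_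
    (hh.norm.const_mul C) ?_
  · filter_upwards [eventually_gt_atTop 0] with R hR
    have c2 := ((cutoff_isTest (N := N) hR).partial i).1
    exact (Complex.continuous_ofReal.comp c2).aestronglyMeasurable.mul hh.1
  · filter_upwards [eventually_ge_atTop 1] with R hR
    refine .of_forall fun x => ?_
    rw [norm_mul, Complex.norm_real]
    gcongr
    refine (hC R (by linarith) x).trans ?_
    exact (indicator_le_self' (fun _ _ => by positivity) x).trans (div_le_self hC0 hR)
  · refine .of_forall fun x => ?_
    simpa using (tendsto_partial_cutoff i x).mul_const (h x)

theorem HasWeakPartial.integral_cutoff_schwartz {i : Fin N} {f g : Rn N → ℂ}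
    (h : HasWeakPartial i f g)
    (hf : LocallyIntegrable f volume) (hg : LocallyIntegrable g volume) (ψ : 𝓢(Rn N, ℂ))
    {R : ℝ} (hR : 0 < R) :
    ∫ x, ((cutoff N R x : ℂ) * ((∂_{coordVec i} ψ) x * f x)
      + ((fderiv ℝ (cutoff N R) x (coordVec i) : ℝ) : ℂ) * (ψ x * f x))
      = - ∫ x, (cutoff N R x : ℂ) * (ψ x * g x) := by
  have hχ := cutoff_isTest (N := N) hR
  have hc : ContDiff ℝ ∞ (fun x => (cutoff N R x : ℂ)) :=
    Complex.ofRealCLM.contDiff.comp hχ.1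
  have hd := h.integral_complex hf hg (φ := fun x => (cutoff N R x : ℂ) * ψ x)
    (hc.mul (ψ.smooth _)) ((hχ.2.comp_left (g := fun r : ℝ => (r : ℂ)) rfl).mul_right)
  simp only [mul_assoc] at hd
  rw [← hd]
  refine integral_congr_ae (.of_forall fun x => ?_)
  have e := (Complex.ofRealCLM.hasFDerivAt.comp x
    (hχ.1.differentiable (by simp) x).hasFDerivAt).mul (ψ.hasFDerivAt x)
  have e' : fderiv ℝ (fun x => (cutoff N R x : ℂ) * ψ x) x = _ := e.fderiv
  simp only [e', SchwartzMap.lineDerivOp_apply_eq_fderiv, add_apply, smul_apply, smul_eq_mul,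
    Function.comp, ContinuousLinearMap.comp_apply, Complex.ofRealCLM_apply]
  ring

/-- For `L²` functions, weak derivatives may be tested with Schwartz functions. -/
theorem HasWeakPartial.integral_schwartz {i : Fin N} {f g : Rn N → ℂ} (h : HasWeakPartial i f g)
    (hf : MemLp f 2 volume) (hg : MemLp g 2 volume) (ψ : 𝓢(Rn N, ℂ)) :
    ∫ x, (∂_{coordVec i} ψ) x * f x = - ∫ x, ψ x * g x := by
  have m1 : Integrable (fun x => (∂_{coordVec i} ψ) x * f x) :=
    ((∂_{coordVec i} ψ).memLp 2 volume).integrable_mul hf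
  have m2 : Integrable (fun x => ψ x * f x) := (ψ.memLp 2 volume).integrable_mul hf
  have m3 : Integrable (fun x => ψ x * g x) := (ψ.memLp 2 volume).integrable_mul hg
  have l1 := (tendsto_integral_cutoff_mul m1).add (tendsto_integral_partial_cutoff_mul i m2)
  have l2 := (tendsto_integral_cutoff_mul m3).neg
  rw [add_zero] at l1
  refine tendsto_nhds_unique l1 (l2.congr' ?_)
  filter_upwards [eventually_gt_atTop 0] with R hR
  rw [← h.integral_cutoff_schwartz (hf.locallyIntegrable (by norm_num))
    (hg.locallyIntegrable (by norm_num)) ψ hR]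
  have hχ := cutoff_isTest (N := N) hR
  obtain ⟨C, hC0, hC⟩ := exists_abs_partial_cutoff_le (N := N) i
  refine integral_add ?_ ?_
  · exact m1.mono ((Complex.continuous_ofReal.comp hχ.1.continuous).aestronglyMeasurable.mul m1.1)
      (.of_forall fun x => norm_cutoff_mul_le R x _)
  · refine m2.bdd_mul (c := C / R)
      (Complex.continuous_ofReal.comp (hχ.partial i).1).aestronglyMeasurable
      (.of_forall fun x => ?_)
    change ‖((fderiv ℝ (cutoff N R) x (coordVec i) : ℝ) : ℂ)‖ ≤ _
    rw [Complex.norm_real]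
    exact (hC R hR x).trans (indicator_le_self' (fun _ _ => by positivity) x)

/-! ### Weak derivatives on the Fourier side -/

theorem integral_fourier_mul_L2 (f : L2 N) (ψ : 𝓢(Rn N, ℂ)) :
    ∫ x, (𝓕 ψ) x * f x = ∫ x, ψ x * (𝓕 f : L2 N) x := by
  have h := congrArg (fun T : 𝓢'(Rn N, ℂ) => T ψ) (Lp.fourier_toTemperedDistribution_eq f)
  simpa using h

theorem integral_fourierInv_mul_L2 (f : L2 N) (ψ : 𝓢(Rn N, ℂ)) :
    ∫ x, (𝓕⁻ ψ) x * (𝓕 f : L2 N) x = ∫ x, ψ x * f x := by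
  rw [← integral_fourier_mul_L2 f (𝓕⁻ ψ), FourierTransform.fourier_fourierInv_eq]

/-- A real test function, as a complex Schwartz function. -/
def IsTest.toSchwartz {φ : Rn N → ℝ} (h : IsTest φ) : 𝓢(Rn N, ℂ) :=
  HasCompactSupport.toSchwartzMap (f := fun x => (φ x : ℂ))
    (h.2.comp_left (g := fun r : ℝ => (r : ℂ)) rfl) (Complex.ofRealCLM.contDiff.comp h.1)

@[simp] theorem IsTest.toSchwartz_apply {φ : Rn N → ℝ} (h : IsTest φ) (x : Rn N) :
    h.toSchwartz x = φ x := rfl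

theorem IsTest.lineDeriv_toSchwartz {φ : Rn N → ℝ} (h : IsTest φ) (m x : Rn N) :
    (∂_{m} h.toSchwartz) x = ((fderiv ℝ φ x m : ℝ) : ℂ) := by
  rw [SchwartzMap.lineDerivOp_apply_eq_fderiv]
  have := (Complex.ofRealCLM.hasFDerivAt.comp x
    (h.1.differentiable (by simp) x).hasFDerivAt).fderiv
  exact congrArg (fun L => L m) this

/-- A locally integrable function is determined by its pairings with test functions. -/
theorem ae_eq_of_integral_test {f g : Rn N → ℂ} (hf : LocallyIntegrable f volume)
    (hg : LocallyIntegrable g volume)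
    (h : ∀ φ : Rn N → ℝ, IsTest φ → ∫ x, (φ x : ℂ) * f x = ∫ x, (φ x : ℂ) * g x) :
    f =ᵐ[volume] g := by
  refine ae_eq_of_integral_contDiff_smul_eq hf hg fun φ h1 h2 => ?_
  simpa [Complex.real_smul] using h φ ⟨h1, h2⟩

/-- The symbol `2πi ξ_i` of the `i`-th partial derivative. -/
def partialSymbol (i : Fin N) (ξ : Rn N) : ℂ := 2 * Real.pi * Complex.I * (ξ i : ℂ)

theorem continuous_partialSymbol (i : Fin N) : Continuous (partialSymbol i) := by
  unfold partialSymbol; fun_prop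

theorem conj_partialSymbol (i : Fin N) (ξ : Rn N) :
    conj (partialSymbol i ξ) = - partialSymbol i ξ := by
  simp [partialSymbol, Complex.conj_ofNat]

theorem inner_coordVec (i : Fin N) (ξ : Rn N) : inner ℝ ξ (coordVec i) = ξ i := by
  simpa using EuclideanSpace.inner_single_right i (1 : ℝ) ξ

theorem exists_lineDeriv_fourier_eq (i : Fin N) (ψ : 𝓢(Rn N, ℂ)) :
    ∃ θ : 𝓢(Rn N, ℂ), (∀ ξ, θ ξ = - partialSymbol i ξ * ψ ξ) ∧ ∂_{coordVec i} (𝓕 ψ) = 𝓕 θ := by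
  refine ⟨_, fun ξ => ?_, SchwartzMap.lineDerivOp_fourier_eq ψ (coordVec i)⟩
  have : (fun ξ : Rn N => inner ℝ ξ (coordVec i)).HasTemperateGrowth := by fun_prop
  rw [smul_apply, SchwartzMap.smulLeftCLM_apply_apply this, inner_coordVec]
  simp [partialSymbol]
  ring

/-- The weak `i`-th derivative of an `L²` function is multiplication by `2πi ξ_i` on the Fourier
side. -/
theorem HasWeakPartial.fourier {i : Fin N} {f g : L2 N} (h : HasWeakPartial i f g) :
    ∀ᵐ ξ, (𝓕 g : L2 N) ξ = partialSymbol i ξ * (𝓕 f : L2 N) ξ := by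
  have hl : LocallyIntegrable (fun ξ => partialSymbol i ξ * (𝓕 f : L2 N) ξ) volume := by
    refine (locallyIntegrableOn_univ.1 ?_)
    have h2 := (locallyIntegrableOn_univ.2 (locInt (𝓕 f : L2 N))).continuousOn_smul
      isOpen_univ.isLocallyClosed (continuous_partialSymbol i).continuousOn
    simpa using h2
  refine ae_eq_of_integral_test (locInt (𝓕 g : L2 N)) hl fun φ hφ => ?_
  obtain ⟨θ, hθ, hd⟩ := exists_lineDeriv_fourier_eq i hφ.toSchwartz
  have h1 := h.integral_schwartz (Lp.memLp f) (Lp.memLp g) (𝓕 hφ.toSchwartz)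
  rw [hd, integral_fourier_mul_L2, integral_fourier_mul_L2] at h1
  simp only [hθ, IsTest.toSchwartz_apply] at h1
  rw [← neg_eq_iff_eq_neg] at h1
  rw [← h1, ← integral_neg]
  refine integral_congr_ae (.of_forall fun x => ?_)
  simp only
  ring

theorem hasWeakPartial_of_fourier {i : Fin N} {f g : L2 N}
    (h : ∀ᵐ ξ, (𝓕 g : L2 N) ξ = partialSymbol i ξ * (𝓕 f : L2 N) ξ) : HasWeakPartial i f g := by
  intro φ hφ
  obtain ⟨θ, hθ, hd⟩ := exists_lineDeriv_fourier_eq i (𝓕⁻ hφ.toSchwartz)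
  rw [FourierTransform.fourier_fourierInv_eq] at hd
  have h1 : ∫ x, (∂_{coordVec i} hφ.toSchwartz) x * f x = - ∫ x, hφ.toSchwartz x * g x := by
    rw [hd, integral_fourier_mul_L2, ← integral_fourierInv_mul_L2 g, ← integral_neg]
    refine integral_congr_ae ?_
    filter_upwards [h] with ξ hξ
    rw [hξ, hθ]
    ring
  simpa [IsTest.lineDeriv_toSchwartz] using h1

theorem inner_L2_eq (f g : L2 N) : ⟪f, g⟫_ℂ = ∫ x, g x * conj (f x) := by
  simp [L2.inner_def]

/-- Integration by parts for weak derivatives in `L²`. -/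
theorem HasWeakPartial.inner_eq {i : Fin N} {g k f h : L2 N} (h1 : HasWeakPartial i g k)
    (h2 : HasWeakPartial i f h) : ⟪k, f⟫_ℂ = - ⟪g, h⟫_ℂ := by
  rw [← Lp.inner_fourier_eq k f, ← Lp.inner_fourier_eq g h, inner_L2_eq, inner_L2_eq,
    ← integral_neg]
  refine integral_congr_ae ?_
  filter_upwards [h1.fourier, h2.fourier] with ξ e1 e2
  rw [e1, e2, map_mul, conj_partialSymbol]
  ring

/-! ### Pointwise bounds and integrability of `G_λ` -/

/-- The integrand in the definition of `G_λ`: the heat kernel at time `t` times `e^{-λt}`. -/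
def greenIntegrand (N : ℕ) (lam : ℝ) (x : Rn N) (t : ℝ) : ℝ :=
  (4 * Real.pi * t) ^ (-(N : ℝ) / 2) * Real.exp (-lam * t - ‖x‖ ^ 2 / (4 * t))

theorem green_eq (N : ℕ) (lam : ℝ) (x : Rn N) :
    green N lam x = ((∫ t in Ioi (0 : ℝ), greenIntegrand N lam x t : ℝ) : ℂ) := rfl

theorem conj_green (N : ℕ) (lam : ℝ) (x : Rn N) : conj (green N lam x) = green N lam x := by
  rw [green_eq, Complex.conj_ofReal]

theorem greenIntegrand_nonneg (lam : ℝ) (x : Rn N) {t : ℝ} (ht : 0 < t) :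
    0 ≤ greenIntegrand N lam x t := by
  unfold greenIntegrand; positivity

theorem measurable_greenIntegrand (lam : ℝ) :
    Measurable (fun z : Rn N × ℝ => greenIntegrand N lam z.1 z.2) := by
  unfold greenIntegrand
  fun_prop

theorem aestronglyMeasurable_green (lam : ℝ) :
    AEStronglyMeasurable (green N lam) volume := by
  have h : StronglyMeasurable (fun x : Rn N => ∫ t in Ioi (0 : ℝ), greenIntegrand N lam x t) :=
    (measurable_greenIntegrand lam).stronglyMeasurable.integral_prod_right
  exact (Complex.continuous_ofReal.comp_stronglyMeasurable h).aestronglyMeasurable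

theorem rpow_mul_exp_neg_le {θ s : ℝ} (hθ : 0 < θ) (hs : 0 ≤ s) :
    s ^ θ * Real.exp (-s) ≤ θ ^ θ := by
  have h1 : s ≤ θ * Real.exp (s / θ) := by
    have := Real.add_one_le_exp (s / θ)
    have h2 : s / θ ≤ Real.exp (s / θ) := by linarith
    rwa [div_le_iff₀' hθ] at h2
  have h2 : s ^ θ ≤ θ ^ θ * Real.exp s := by
    refine (Real.rpow_le_rpow hs h1 hθ.le).trans (le_of_eq ?_)
    rw [Real.mul_rpow hθ.le (Real.exp_pos _).le, ← Real.exp_mul, div_mul_cancel₀ _ hθ.ne']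
  rw [Real.exp_neg, ← div_eq_mul_inv, div_le_iff₀ (Real.exp_pos s)]
  exact h2

/-- Half of the exponent `λt + r²/(4t)` controls `√λ r / 2`, by the arithmetic-geometric mean
inequality; the other half leaves integrability in `t`, at the price of a power of `r`. -/
theorem greenIntegrand_le {lam θ : ℝ} (hl : 0 < lam) (hθ : 0 < θ) {x : Rn N} (hx : x ≠ 0)
    {t : ℝ} (ht : 0 < t) :
    greenIntegrand N lam x t ≤
      ((4 * Real.pi) ^ (-(N : ℝ) / 2) * (8 * θ) ^ θ) *
        (‖x‖ ^ (-(2 * θ)) * Real.exp (-(Real.sqrt lam / 2) * ‖x‖)) *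
        (t ^ (θ - N / 2) * Real.exp (-(lam / 2) * t)) := by
  have hr : 0 < ‖x‖ := norm_pos_iff.2 hx
  set r := ‖x‖ with hrdef
  set a := Real.sqrt lam with ha
  have ha2 : a ^ 2 = lam := Real.sq_sqrt hl.le
  set s := r ^ 2 / (8 * t) with hs
  have hspos : 0 < s := by positivity
  have e1 : -lam * t - r ^ 2 / (4 * t) ≤ -(a / 2) * r + -(lam / 2) * t + -s := by
    have h : 0 ≤ (2 * a * t - r) ^ 2 / (8 * t) := by positivity
    have h' : (2 * a * t - r) ^ 2 / (8 * t) = a ^ 2 * t / 2 - a * r / 2 + r ^ 2 / (8 * t) := by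
      field_simp; ring
    have h3 : r ^ 2 / (4 * t) = 2 * s := by rw [hs]; field_simp; ring
    rw [h', ha2, ← hs] at h
    rw [h3]
    linarith
  have e2 : Real.exp (-s) ≤ θ ^ θ * s ^ (-θ) := by
    have := rpow_mul_exp_neg_le hθ hspos.le
    rw [Real.rpow_neg hspos.le, ← div_eq_mul_inv, le_div_iff₀ (by positivity), mul_comm]
    exact this
  have e3 : s ^ (-θ) = 8 ^ θ * t ^ θ * r ^ (-(2 * θ)) := by
    rw [hs, Real.div_rpow (by positivity) (by positivity), Real.rpow_neg (by positivity),
      Real.rpow_neg (by positivity), ← Real.rpow_natCast r 2, ← Real.rpow_mul hr.le,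
      Real.mul_rpow (by norm_num) ht.le, Real.rpow_neg hr.le]
    push_cast
    field_simp
  unfold greenIntegrand
  rw [← hrdef, Real.mul_rpow (by positivity) ht.le, Real.mul_rpow (by norm_num) hθ.le,
    Real.rpow_sub ht, neg_div, Real.rpow_neg ht.le]
  calc (4 * Real.pi) ^ (-((N : ℝ) / 2)) * (t ^ ((N : ℝ) / 2))⁻¹ *
        Real.exp (-lam * t - r ^ 2 / (4 * t))
      ≤ (4 * Real.pi) ^ (-((N : ℝ) / 2)) * (t ^ ((N : ℝ) / 2))⁻¹ *
        (Real.exp (-(a / 2) * r) * Real.exp (-(lam / 2) * t) *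
          (θ ^ θ * (8 ^ θ * t ^ θ * r ^ (-(2 * θ))))) := by
        gcongr
        refine (Real.exp_le_exp.2 e1).trans ?_
        rw [Real.exp_add, Real.exp_add]
        gcongr
        rw [← e3]
        exact e2
    _ = _ := by ring

theorem integrableOn_rpow_mul_exp {s b : ℝ} (hs : -1 < s) (hb : 0 < b) :
    IntegrableOn (fun t : ℝ => t ^ s * Real.exp (-b * t)) (Ioi 0) := by
  have := integrableOn_rpow_mul_exp_neg_mul_rpow hs one_pos hb
  simpa using this

theorem integrableOn_greenIntegrand {lam : ℝ} (hl : 0 < lam) {x : Rn N} (hx : x ≠ 0) :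
    IntegrableOn (greenIntegrand N lam x) (Ioi 0) := by
  have h := (integrableOn_rpow_mul_exp (s := ((N : ℝ) / 2 + 1) - N / 2) (by linarith)
    (half_pos hl)).const_mul (((4 * Real.pi) ^ (-(N : ℝ) / 2) *
      (8 * ((N : ℝ) / 2 + 1)) ^ ((N : ℝ) / 2 + 1)) *
        (‖x‖ ^ (-(2 * ((N : ℝ) / 2 + 1))) * Real.exp (-(Real.sqrt lam / 2) * ‖x‖)))
  refine h.mono' ?_ ?_
  · exact ((measurable_greenIntegrand lam).comp measurable_prodMk_left).aestronglyMeasurable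
  · refine (ae_restrict_iff' measurableSet_Ioi).2 (.of_forall fun t ht => ?_)
    rw [Real.norm_eq_abs, abs_of_nonneg (greenIntegrand_nonneg lam x ht)]
    exact greenIntegrand_le hl (by positivity) hx ht

/-- `|G_λ(x)| ≤ C |x|^{-2θ} e^{-√λ|x|/2}` whenever `2θ > N - 2`. -/
theorem exists_norm_green_le {lam θ : ℝ} (hl : 0 < lam) (hθ : 0 < θ) (hN : (N : ℝ) / 2 - 1 < θ) :
    ∃ C : ℝ, 0 ≤ C ∧ ∀ x : Rn N, x ≠ 0 →
      ‖green N lam x‖ ≤ C * (‖x‖ ^ (-(2 * θ)) * Real.exp (-(Real.sqrt lam / 2) * ‖x‖)) := by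
  set K := (4 * Real.pi) ^ (-(N : ℝ) / 2) * (8 * θ) ^ θ
  set I := ∫ t in Ioi (0 : ℝ), t ^ (θ - N / 2) * Real.exp (-(lam / 2) * t)
  have hI : 0 ≤ I := setIntegral_nonneg measurableSet_Ioi fun t ht => by
    have : (0 : ℝ) < t := ht
    positivity
  refine ⟨K * I, by positivity, fun x hx => ?_⟩
  rw [green_eq, Complex.norm_real, Real.norm_eq_abs, abs_of_nonneg
    (setIntegral_nonneg measurableSet_Ioi fun t ht => greenIntegrand_nonneg lam x ht)]
  have h := setIntegral_mono_on (integrableOn_greenIntegrand hl hx)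
    ((integrableOn_rpow_mul_exp (s := θ - N / 2) (by linarith) (half_pos hl)).const_mul
      (K * (‖x‖ ^ (-(2 * θ)) * Real.exp (-(Real.sqrt lam / 2) * ‖x‖)))) measurableSet_Ioi
    (fun t ht => greenIntegrand_le hl hθ hx ht)
  rw [integral_const_mul] at h
  refine h.trans (le_of_eq ?_)
  ring

/-- `G_λ ∈ L^q` for `1 ≤ q < N / (N - 2)`. -/
theorem memLp_green (hN : 2 ≤ N) {lam q : ℝ} (hl : 0 < lam) (hq : 0 < q)
    (hqN : ((N : ℝ) - 2) * q < N) : MemLp (green N lam) (ENNReal.ofReal q) volume := by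
  have : Nontrivial (Rn N) := by
    have : NeZero N := ⟨by omega⟩
    infer_instance
  have hN' : (2 : ℝ) ≤ N := by exact_mod_cast hN
  have hNq : (N : ℝ) - 2 < N / q := by rwa [lt_div_iff₀ hq]
  -- the midpoint of the admissible range `N - 2 < 2θ < N / q`
  set θ := ((N : ℝ) - 2 + N / q) / 4 with hθdef
  have hNq0 : 0 < (N : ℝ) / q := by positivity
  have hθ : 0 < θ := by
    rw [hθdef]; linarith
  have hθ2 : 2 * θ * q < N := by
    rw [← lt_div_iff₀ hq]; linarith
  obtain ⟨C, hC0, hC⟩ := exists_norm_green_le (N := N) hl hθ (by rw [hθdef]; linarith)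
  have hb : 0 < Real.sqrt lam / 2 := by positivity
  set b := Real.sqrt lam / 2
  set g : ℝ → ℝ := fun r => C * (r ^ (-(2 * θ)) * Real.exp (-b * r))
  have hg : Integrable (fun x : Rn N => (g ‖x‖) ^ q) := by
    rw [integrable_fun_norm_addHaar volume (f := fun r => g r ^ q), finrank_euclideanSpace_fin]
    have h := (integrableOn_rpow_mul_exp (s := (N : ℝ) - 1 - 2 * θ * q) (b := b * q)
      (by linarith) (by positivity)).const_mul (C ^ q)
    refine IntegrableOn.congr_fun h (fun r hr => ?_) measurableSet_Ioi
    have hr : (0 : ℝ) < r := hr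
    simp only [g, smul_eq_mul]
    rw [Real.mul_rpow hC0 (by positivity), Real.mul_rpow (by positivity) (by positivity),
      ← Real.rpow_mul hr.le, ← Real.exp_mul, ← Real.rpow_natCast r (N - 1), Nat.cast_sub (by omega),
      sub_eq_add_neg _ (2 * θ * q), Real.rpow_add hr, Nat.cast_one]
    have e1 : -(2 * θ) * q = -(2 * θ * q) := by ring
    have e2 : -b * r * q = -(b * q) * r := by ring
    rw [e1, e2]
    ring
  have hq0 : ENNReal.ofReal q ≠ 0 := by simpa using hq
  rw [← integrable_norm_rpow_iff (aestronglyMeasurable_green lam) hq0 ENNReal.ofReal_ne_top,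
    ENNReal.toReal_ofReal hq.le]
  refine hg.mono' ((aestronglyMeasurable_green lam).norm.aemeasurable.pow_const q
    |>.aestronglyMeasurable) ?_
  have h0 : ∀ᵐ x : Rn N, x ≠ 0 := by
    simp [ae_iff]
  filter_upwards [h0] with x hx
  rw [Real.norm_eq_abs, abs_of_nonneg (by positivity)]
  exact Real.rpow_le_rpow (norm_nonneg _) (hC x hx) hq.le

/-! ### The Fourier transform of `G_λ` -/

/-- The symbol `1 / (λ + 4π²|ξ|²)` of the resolvent, the Fourier transform of `G_λ`. -/
def resolventSymbol (N : ℕ) (lam : ℝ) (ξ : Rn N) : ℝ := (lam + 4 * Real.pi ^ 2 * ‖ξ‖ ^ 2)⁻¹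

theorem resolvent_pos {lam : ℝ} (hl : 0 < lam) (ξ : Rn N) :
    0 < lam + 4 * Real.pi ^ 2 * ‖ξ‖ ^ 2 := by positivity

theorem continuous_resolventSymbol {lam : ℝ} (hl : 0 < lam) :
    Continuous (resolventSymbol N lam) := by
  unfold resolventSymbol
  exact Continuous.inv₀ (by fun_prop) fun ξ => (resolvent_pos hl ξ).ne'

theorem resolventSymbol_pos {lam : ℝ} (hl : 0 < lam) (ξ : Rn N) :
    0 < resolventSymbol N lam ξ := inv_pos.2 (resolvent_pos hl ξ)

theorem resolventSymbol_mul {lam : ℝ} (hl : 0 < lam) (ξ : Rn N) :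
    resolventSymbol N lam ξ * (lam + 4 * Real.pi ^ 2 * ‖ξ‖ ^ 2) = 1 :=
  inv_mul_cancel₀ (resolvent_pos hl ξ).ne'

theorem integral_exp_neg_symbol {lam : ℝ} (hl : 0 < lam) (ξ : Rn N) :
    ∫ t in Ioi (0 : ℝ), Real.exp (-(lam + 4 * Real.pi ^ 2 * ‖ξ‖ ^ 2) * t)
      = resolventSymbol N lam ξ := by
  rw [integral_exp_mul_Ioi (neg_lt_zero.2 (resolvent_pos hl ξ))]
  rw [mul_zero, Real.exp_zero, neg_div_neg_eq, one_div, resolventSymbol]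

theorem integrable_exp_neg_sq {b : ℝ} (hb : 0 < b) :
    Integrable (fun x : Rn N => Real.exp (-b * ‖x‖ ^ 2)) := by
  have := (GaussianFourier.integrable_cexp_neg_mul_sq_norm_add (V := Rn N) (b := (b : ℂ))
    (by simpa) 0 0).norm
  refine this.congr (.of_forall fun x => ?_)
  simp only [zero_mul, add_zero]
  rw [Complex.norm_exp]
  congr 1
  have : -(b : ℂ) * (‖x‖ : ℂ) ^ 2 = ((-b * ‖x‖ ^ 2 : ℝ) : ℂ) := by push_cast; ring
  rw [this, Complex.ofReal_re]

theorem greenIntegrand_eq (lam : ℝ) (x : Rn N) (t : ℝ) :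
    greenIntegrand N lam x t = (4 * Real.pi * t) ^ (-(N : ℝ) / 2) * Real.exp (-lam * t) *
      Real.exp (-(4 * t)⁻¹ * ‖x‖ ^ 2) := by
  unfold greenIntegrand
  rw [mul_assoc (_ ^ _), ← Real.exp_add]
  congr 2
  ring

theorem integrable_greenIntegrand_space (lam : ℝ) {t : ℝ} (ht : 0 < t) :
    Integrable (fun x : Rn N => greenIntegrand N lam x t) := by
  simp only [greenIntegrand_eq]
  exact (integrable_exp_neg_sq (by positivity)).const_mul _

theorem integral_greenIntegrand_space (lam : ℝ) {t : ℝ} (ht : 0 < t) :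
    ∫ x : Rn N, greenIntegrand N lam x t = Real.exp (-lam * t) := by
  simp only [greenIntegrand_eq]
  rw [integral_const_mul, GaussianFourier.integral_rexp_neg_mul_sq_norm (by positivity),
    finrank_euclideanSpace_fin]
  have : Real.pi / (4 * t)⁻¹ = 4 * Real.pi * t := by field_simp
  rw [this, neg_div, Real.rpow_neg (by positivity)]
  field_simp

/-- Fourier transform of the heat kernel, tested with a Schwartz function. -/
theorem integral_greenIntegrand_mul_fourier (lam : ℝ) {t : ℝ} (ht : 0 < t) (θ : 𝓢(Rn N, ℂ)) :
    ∫ x : Rn N, (greenIntegrand N lam x t : ℂ) * (𝓕 θ) x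
      = ∫ ξ, (Real.exp (-(lam + 4 * Real.pi ^ 2 * ‖ξ‖ ^ 2) * t) : ℂ) * θ ξ := by
  set b : ℝ := (4 * t)⁻¹ with hb
  have hbpos : 0 < b := by positivity
  set g : Rn N → ℂ := fun v => Complex.exp (-(b : ℂ) * (‖v‖ : ℂ) ^ 2) with hg
  have hgi : Integrable g := by
    have := GaussianFourier.integrable_cexp_neg_mul_sq_norm_add (V := Rn N) (b := (b : ℂ))
      (by simpa) 0 0
    simpa only [zero_mul, add_zero] using this
  have hF : ∀ w : Rn N, 𝓕 g w = (((4 * Real.pi * t) ^ ((N : ℝ) / 2) *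
      Real.exp (-(4 * Real.pi ^ 2 * ‖w‖ ^ 2) * t) : ℝ) : ℂ) := by
    intro w
    rw [hg, fourier_gaussian_innerProductSpace (by simpa) w, finrank_euclideanSpace_fin]
    have e1 : (Real.pi : ℂ) / (b : ℂ) = ((4 * Real.pi * t : ℝ) : ℂ) := by
      rw [hb]; push_cast; field_simp
    have e2 : -(Real.pi : ℂ) ^ 2 * (‖w‖ : ℂ) ^ 2 / (b : ℂ)
        = ((-(4 * Real.pi ^ 2 * ‖w‖ ^ 2) * t : ℝ) : ℂ) := by
      rw [hb]; push_cast; field_simp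
    have e3 : ((N : ℕ) : ℂ) / 2 = (((N : ℝ) / 2 : ℝ) : ℂ) := by push_cast; ring
    rw [e1, e2, e3, ← Complex.ofReal_cpow (by positivity), ← Complex.ofReal_exp,
      ← Complex.ofReal_mul]
  have key : ∫ w, 𝓕 g w * θ w = ∫ x, g x * 𝓕 (θ : Rn N → ℂ) x := by
    have := VectorFourier.integral_fourierIntegral_smul_eq_flip (μ := volume) (ν := volume)
      (L := innerₗ (Rn N)) (f := g) (g := (θ : Rn N → ℂ)) Real.continuous_fourierChar
      continuous_inner hgi θ.integrable
    rw [flip_innerₗ] at this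
    exact this
  have l : ∫ x : Rn N, (greenIntegrand N lam x t : ℂ) * (𝓕 θ) x
      = (((4 * Real.pi * t) ^ (-(N : ℝ) / 2) * Real.exp (-lam * t) : ℝ) : ℂ) *
        ∫ x, g x * 𝓕 (θ : Rn N → ℂ) x := by
    rw [← integral_const_mul]
    refine integral_congr_ae (.of_forall fun x => ?_)
    simp only [greenIntegrand_eq, hg, SchwartzMap.fourier_coe, ← hb]
    push_cast
    ring
  rw [l, ← key, ← integral_const_mul]
  refine integral_congr_ae (.of_forall fun x => ?_)
  simp only [hF]
  rw [← mul_assoc, ← Complex.ofReal_mul]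
  congr 2
  have e4 : (4 * Real.pi * t) ^ (-(N : ℝ) / 2) * (4 * Real.pi * t) ^ ((N : ℝ) / 2) = 1 := by
    rw [← Real.rpow_add (by positivity), neg_div, neg_add_cancel, Real.rpow_zero]
  have e5 : Real.exp (-(lam + 4 * Real.pi ^ 2 * ‖x‖ ^ 2) * t)
      = Real.exp (-lam * t) * Real.exp (-(4 * Real.pi ^ 2 * ‖x‖ ^ 2) * t) := by
    rw [← Real.exp_add]; congr 1; ring
  rw [e5]
  linear_combination (Real.exp (-lam * t) * Real.exp (-(4 * Real.pi ^ 2 * ‖x‖ ^ 2) * t)) * e4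

/-- `∫ G_λ 𝓕θ = ∫ θ / (λ + 4π²|ξ|²)`: the Fourier transform of `G_λ` is the resolvent symbol. -/
theorem integral_green_mul_fourier {lam : ℝ} (hl : 0 < lam) (θ : 𝓢(Rn N, ℂ)) :
    ∫ x, green N lam x * (𝓕 θ) x = ∫ ξ, (resolventSymbol N lam ξ : ℂ) * θ ξ := by
  set ν := (volume : Measure ℝ).restrict (Ioi 0)
  have hexp : Integrable (fun t => Real.exp (-lam * t)) ν := by
    have := integrableOn_rpow_mul_exp (s := 0) (by norm_num) hl
    simpa [IntegrableOn] using this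
  -- absolute integrability on both sides, for Fubini
  have i1 : Integrable (fun z : Rn N × ℝ => (greenIntegrand N lam z.1 z.2 : ℂ) * (𝓕 θ) z.1)
      (volume.prod ν) := by
    set B := SchwartzMap.seminorm ℝ 0 0 (𝓕 θ)
    have hB : ∀ x, ‖(𝓕 θ) x‖ ≤ B := fun x => SchwartzMap.norm_le_seminorm ℝ (𝓕 θ) x
    have hm : AEStronglyMeasurable (fun z : Rn N × ℝ =>
        (greenIntegrand N lam z.1 z.2 : ℂ)) (volume.prod ν) :=
      (Complex.measurable_ofReal.comp (measurable_greenIntegrand lam)).aestronglyMeasurable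
    refine Integrable.mul_bdd (c := B) ?_ ?_ (.of_forall fun z => hB z.1)
    · rw [integrable_prod_iff' hm]
      refine ⟨(ae_restrict_iff' measurableSet_Ioi).2 (.of_forall fun t ht =>
        (integrable_greenIntegrand_space lam ht).ofReal), ?_⟩
      refine hexp.congr ((ae_restrict_iff' measurableSet_Ioi).2 (.of_forall fun t ht => ?_))
      simp only
      rw [← integral_greenIntegrand_space lam ht]
      refine integral_congr_ae (.of_forall fun x => ?_)
      simp only [Complex.norm_real, Real.norm_eq_abs]
      rw [abs_of_nonneg (greenIntegrand_nonneg lam x ht)]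
    · exact ((𝓕 θ).continuous.comp continuous_fst).aestronglyMeasurable
  have i2 : Integrable (fun z : Rn N × ℝ =>
      (Real.exp (-(lam + 4 * Real.pi ^ 2 * ‖z.1‖ ^ 2) * z.2) : ℂ) * θ z.1) (volume.prod ν) := by
    have h := (θ.integrable (μ := volume)).mul_prod (f := (θ : Rn N → ℂ)) (hexp.ofReal (𝕜 := ℂ))
    refine h.mono ?_ ?_
    · exact (by fun_prop : Continuous fun z : Rn N × ℝ =>
        (Real.exp (-(lam + 4 * Real.pi ^ 2 * ‖z.1‖ ^ 2) * z.2) : ℂ)).aestronglyMeasurable.mul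
        (θ.continuous.comp continuous_fst).aestronglyMeasurable
    · have hae : ∀ᵐ z : Rn N × ℝ ∂(volume.prod ν), 0 < z.2 :=
        Measure.quasiMeasurePreserving_snd.ae (ae_restrict_mem measurableSet_Ioi)
      filter_upwards [hae] with z hz
      rw [norm_mul, norm_mul, mul_comm, Complex.norm_real,
        RCLike.norm_ofReal, Real.norm_eq_abs, Real.abs_exp, Real.abs_exp]
      gcongr
      have : 0 ≤ 4 * Real.pi ^ 2 * ‖z.1‖ ^ 2 := by positivity
      nlinarith
  calc ∫ x, green N lam x * (𝓕 θ) x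
      = ∫ x, ∫ t, (greenIntegrand N lam x t : ℂ) * (𝓕 θ) x ∂ν := by
        refine integral_congr_ae (.of_forall fun x => ?_)
        simp only
        rw [integral_mul_const, integral_complex_ofReal, green_eq]
    _ = ∫ t, (∫ x, (greenIntegrand N lam x t : ℂ) * (𝓕 θ) x) ∂ν := integral_integral_swap i1
    _ = ∫ t, (∫ ξ, (Real.exp (-(lam + 4 * Real.pi ^ 2 * ‖ξ‖ ^ 2) * t) : ℂ) * θ ξ) ∂ν := by
        refine integral_congr_ae ((ae_restrict_iff' measurableSet_Ioi).2
          (.of_forall fun t ht => ?_))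
        exact integral_greenIntegrand_mul_fourier lam ht θ
    _ = ∫ ξ, ∫ t, (Real.exp (-(lam + 4 * Real.pi ^ 2 * ‖ξ‖ ^ 2) * t) : ℂ) * θ ξ ∂ν :=
        (integral_integral_swap i2).symm
    _ = ∫ ξ, (resolventSymbol N lam ξ : ℂ) * θ ξ := by
        refine integral_congr_ae (.of_forall fun ξ => ?_)
        simp only
        rw [integral_mul_const, ← integral_exp_neg_symbol hl ξ, integral_complex_ofReal]

theorem memLp_green_two (h23 : N = 2 ∨ N = 3) {lam : ℝ} (hl : 0 < lam) :
    MemLp (green N lam) 2 volume := by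
  have h := memLp_green (N := N) (q := 2) (by omega) hl two_pos (by
    rcases h23 with rfl | rfl <;> norm_num)
  simpa using h

/-- `G_λ` as an element of `L²`. -/
def greenL2 (h23 : N = 2 ∨ N = 3) {lam : ℝ} (hl : 0 < lam) : L2 N :=
  (memLp_green_two h23 hl).toLp _

theorem coeFn_greenL2 (h23 : N = 2 ∨ N = 3) {lam : ℝ} (hl : 0 < lam) :
    greenL2 h23 hl =ᵐ[volume] green N lam := MemLp.coeFn_toLp _

theorem continuous_ofReal_resolventSymbol {lam : ℝ} (hl : 0 < lam) :
    Continuous (fun ξ : Rn N => (resolventSymbol N lam ξ : ℂ)) :=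
  Complex.continuous_ofReal.comp (continuous_resolventSymbol hl)

theorem fourier_greenL2 (h23 : N = 2 ∨ N = 3) {lam : ℝ} (hl : 0 < lam) :
    ∀ᵐ ξ, (𝓕 (greenL2 h23 hl) : L2 N) ξ = (resolventSymbol N lam ξ : ℂ) := by
  refine ae_eq_of_integral_test (locInt (𝓕 (greenL2 h23 hl) : L2 N))
    (continuous_ofReal_resolventSymbol hl).locallyIntegrable fun φ hφ => ?_
  have h1 := integral_fourier_mul_L2 (greenL2 h23 hl) hφ.toSchwartz
  have h2 := integral_green_mul_fourier hl hφ.toSchwartz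
  simp only [IsTest.toSchwartz_apply] at h1 h2
  rw [← h1, integral_congr_ae (g := fun ξ => (resolventSymbol N lam ξ : ℂ) * (φ ξ : ℂ))
    (.of_forall fun ξ => mul_comm _ _), ← h2]
  refine integral_congr_ae ?_
  filter_upwards [coeFn_greenL2 h23 hl] with x hx
  rw [hx, mul_comm]

open Laplacian in
theorem IsTest.laplacian_toSchwartz {φ : Rn N → ℝ} (h : IsTest φ) (x : Rn N) :
    (Δ h.toSchwartz) x = ((Laplacian.laplacian φ x : ℝ) : ℂ) := by
  rw [SchwartzMap.laplacian_apply]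
  have h2 : ContDiffAt ℝ 2 φ x := (h.1.of_le (by norm_cast)).contDiffAt
  exact h2.laplacian_CLM_comp_left (l := Complex.ofRealCLM)

theorem green_neg (lam : ℝ) (x : Rn N) : green N lam (-x) = green N lam x := by
  simp only [green, norm_neg]

theorem integral_green_mul_fourierInv {lam : ℝ} (hl : 0 < lam) (θ : 𝓢(Rn N, ℂ)) :
    ∫ x, green N lam x * (𝓕⁻ θ) x = ∫ ξ, (resolventSymbol N lam ξ : ℂ) * θ ξ := by
  rw [← integral_green_mul_fourier hl θ]
  refine Eq.trans ?_ (integral_neg_eq_self (fun x => green N lam x * (𝓕 θ) x) volume)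
  refine integral_congr_ae (.of_forall fun x => ?_)
  simp only
  rw [green_neg, SchwartzMap.fourierInv_coe, SchwartzMap.fourier_coe,
    Real.fourierInv_eq_fourier_neg]

open Laplacian in
theorem sub_laplacian_eq_fourierInv (lam : ℝ) (ψ : 𝓢(Rn N, ℂ)) :
    ∃ θ : 𝓢(Rn N, ℂ), (∀ ξ, θ ξ = (lam + 4 * Real.pi ^ 2 * ‖ξ‖ ^ 2 : ℝ) * (𝓕 ψ) ξ) ∧
      (lam : ℂ) • ψ - Δ ψ = 𝓕⁻ θ := by
  have ht : (fun ξ : Rn N => ‖ξ‖ ^ 2).HasTemperateGrowth := by fun_prop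
  refine ⟨(lam : ℂ) • 𝓕 ψ + ((2 * Real.pi) ^ 2 : ℝ) • SchwartzMap.smulLeftCLM ℂ
    (fun ξ : Rn N => ‖ξ‖ ^ 2) (𝓕 ψ), ?_, ?_⟩
  · intro ξ
    rw [add_apply, smul_apply, smul_apply, SchwartzMap.smulLeftCLM_apply_apply ht]
    simp
    ring
  · rw [SchwartzMap.laplacian_eq_fourierMultiplierCLM, FourierTransform.fourierInv_add,
      FourierTransform.fourierInv_smul, FourierTransform.fourierInv_smul,
      SchwartzMap.fourierMultiplierCLM_apply, FourierTransform.fourierInv_fourier_eq,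
      neg_smul, sub_neg_eq_add]

theorem isFundamentalSolution_green (h23 : N = 2 ∨ N = 3) {lam : ℝ} (hl : 0 < lam) :
    IsFundamentalSolution lam (green N lam) := by
  refine ⟨memLp_green_two h23 hl, fun φ hφ => ?_⟩
  obtain ⟨θ, hθ, h⟩ := sub_laplacian_eq_fourierInv lam hφ.toSchwartz
  have h1 := integral_green_mul_fourierInv hl θ
  rw [← h] at h1
  have h2 : ∫ ξ, (resolventSymbol N lam ξ : ℂ) * θ ξ = ((φ 0 : ℝ) : ℂ) := by
    have h3 : ∫ ξ, (𝓕 hφ.toSchwartz) ξ = (𝓕⁻ (𝓕 hφ.toSchwartz)) 0 := by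
      rw [SchwartzMap.fourierInv_coe, Real.fourierInv_eq]
      simp
    rw [FourierTransform.fourierInv_fourier_eq] at h3
    rw [← IsTest.toSchwartz_apply hφ, ← h3]
    refine integral_congr_ae (.of_forall fun ξ => ?_)
    simp only
    rw [hθ, ← mul_assoc, ← Complex.ofReal_mul, resolventSymbol_mul hl, Complex.ofReal_one,
      one_mul]
  rw [← h2, ← h1]
  refine integral_congr_ae (.of_forall fun x => ?_)
  simp only
  congr 1
  rw [sub_apply, smul_apply, IsTest.laplacian_toSchwartz, IsTest.toSchwartz_apply]
  push_cast
  rfl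

/-! ### The difference `G_λ - G_μ` -/

/-- The continuous representative of `G_λ - G_μ`. -/
def greenDiff (N : ℕ) (lam mu : ℝ) (x : Rn N) : ℝ :=
  ∫ t in Ioi (0 : ℝ), (4 * Real.pi * t) ^ (-(N : ℝ) / 2) *
    (Real.exp (-lam * t) - Real.exp (-mu * t)) * Real.exp (-‖x‖ ^ 2 / (4 * t))

theorem abs_exp_sub_exp_le {lam mu c t : ℝ} (h1 : c ≤ lam) (h2 : c ≤ mu) (ht : 0 < t) :
    |Real.exp (-lam * t) - Real.exp (-mu * t)| ≤ |lam - mu| * (t * Real.exp (-c * t)) := by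
  wlog h : lam ≤ mu generalizing lam mu
  · rw [abs_sub_comm, abs_sub_comm lam]
    exact this h2 h1 (le_of_not_ge h)
  have e : Real.exp (-mu * t) = Real.exp (-lam * t) * Real.exp (-(mu - lam) * t) := by
    rw [← Real.exp_add]; congr 1; ring
  have h3 : Real.exp (-(mu - lam) * t) ≤ 1 := Real.exp_le_one_iff.2 (by nlinarith)
  have h4 : 1 - Real.exp (-(mu - lam) * t) ≤ (mu - lam) * t := by
    have := Real.add_one_le_exp (-(mu - lam) * t)
    linarith
  have h5 : Real.exp (-lam * t) ≤ Real.exp (-c * t) := Real.exp_le_exp.2 (by nlinarith)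
  have e2 : Real.exp (-lam * t) - Real.exp (-mu * t)
      = Real.exp (-lam * t) * (1 - Real.exp (-(mu - lam) * t)) := by rw [e]; ring
  rw [e2, abs_mul, Real.abs_exp, abs_of_nonneg (by linarith), abs_sub_comm, abs_of_nonneg
    (by linarith)]
  calc _ ≤ Real.exp (-c * t) * ((mu - lam) * t) := by gcongr
    _ = _ := by ring

theorem four_pi_mul_rpow {t : ℝ} (ht : 0 < t) :
    (4 * Real.pi * t) ^ (-(N : ℝ) / 2) * t
      = (4 * Real.pi) ^ (-(N : ℝ) / 2) * t ^ (1 - (N : ℝ) / 2) := by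
  rw [Real.mul_rpow (by positivity) ht.le, mul_assoc]
  congr 1
  rw [show 1 - (N : ℝ) / 2 = -(N : ℝ) / 2 + 1 by ring, Real.rpow_add ht, Real.rpow_one]

theorem integrableOn_four_pi_mul (h23 : N = 2 ∨ N = 3) {c : ℝ} (hc : 0 < c) :
    IntegrableOn (fun t : ℝ => (4 * Real.pi * t) ^ (-(N : ℝ) / 2) * (t * Real.exp (-c * t)))
      (Ioi 0) := by
  have h := (integrableOn_rpow_mul_exp (s := 1 - (N : ℝ) / 2) (by
    rcases h23 with rfl | rfl <;> norm_num) hc).const_mul ((4 * Real.pi) ^ (-(N : ℝ) / 2))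
  refine IntegrableOn.congr_fun h (fun t ht => ?_) measurableSet_Ioi
  rw [← mul_assoc, ← mul_assoc, ← four_pi_mul_rpow ht]

theorem norm_greenDiff_integrand_le {lam mu c t : ℝ} (h1 : c ≤ lam) (h2 : c ≤ mu) (ht : 0 < t)
    (x : Rn N) :
    ‖(4 * Real.pi * t) ^ (-(N : ℝ) / 2) *
      (Real.exp (-lam * t) - Real.exp (-mu * t)) * Real.exp (-‖x‖ ^ 2 / (4 * t))‖ ≤
      |lam - mu| * ((4 * Real.pi * t) ^ (-(N : ℝ) / 2) * (t * Real.exp (-c * t))) := by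
  rw [norm_mul, norm_mul, Real.norm_eq_abs, Real.norm_eq_abs, Real.norm_eq_abs, Real.abs_exp,
    abs_of_nonneg (by positivity)]
  have h3 : Real.exp (-‖x‖ ^ 2 / (4 * t)) ≤ 1 := by
    rw [Real.exp_le_one_iff, neg_div]
    have : 0 ≤ ‖x‖ ^ 2 / (4 * t) := by positivity
    linarith
  calc _ ≤ (4 * Real.pi * t) ^ (-(N : ℝ) / 2) *
        (|lam - mu| * (t * Real.exp (-c * t))) * 1 := by
        gcongr
        exact abs_exp_sub_exp_le h1 h2 ht
    _ = _ := by ring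

theorem continuous_greenDiff (h23 : N = 2 ∨ N = 3) {lam mu : ℝ} (hl : 0 < lam) (hm : 0 < mu) :
    Continuous (greenDiff N lam mu) := by
  refine continuous_of_dominated (bound := fun t => |lam - mu| *
    ((4 * Real.pi * t) ^ (-(N : ℝ) / 2) * (t * Real.exp (-(min lam mu) * t)))) ?_ ?_ ?_ ?_
  · intro x
    exact (by fun_prop : Measurable _).aestronglyMeasurable
  · intro x
    refine (ae_restrict_iff' measurableSet_Ioi).2 (.of_forall fun t ht => ?_)
    exact norm_greenDiff_integrand_le (min_le_left _ _) (min_le_right _ _) ht x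
  · exact (integrableOn_four_pi_mul h23 (lt_min hl hm)).const_mul _
  · exact .of_forall fun t => by fun_prop

theorem greenDiff_eq {lam mu : ℝ} (hl : 0 < lam) (hm : 0 < mu) {x : Rn N} (hx : x ≠ 0) :
    (greenDiff N lam mu x : ℂ) = green N lam x - green N mu x := by
  rw [green_eq, green_eq, ← Complex.ofReal_sub, ← integral_sub (integrableOn_greenIntegrand hl hx)
    (integrableOn_greenIntegrand hm hx), greenDiff]
  congr 1
  refine integral_congr_ae (.of_forall fun t => ?_)
  simp only [greenIntegrand]
  rw [sub_eq_add_neg (-lam * t), sub_eq_add_neg (-mu * t), Real.exp_add, Real.exp_add, neg_div]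
  ring_nf

theorem greenDiff_ae (hN : N ≠ 0) {lam mu : ℝ} (hl : 0 < lam) (hm : 0 < mu) :
    ∀ᵐ x : Rn N, (greenDiff N lam mu x : ℂ) = green N lam x - green N mu x := by
  have : NeZero N := ⟨hN⟩
  have h0 : ∀ᵐ x : Rn N, x ≠ 0 := by simp [ae_iff]
  filter_upwards [h0] with x hx using greenDiff_eq hl hm hx

theorem greenDiff_zero_eq (lam mu : ℝ) : greenDiff N lam mu 0 =
    ∫ t in Ioi (0 : ℝ), (4 * Real.pi * t) ^ (-(N : ℝ) / 2) *
      (Real.exp (-lam * t) - Real.exp (-mu * t)) := by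
  simp [greenDiff]

theorem integral_four_pi_mul (h23 : N = 2 ∨ N = 3) {s : ℝ} (hs : 0 < s) :
    ∫ t in Ioi (0 : ℝ), (4 * Real.pi * t) ^ (-(N : ℝ) / 2) * (t * Real.exp (-s * t))
      = (4 * Real.pi) ^ (-(N : ℝ) / 2) *
        ((1 / s) ^ (2 - (N : ℝ) / 2) * Real.Gamma (2 - (N : ℝ) / 2)) := by
  rw [← Real.integral_rpow_mul_exp_neg_mul_Ioi (by rcases h23 with rfl | rfl <;> norm_num) hs,
    ← integral_const_mul]
  refine setIntegral_congr_fun measurableSet_Ioi fun t ht => ?_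
  rw [← mul_assoc, four_pi_mul_rpow ht, mul_assoc]
  rw [show 2 - (N : ℝ) / 2 - 1 = 1 - N / 2 by ring, neg_mul]

theorem hasDerivAt_greenDiff_zero (h23 : N = 2 ∨ N = 3) {mu s : ℝ} (hm : 0 < mu) (hs : 0 < s) :
    HasDerivAt (fun s => greenDiff N s mu 0)
      (-((4 * Real.pi) ^ (-(N : ℝ) / 2) *
        ((1 / s) ^ (2 - (N : ℝ) / 2) * Real.Gamma (2 - (N : ℝ) / 2)))) s := by
  simp only [greenDiff_zero_eq]
  rw [← integral_four_pi_mul h23 hs, ← integral_neg]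
  refine (hasDerivAt_integral_of_dominated_loc_of_deriv_le (μ := volume.restrict (Ioi 0))
    (s := Ioi (s / 2))
    (F := fun s t => (4 * Real.pi * t) ^ (-(N : ℝ) / 2) *
      (Real.exp (-s * t) - Real.exp (-mu * t)))
    (F' := fun s t => -((4 * Real.pi * t) ^ (-(N : ℝ) / 2) * (t * Real.exp (-s * t))))
    (bound := fun t => (4 * Real.pi * t) ^ (-(N : ℝ) / 2) * (t * Real.exp (-(s / 2) * t)))
    (Ioi_mem_nhds (by linarith)) ?_ ?_ ?_ ?_ ?_ ?_).2
  · exact .of_forall fun s => (by fun_prop : Measurable _).aestronglyMeasurable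
  · refine Integrable.mono' ((integrableOn_four_pi_mul h23 (lt_min hs hm)).const_mul |s - mu|)
      (by fun_prop : Measurable _).aestronglyMeasurable ?_
    refine (ae_restrict_iff' measurableSet_Ioi).2 (.of_forall fun t ht => ?_)
    have := norm_greenDiff_integrand_le (N := N) (min_le_left s mu) (min_le_right s mu) ht 0
    simpa using this
  · exact (by fun_prop : Measurable _).aestronglyMeasurable
  · refine (ae_restrict_iff' measurableSet_Ioi).2 (.of_forall fun t ht r hr => ?_)
    have ht : (0 : ℝ) < t := ht
    have hr : s / 2 < r := hr
    rw [norm_neg, Real.norm_eq_abs, abs_of_nonneg (by positivity)]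
    gcongr
  · exact integrableOn_four_pi_mul h23 (half_pos hs)
  · refine .of_forall fun t r hr => ?_
    have h1 : HasDerivAt (fun s : ℝ => Real.exp (-s * t)) (Real.exp (-r * t) * (-1 * t)) r :=
      (((hasDerivAt_id r).neg).mul_const t).exp
    have h2 := (h1.sub_const (Real.exp (-mu * t))).const_mul ((4 * Real.pi * t) ^ (-(N : ℝ) / 2))
    refine h2.congr_deriv ?_
    ring_nf

theorem hasDerivAt_beta (h23 : N = 2 ∨ N = 3) {s : ℝ} (hs : 0 < s) :
    HasDerivAt (beta N) ((4 * Real.pi) ^ (-(N : ℝ) / 2) *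
        ((1 / s) ^ (2 - (N : ℝ) / 2) * Real.Gamma (2 - (N : ℝ) / 2))) s := by
  have hsq : 0 < Real.sqrt s := Real.sqrt_pos.2 hs
  have hpi := Real.pi_pos
  rcases h23 with rfl | rfl
  · have h1 : beta 2 = fun lam => 1 / (2 * Real.pi) *
        (Real.eulerMascheroniConstant + Real.log (Real.sqrt lam / 2)) := by
      ext; simp [beta]
    rw [h1]
    have h2 := ((((Real.hasDerivAt_sqrt hs.ne').div_const 2).log (by positivity)).const_add
      Real.eulerMascheroniConstant).const_mul (1 / (2 * Real.pi))
    refine h2.congr_deriv ?_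
    have e : -((2 : ℕ) : ℝ) / 2 = -1 := by norm_num
    have e' : 2 - ((2 : ℕ) : ℝ) / 2 = 1 := by norm_num
    rw [e, e', Real.Gamma_one, Real.rpow_one, Real.rpow_neg_one]
    have := Real.sq_sqrt hs.le
    field_simp
    rw [this]
    norm_num
  · have h1 : beta 3 = fun lam => Real.sqrt lam / (4 * Real.pi) := by
      ext; simp [beta]
    rw [h1]
    have h2 := (Real.hasDerivAt_sqrt hs.ne').div_const (4 * Real.pi)
    refine h2.congr_deriv ?_
    have e : -((3 : ℕ) : ℝ) / 2 = -(1 + 1 / 2) := by norm_num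
    have e' : 2 - ((3 : ℕ) : ℝ) / 2 = 1 / 2 := by norm_num
    rw [e, e', Real.Gamma_one_half_eq, Real.rpow_neg (by positivity),
      Real.rpow_add (by positivity), Real.rpow_one, ← Real.sqrt_eq_rpow, ← Real.sqrt_eq_rpow,
      Real.sqrt_div (by norm_num), Real.sqrt_one, Real.sqrt_mul (by norm_num),
      show (4 : ℝ) = 2 ^ 2 by norm_num, Real.sqrt_sq (by norm_num)]
    have := Real.sqrt_pos.2 hpi
    field_simp

/-- `(G_λ - G_μ)(0) = β(μ) - β(λ)`: both sides have the same derivative in `λ`. -/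
theorem greenDiff_zero (h23 : N = 2 ∨ N = 3) {lam mu : ℝ} (hl : 0 < lam) (hm : 0 < mu) :
    greenDiff N lam mu 0 = beta N mu - beta N lam := by
  have hd : ∀ s ∈ Ioi (0 : ℝ), HasDerivAt (fun s => greenDiff N s mu 0 + beta N s) 0 s :=
    fun s hs => ((hasDerivAt_greenDiff_zero h23 hm hs).add (hasDerivAt_beta h23 hs)).congr_deriv
      (neg_add_cancel _)
  have := isOpen_Ioi.is_const_of_deriv_eq_zero (isPreconnected_Ioi)
    (fun s hs => (hd s hs).differentiableAt.differentiableWithinAt)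
    (fun s hs => (hd s hs).deriv) (mem_Ioi.2 hl) (mem_Ioi.2 hm)
  have h0 : greenDiff N mu mu 0 = 0 := by simp [greenDiff]
  simp only [h0] at this
  linarith

/-! ### `G_λ - G_μ` in `H²` -/

theorem memLp_of_norm_le_resolventSymbol (h23 : N = 2 ∨ N = 3) {lam : ℝ} (hl : 0 < lam)
    {h : Rn N → ℂ} (hc : Continuous h) {C : ℝ} (hC : ∀ ξ, ‖h ξ‖ ≤ C * resolventSymbol N lam ξ) :
    MemLp h 2 volume := by
  refine (Lp.memLp (𝓕 (greenL2 h23 hl) : L2 N)).of_le_mul (c := C) hc.aestronglyMeasurable ?_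
  filter_upwards [fourier_greenL2 h23 hl] with ξ hξ
  rw [hξ, Complex.norm_real, Real.norm_eq_abs, abs_of_pos (resolventSymbol_pos hl ξ)]
  exact hC ξ

/-- An `L²` function with prescribed Fourier transform. -/
theorem exists_L2_fourier_eq {h : Rn N → ℂ} (hh : MemLp h 2 volume) :
    ∃ f : L2 N, ∀ᵐ ξ, (𝓕 f : L2 N) ξ = h ξ :=
  ⟨𝓕⁻ (hh.toLp h), by
    rw [FourierTransform.fourier_fourierInv_eq]
    exact hh.coeFn_toLp⟩

theorem norm_partialSymbol_sq_le (i : Fin N) (ξ : Rn N) :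
    ‖partialSymbol i ξ‖ ^ 2 ≤ 4 * Real.pi ^ 2 * ‖ξ‖ ^ 2 := by
  have h1 : ‖partialSymbol i ξ‖ = 2 * Real.pi * |ξ i| := by
    simp [partialSymbol, abs_of_pos Real.pi_pos]
  have h2 : |ξ i| ≤ ‖ξ‖ := PiLp.norm_apply_le ξ i
  rw [h1, mul_pow, mul_pow]
  have : |ξ i| ^ 2 ≤ ‖ξ‖ ^ 2 := by gcongr
  nlinarith [sq_nonneg Real.pi]

theorem sum_partialSymbol_sq (ξ : Rn N) :
    ∑ i, partialSymbol i ξ * partialSymbol i ξ = ((-(4 * Real.pi ^ 2 * ‖ξ‖ ^ 2) : ℝ) : ℂ) := by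
  rw [EuclideanSpace.real_norm_sq_eq]
  push_cast
  rw [Finset.mul_sum, ← Finset.sum_neg_distrib]
  refine Finset.sum_congr rfl fun i _ => ?_
  simp only [partialSymbol]
  linear_combination (4 * (Real.pi : ℂ) ^ 2 * (ξ i : ℂ) ^ 2) * Complex.I_sq

theorem resolventSymbol_sub {lam mu : ℝ} (hl : 0 < lam) (hm : 0 < mu) (ξ : Rn N) :
    resolventSymbol N lam ξ - resolventSymbol N mu ξ
      = (mu - lam) * (resolventSymbol N lam ξ * resolventSymbol N mu ξ) := by
  have h1 := resolventSymbol_mul hl ξ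
  have h2 := resolventSymbol_mul hm ξ
  linear_combination resolventSymbol N mu ξ * h1 - resolventSymbol N lam ξ * h2

/-- `G_λ - G_μ` as an element of `L²`. -/
def greenDiffL2 (h23 : N = 2 ∨ N = 3) {lam mu : ℝ} (hl : 0 < lam) (hm : 0 < mu) : L2 N :=
  greenL2 h23 hl - greenL2 h23 hm

theorem coeFn_greenDiffL2 (h23 : N = 2 ∨ N = 3) {lam mu : ℝ} (hl : 0 < lam) (hm : 0 < mu) :
    greenDiffL2 h23 hl hm =ᵐ[volume] fun x => green N lam x - green N mu x := by
  filter_upwards [Lp.coeFn_sub (greenL2 h23 hl) (greenL2 h23 hm), coeFn_greenL2 h23 hl,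
    coeFn_greenL2 h23 hm] with x h1 h2 h3
  rw [greenDiffL2, h1, Pi.sub_apply, h2, h3]

theorem fourier_greenDiffL2 (h23 : N = 2 ∨ N = 3) {lam mu : ℝ} (hl : 0 < lam) (hm : 0 < mu) :
    ∀ᵐ ξ, (𝓕 (greenDiffL2 h23 hl hm) : L2 N) ξ
      = ((resolventSymbol N lam ξ - resolventSymbol N mu ξ : ℝ) : ℂ) := by
  have e : (𝓕 (greenDiffL2 h23 hl hm) : L2 N) = 𝓕 (greenL2 h23 hl) - 𝓕 (greenL2 h23 hm) :=
    map_sub (Lp.fourierTransformₗᵢ (Rn N) ℂ) _ _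
  rw [e]
  filter_upwards [Lp.coeFn_sub (𝓕 (greenL2 h23 hl)) (𝓕 (greenL2 h23 hm)), fourier_greenL2 h23 hl,
    fourier_greenL2 h23 hm] with ξ h1 h2 h3
  rw [h1, Pi.sub_apply, h2, h3, Complex.ofReal_sub]

theorem norm_resolventSymbol_sub_le {lam mu : ℝ} (hl : 0 < lam) (hm : 0 < mu) {z : ℂ} {ξ : Rn N}
    (hz : ‖z‖ ≤ 1 + 4 * Real.pi ^ 2 * ‖ξ‖ ^ 2) :
    ‖z * ((resolventSymbol N lam ξ - resolventSymbol N mu ξ : ℝ) : ℂ)‖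
      ≤ (|mu - lam| * (1 / mu + 1)) * resolventSymbol N lam ξ := by
  have p1 := resolventSymbol_pos hl ξ
  have p2 := resolventSymbol_pos hm ξ
  have key : (1 + 4 * Real.pi ^ 2 * ‖ξ‖ ^ 2) * resolventSymbol N mu ξ ≤ 1 / mu + 1 := by
    rw [resolventSymbol, ← div_eq_mul_inv, div_le_iff₀ (resolvent_pos hm ξ)]
    have : 0 ≤ 4 * Real.pi ^ 2 * ‖ξ‖ ^ 2 := by positivity
    have : 0 ≤ 1 / mu * (4 * Real.pi ^ 2 * ‖ξ‖ ^ 2) := by positivity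
    have : 1 / mu * mu = 1 := by field_simp
    nlinarith
  rw [resolventSymbol_sub hl hm, norm_mul, Complex.norm_real, Real.norm_eq_abs, abs_mul,
    abs_of_pos (mul_pos p1 p2)]
  calc ‖z‖ * (|mu - lam| * (resolventSymbol N lam ξ * resolventSymbol N mu ξ))
      ≤ (1 + 4 * Real.pi ^ 2 * ‖ξ‖ ^ 2) *
        (|mu - lam| * (resolventSymbol N lam ξ * resolventSymbol N mu ξ)) := by gcongr
    _ = |mu - lam| * ((1 + 4 * Real.pi ^ 2 * ‖ξ‖ ^ 2) * resolventSymbol N mu ξ)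
        * resolventSymbol N lam ξ := by ring
    _ ≤ _ := by gcongr

/-- `G_λ - G_μ` has weak derivatives of first and second order in `L²`, and
`Δ (G_λ - G_μ) = λ G_λ - μ G_μ`. -/
theorem exists_weakPartial_greenDiff (h23 : N = 2 ∨ N = 3) {lam mu : ℝ} (hl : 0 < lam)
    (hm : 0 < mu) :
    ∃ (E : Fin N → L2 N) (K : Fin N → Fin N → L2 N),
      (∀ i, HasWeakPartial i (greenDiffL2 h23 hl hm) (E i)) ∧
      (∀ i j, HasWeakPartial j (E i) (K i j)) ∧
      ∑ i, K i i = (lam : ℂ) • greenL2 h23 hl - (mu : ℂ) • greenL2 h23 hm := by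
  set d : Rn N → ℂ := fun ξ =>
    ((resolventSymbol N lam ξ - resolventSymbol N mu ξ : ℝ) : ℂ) with hd
  have hdc : Continuous d := Complex.continuous_ofReal.comp
    ((continuous_resolventSymbol hl).sub (continuous_resolventSymbol hm))
  have m1 : ∀ i : Fin N, MemLp (fun ξ => partialSymbol i ξ * d ξ) 2 volume := fun i =>
    memLp_of_norm_le_resolventSymbol h23 hl ((continuous_partialSymbol i).mul hdc) fun ξ =>
      norm_resolventSymbol_sub_le hl hm (by
        nlinarith [norm_partialSymbol_sq_le i ξ, sq_nonneg (‖partialSymbol i ξ‖ - 1)])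
  have m2 : ∀ i j : Fin N, MemLp (fun ξ => partialSymbol j ξ * partialSymbol i ξ * d ξ) 2
      volume := fun i j =>
    memLp_of_norm_le_resolventSymbol h23 hl
      (((continuous_partialSymbol j).mul (continuous_partialSymbol i)).mul hdc) fun ξ =>
      norm_resolventSymbol_sub_le hl hm (by
        rw [norm_mul]
        nlinarith [norm_partialSymbol_sq_le i ξ, norm_partialSymbol_sq_le j ξ,
          sq_nonneg (‖partialSymbol i ξ‖ - ‖partialSymbol j ξ‖)])
  choose E hE using fun i => exists_L2_fourier_eq (m1 i)
  choose K hK using fun i j => exists_L2_fourier_eq (m2 i j)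
  refine ⟨E, K, fun i => hasWeakPartial_of_fourier ?_, fun i j => hasWeakPartial_of_fourier ?_, ?_⟩
  · filter_upwards [hE i, fourier_greenDiffL2 h23 hl hm] with ξ h1 h2
    rw [h1, h2]
  · filter_upwards [hE i, hK i j] with ξ h1 h2
    rw [h1, h2, mul_assoc]
  · apply (Lp.fourierTransformₗᵢ (Rn N) ℂ).injective
    rw [map_sum, map_sub, map_smul, map_smul]
    refine Lp.ext ?_
    set FT := Lp.fourierTransformₗᵢ (Rn N) ℂ
    have a1 : ∀ᵐ ξ, ∀ i, FT (K i i) ξ = partialSymbol i ξ * partialSymbol i ξ * d ξ :=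
      ae_all_iff.2 fun i => hK i i
    filter_upwards [Lp.coeFn_finsetSum Finset.univ (fun i => FT (K i i)), a1,
      Lp.coeFn_sub ((lam : ℂ) • FT (greenL2 h23 hl)) ((mu : ℂ) • FT (greenL2 h23 hm)),
      Lp.coeFn_smul (lam : ℂ) (FT (greenL2 h23 hl)), Lp.coeFn_smul (mu : ℂ) (FT (greenL2 h23 hm)),
      fourier_greenL2 h23 hl, fourier_greenL2 h23 hm] with ξ h1 h2 h3 h4 h5 h6 h7
    have h6' : FT (greenL2 h23 hl) ξ = (resolventSymbol N lam ξ : ℂ) := h6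
    have h7' : FT (greenL2 h23 hm) ξ = (resolventSymbol N mu ξ : ℂ) := h7
    rw [h1, h3, Pi.sub_apply, h4, h5, Pi.smul_apply, Pi.smul_apply, h6', h7', smul_eq_mul,
      smul_eq_mul, Finset.sum_apply, Finset.sum_congr rfl fun i _ => h2 i, ← Finset.sum_mul,
      sum_partialSymbol_sq]
    simp only [hd]
    norm_cast
    have e1 := resolventSymbol_mul hl ξ
    have e2 := resolventSymbol_mul hm ξ
    linear_combination e2 - e1

/-! ### Point evaluation on `H²` -/

/-- Fourier inversion for `f ∈ L²` with integrable Fourier transform. -/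
theorem ae_eq_fourier_neg {f : L2 N} (hint : Integrable (𝓕 f : L2 N)) :
    f =ᵐ[volume] fun x => 𝓕 (fun ξ => (𝓕 f : L2 N) ξ) (-x) := by
  set h : Rn N → ℂ := fun ξ => (𝓕 f : L2 N) ξ
  set k : Rn N → ℂ := 𝓕 h with hk
  have hkc : Continuous k := VectorFourier.fourierIntegral_continuous Real.continuous_fourierChar
    continuous_inner hint
  refine ae_eq_of_integral_test (locInt f) (hkc.comp continuous_neg).locallyIntegrable
    fun φ hφ => ?_
  have h1 := integral_fourierInv_mul_L2 f hφ.toSchwartz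
  have h2 := VectorFourier.integral_fourierIntegral_smul_eq_flip (μ := volume) (ν := volume)
    (L := innerₗ (Rn N)) (f := h) (g := fun x => hφ.toSchwartz (-x)) Real.continuous_fourierChar
    continuous_inner hint hφ.toSchwartz.integrable.comp_neg
  rw [flip_innerₗ] at h2
  have h2' : ∫ x, k x * hφ.toSchwartz (-x)
      = ∫ x, h x * 𝓕 (fun x => hφ.toSchwartz (-x)) x := h2
  have e2 : ∫ x, (φ x : ℂ) * k (-x) = ∫ x, k x * hφ.toSchwartz (-x) := by
    rw [← integral_neg_eq_self (fun x => (φ x : ℂ) * k (-x))]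
    refine integral_congr_ae (.of_forall fun x => ?_)
    simp [mul_comm]
  simp only [IsTest.toSchwartz_apply] at h1
  rw [← h1, e2, h2']
  refine integral_congr_ae (.of_forall fun x => ?_)
  simp only
  rw [mul_comm, SchwartzMap.fourierInv_coe, Real.fourierInv_eq_fourier_comp_neg]

theorem eq_integral_fourier {f : L2 N} {f₀ : Rn N → ℂ} (hf₀ : Continuous f₀)
    (hf : f =ᵐ[volume] f₀) (hint : Integrable (𝓕 f : L2 N)) : f₀ 0 = ∫ ξ, (𝓕 f : L2 N) ξ := by
  have hkc : Continuous (𝓕 (fun ξ => (𝓕 f : L2 N) ξ)) :=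
    VectorFourier.fourierIntegral_continuous Real.continuous_fourierChar continuous_inner hint
  have heq := (hf₀.ae_eq_iff_eq volume (hkc.comp continuous_neg)).1
    (hf.symm.trans (ae_eq_fourier_neg hint))
  rw [heq]
  simp [Real.fourier_eq]

theorem ae_norm_le_integral_fourier {f : L2 N} (hint : Integrable (𝓕 f : L2 N)) :
    ∀ᵐ x, ‖f x‖ ≤ ∫ ξ, ‖(𝓕 f : L2 N) ξ‖ := by
  filter_upwards [ae_eq_fourier_neg hint] with x hx
  rw [hx]
  exact VectorFourier.norm_fourierIntegral_le_integral_norm _ _ _ _ _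

/-- For `f ∈ H²`, `f(0) = ⟨(λ - Δ)f, G_λ⟩`. -/
theorem inner_greenL2_eq (h23 : N = 2 ∨ N = 3) {lam : ℝ} (hl : 0 < lam) {f : L2 N}
    {f₀ : Rn N → ℂ} (hf₀ : Continuous f₀) (hf : f =ᵐ[volume] f₀) {F : Fin N → L2 N}
    {H : Fin N → L2 N} (hF : ∀ i, HasWeakPartial i f (F i))
    (hH : ∀ i, HasWeakPartial i (F i) (H i)) :
    ⟪greenL2 h23 hl, (lam : ℂ) • f - ∑ i, H i⟫_ℂ = f₀ 0 := by
  set w := (lam : ℂ) • f - ∑ i, H i with hw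
  have hwF : ∀ᵐ ξ, (𝓕 w : L2 N) ξ
      = ((lam + 4 * Real.pi ^ 2 * ‖ξ‖ ^ 2 : ℝ) : ℂ) * (𝓕 f : L2 N) ξ := by
    set FT := Lp.fourierTransformₗᵢ (Rn N) ℂ
    have e : (𝓕 w : L2 N) = (lam : ℂ) • FT f - ∑ i, FT (H i) := by
      change FT w = _
      rw [hw, map_sub, map_smul, map_sum]
    rw [e]
    have a1 : ∀ᵐ ξ, ∀ i, FT (F i) ξ = partialSymbol i ξ * FT f ξ :=
      ae_all_iff.2 fun i => (hF i).fourier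
    have a2 : ∀ᵐ ξ, ∀ i, FT (H i) ξ = partialSymbol i ξ * FT (F i) ξ :=
      ae_all_iff.2 fun i => (hH i).fourier
    filter_upwards [a1, a2, Lp.coeFn_finsetSum Finset.univ (fun i => FT (H i)),
      Lp.coeFn_sub ((lam : ℂ) • FT f) (∑ i, FT (H i)), Lp.coeFn_smul (lam : ℂ) (FT f)]
      with ξ h1 h2 h3 h4 h5
    have e3 : ∑ i, FT (H i) ξ = (∑ i, partialSymbol i ξ * partialSymbol i ξ) * FT f ξ := by
      rw [Finset.sum_mul]
      refine Finset.sum_congr rfl fun i _ => ?_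
      rw [h2, h1, mul_assoc]
    change _ = _ * FT f ξ
    rw [h4, Pi.sub_apply, h5, h3, Pi.smul_apply, smul_eq_mul, Finset.sum_apply, e3,
      sum_partialSymbol_sq]
    push_cast
    ring
  have hm : ∀ᵐ ξ, (𝓕 w : L2 N) ξ * conj ((𝓕 (greenL2 h23 hl) : L2 N) ξ) = (𝓕 f : L2 N) ξ := by
    filter_upwards [hwF, fourier_greenL2 h23 hl] with ξ h1 h2
    rw [h1, h2, Complex.conj_ofReal, mul_comm, ← mul_assoc, ← Complex.ofReal_mul,
      resolventSymbol_mul hl, Complex.ofReal_one, one_mul]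
  have hint : Integrable (𝓕 f : L2 N) := by
    have h1 := L2.integrable_inner (𝕜 := ℂ) (𝓕 (greenL2 h23 hl) : L2 N) (𝓕 w : L2 N)
    refine h1.congr ?_
    filter_upwards [hm] with ξ h
    simpa using h
  rw [eq_integral_fourier hf₀ hf hint, ← Lp.inner_fourier_eq, inner_L2_eq]
  exact integral_congr_ae hm

/-! ### Uniqueness of the decomposition -/

/-- The integrand is `|∇G_λ|²` on the Fourier side; it decays like `|ξ|⁻²` only. -/
theorem not_integrable_norm_sq_resolventSymbol (hN : 2 ≤ N) {lam : ℝ} (hl : 0 < lam) :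
    ¬ Integrable (fun ξ : Rn N => 4 * Real.pi ^ 2 * ‖ξ‖ ^ 2 * resolventSymbol N lam ξ ^ 2) := by
  have : Nontrivial (Rn N) := by
    have : NeZero N := ⟨by omega⟩
    infer_instance
  intro h
  set g : ℝ → ℝ := fun r => 4 * Real.pi ^ 2 * r ^ 2 * ((lam + 4 * Real.pi ^ 2 * r ^ 2)⁻¹) ^ 2
  have h' : Integrable (fun ξ : Rn N => g ‖ξ‖) := h
  rw [integrable_fun_norm_addHaar volume (f := g), finrank_euclideanSpace_fin] at h'
  have h1 := h'.mono_set (Ioi_subset_Ioi zero_le_one)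
  set c := 4 * Real.pi ^ 2 / (lam + 4 * Real.pi ^ 2) ^ 2
  have hc : 0 < c := by positivity
  refine not_integrableOn_Ioi_inv (a := 1) ?_
  have h2 : IntegrableOn (fun r : ℝ => c * r⁻¹) (Ioi 1) := by
    refine Integrable.mono' h1 (by fun_prop : Measurable _).aestronglyMeasurable ?_
    refine (ae_restrict_iff' measurableSet_Ioi).2 (.of_forall fun r hr => ?_)
    have hr1 : (1 : ℝ) < r := hr
    have hr0 : 0 < r := by linarith
    rw [Real.norm_eq_abs, abs_of_nonneg (by positivity), smul_eq_mul]
    have e1 : r ≤ r ^ (N - 1) := le_self_pow₀ hr1.le (by omega)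
    have e2 : lam + 4 * Real.pi ^ 2 * r ^ 2 ≤ (lam + 4 * Real.pi ^ 2) * r ^ 2 := by
      have : lam ≤ lam * r ^ 2 := le_mul_of_one_le_right hl.le (one_le_pow₀ hr1.le)
      linarith
    calc c * r⁻¹ = r * (4 * Real.pi ^ 2 * r ^ 2 *
          (((lam + 4 * Real.pi ^ 2) * r ^ 2)⁻¹) ^ 2) := by
          simp only [c]; field_simp
      _ ≤ r ^ (N - 1) * g r := by
          simp only [g]
          gcongr
  have h3 := h2.const_mul c⁻¹
  refine h3.congr (.of_forall fun r => ?_)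
  simp only
  rw [inv_mul_cancel_left₀ hc.ne']

theorem norm_partialSymbol_sum (ξ : Rn N) :
    ∑ i, ‖partialSymbol i ξ‖ ^ 2 = 4 * Real.pi ^ 2 * ‖ξ‖ ^ 2 := by
  rw [EuclideanSpace.real_norm_sq_eq, Finset.mul_sum]
  refine Finset.sum_congr rfl fun i _ => ?_
  have h1 : ‖partialSymbol i ξ‖ = 2 * Real.pi * |ξ i| := by
    simp [partialSymbol, abs_of_pos Real.pi_pos]
  rw [h1, mul_pow, mul_pow, sq_abs]
  norm_num

theorem integrable_norm_sq_L2 (f : L2 N) : Integrable (fun x => ‖f x‖ ^ 2) :=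
  (memLp_two_iff_integrable_sq_norm (Lp.memLp f).1).1 (Lp.memLp f)

/-- The gradient of `G_λ` is not in `L²`. -/
theorem not_weakPartial_greenL2 (h23 : N = 2 ∨ N = 3) {lam : ℝ} (hl : 0 < lam)
    (k : Fin N → L2 N) : ¬ ∀ i, HasWeakPartial i (greenL2 h23 hl) (k i) := by
  intro h
  refine not_integrable_norm_sq_resolventSymbol (N := N) (by omega) hl ?_
  have h1 : Integrable (fun ξ => ∑ i, ‖(𝓕 (k i) : L2 N) ξ‖ ^ 2) :=
    integrable_finsetSum _ fun i _ => integrable_norm_sq_L2 _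
  refine h1.congr ?_
  filter_upwards [ae_all_iff.2 fun i => (h i).fourier, fourier_greenL2 h23 hl] with ξ e1 e2
  rw [← norm_partialSymbol_sum, Finset.sum_mul]
  refine Finset.sum_congr rfl fun i _ => ?_
  rw [e1, e2, norm_mul, mul_pow, Complex.norm_real, Real.norm_eq_abs, sq_abs]

theorem HasWeakPartial.const_smul {i : Fin N} {f g : Rn N → ℂ} (h : HasWeakPartial i f g) (a : ℂ) :
    HasWeakPartial i (fun x => a * f x) (fun x => a * g x) := by
  intro φ hφ
  have := h φ hφ
  simp only [mul_left_comm _ a]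
  rw [integral_const_mul, integral_const_mul, this, mul_neg]

theorem HasWeakPartial.add {i : Fin N} {f g f' g' : Rn N → ℂ} (h : HasWeakPartial i f g)
    (h' : HasWeakPartial i f' g') (hf : LocallyIntegrable f volume)
    (hg : LocallyIntegrable g volume) (hf' : LocallyIntegrable f' volume)
    (hg' : LocallyIntegrable g' volume) :
    HasWeakPartial i (fun x => f x + f' x) (fun x => g x + g' x) := by
  intro φ hφ
  obtain ⟨c, s⟩ := hφ.partial i
  simp only [mul_add]
  rw [integral_add (integrable_test_mul hf c s) (integrable_test_mul hf' c s),
    integral_add (integrable_test_mul hg hφ.1.continuous hφ.2)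
      (integrable_test_mul hg' hφ.1.continuous hφ.2), h φ hφ, h' φ hφ]
  ring

theorem HasWeakPartial.eq_zero {i : Fin N} {g : Rn N → ℂ} (h : HasWeakPartial i 0 g)
    (hg : LocallyIntegrable g volume) : g =ᵐ[volume] 0 := by
  refine ae_eq_of_integral_test hg (locallyIntegrable_const 0) fun φ hφ => ?_
  have := h φ hφ
  simp only [Pi.zero_apply, mul_zero, integral_zero] at this ⊢
  linear_combination this

/-- The components of a vector field in `L²`. -/
theorem memLp_comp (F : L2vec N) (i : Fin N) :
    MemLp (fun x => F x i) 2 (volume : Measure (Rn N)) :=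
  (EuclideanSpace.proj (𝕜 := ℂ) i : Cn N →L[ℂ] ℂ).comp_memLp' (Lp.memLp F)

/-- A decomposition of `0` is trivial. -/
theorem IsDecomp.eq_zero (h23 : N = 2 ∨ N = 3) {p lam : ℝ} (hl : 0 < lam) {f : Lpp N p}
    {F : L2vec N} {c : ℂ} (h : IsDecomp lam (0 : Lpp N p) f F c) : f = 0 ∧ F = 0 ∧ c = 0 := by
  have hf : ∀ᵐ x, f x = -c * green N lam x := by
    filter_upwards [h.2, Lp.coeFn_zero ℂ (expo p) (volume : Measure (Rn N))] with x h1 h2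
    rw [h2, Pi.zero_apply] at h1
    linear_combination -h1
  have hw := hasWeakGrad_iff.1 h.1
  have hc : c = 0 := by
    by_contra hc
    refine not_weakPartial_greenL2 h23 hl
      (fun i => ((memLp_comp F i).const_mul (-c⁻¹)).toLp _) fun i => ?_
    refine ((hw i).const_smul (-c⁻¹)).congr ?_ (MemLp.coeFn_toLp _)
    filter_upwards [hf, coeFn_greenL2 h23 hl] with x h1 h2
    rw [h1, h2]
    field_simp
  subst hc
  have hf0 : f =ᵐ[volume] 0 := by
    filter_upwards [hf] with x hx
    simpa using hx
  refine ⟨(Lp.eq_zero_iff_ae_eq_zero).2 hf0, (Lp.eq_zero_iff_ae_eq_zero).2 ?_, rfl⟩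
  have h2 : ∀ i, (fun x => F x i) =ᵐ[volume] 0 := fun i =>
    ((hw i).congr hf0.symm .rfl).eq_zero (locInt_comp F i)
  filter_upwards [ae_all_iff.2 h2] with x hx
  ext i
  exact hx i

theorem IsDecomp.unique (h23 : N = 2 ∨ N = 3) {p lam : ℝ} (hl : 0 < lam) {u f f' : Lpp N p}
    {F F' : L2vec N} {c c' : ℂ} (h : IsDecomp lam u f F c) (h' : IsDecomp lam u f' F' c') :
    f = f' ∧ F = F' ∧ c = c' := by
  have h0 := h.add (h'.smul (-1))
  rw [neg_one_smul, add_neg_cancel] at h0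
  obtain ⟨h1, h2, h3⟩ := h0.eq_zero h23 hl
  refine ⟨?_, ?_, ?_⟩
  · rwa [neg_one_smul, add_neg_eq_zero] at h1
  · rwa [neg_one_smul, add_neg_eq_zero] at h2
  · linear_combination h3

/-! ### The Sobolev embedding `H¹ ⊆ L^q` -/

/-- The weight `1 + |2πξ|²`, for which `‖f‖²_{H¹} = ∫ w |f̂|²`. -/
def sobolevWeight (ξ : Rn N) : ℝ := 1 + 4 * Real.pi ^ 2 * ‖ξ‖ ^ 2

theorem one_le_sobolevWeight (ξ : Rn N) : 1 ≤ sobolevWeight ξ := by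
  have : 0 ≤ 4 * Real.pi ^ 2 * ‖ξ‖ ^ 2 := by positivity
  unfold sobolevWeight; linarith

theorem sobolevWeight_pos (ξ : Rn N) : 0 < sobolevWeight ξ :=
  one_pos.trans_le (one_le_sobolevWeight ξ)

theorem continuous_sobolevWeight_rpow (r : ℝ) :
    Continuous (fun ξ : Rn N => sobolevWeight ξ ^ r) :=
  (by unfold sobolevWeight; fun_prop : Continuous (sobolevWeight (N := N))).rpow_const
    fun ξ => .inl (sobolevWeight_pos ξ).ne'

theorem integrable_sobolevWeight_mul {f : L2 N} {F : Fin N → L2 N}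
    (h : ∀ i, HasWeakPartial i f (F i)) :
    Integrable (fun ξ => sobolevWeight ξ * ‖(𝓕 f : L2 N) ξ‖ ^ 2) := by
  have h1 : Integrable (fun ξ => ‖(𝓕 f : L2 N) ξ‖ ^ 2 + ∑ i, ‖(𝓕 (F i) : L2 N) ξ‖ ^ 2) :=
    (integrable_norm_sq_L2 _).add (integrable_finsetSum _ fun i _ => integrable_norm_sq_L2 _)
  refine h1.congr ?_
  filter_upwards [ae_all_iff.2 fun i => (h i).fourier] with ξ e1
  rw [sobolevWeight, ← norm_partialSymbol_sum, add_mul, one_mul, Finset.sum_mul]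
  congr 1
  refine Finset.sum_congr rfl fun i _ => ?_
  rw [e1, norm_mul, mul_pow]

theorem integrable_sobolevWeight_rpow {r : ℝ} (hr : (N : ℝ) < 2 * r) :
    Integrable (fun ξ : Rn N => sobolevWeight ξ ^ (-r)) := by
  have h1 := integrable_rpow_neg_one_add_norm_sq (E := Rn N) (μ := volume) (r := 2 * r)
    (by rwa [finrank_euclideanSpace_fin])
  refine h1.mono' (continuous_sobolevWeight_rpow _).aestronglyMeasurable (.of_forall fun ξ => ?_)
  rw [Real.norm_eq_abs, abs_of_pos (Real.rpow_pos_of_pos (sobolevWeight_pos ξ) _),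
    show -(2 * r) / 2 = -r by ring]
  have hr0 : 0 < r := by
    have : (0 : ℝ) ≤ N := by positivity
    linarith
  refine Real.rpow_le_rpow_of_nonpos (by positivity) ?_ (by linarith)
  have : 3 < Real.pi := Real.pi_gt_three
  have h2 : 1 ≤ 4 * Real.pi ^ 2 := by nlinarith
  unfold sobolevWeight
  nlinarith [sq_nonneg ‖ξ‖]

theorem integrable_fourier_mul_rpow {f : L2 N}
    (hf : Integrable (fun ξ => sobolevWeight ξ * ‖(𝓕 f : L2 N) ξ‖ ^ 2)) {δ : ℝ}
    (hδ : (N : ℝ) < 2 + 2 * δ) :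
    Integrable (fun ξ => ‖(𝓕 f : L2 N) ξ‖ * sobolevWeight ξ ^ (-(δ / 2))) := by
  have hm : AEStronglyMeasurable (fun ξ => ‖(𝓕 f : L2 N) ξ‖) volume :=
    (Lp.memLp (𝓕 f : L2 N)).1.norm
  have m1 : MemLp (fun ξ => sobolevWeight ξ ^ (1 / 2 : ℝ) * ‖(𝓕 f : L2 N) ξ‖) 2 volume := by
    have hm' : AEStronglyMeasurable
        (fun ξ => sobolevWeight ξ ^ (1 / 2 : ℝ) * ‖(𝓕 f : L2 N) ξ‖) volume :=
      (continuous_sobolevWeight_rpow _).aestronglyMeasurable.mul hm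
    rw [memLp_two_iff_integrable_sq_norm hm']
    refine hf.congr (.of_forall fun ξ => ?_)
    simp only
    have h0 := (sobolevWeight_pos ξ).le
    rw [norm_mul, mul_pow, norm_norm, Real.norm_eq_abs, sq_abs,
      ← Real.rpow_natCast (_ ^ (1 / 2 : ℝ)) 2, ← Real.rpow_mul h0]
    norm_num
  have m2 : MemLp (fun ξ : Rn N => sobolevWeight ξ ^ (-((1 + δ) / 2))) 2 volume := by
    rw [memLp_two_iff_integrable_sq_norm (continuous_sobolevWeight_rpow _).aestronglyMeasurable]
    refine (integrable_sobolevWeight_rpow (r := 1 + δ) (by linarith)).congr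
      (.of_forall fun ξ => ?_)
    simp only
    rw [Real.norm_eq_abs, sq_abs, ← Real.rpow_natCast _ 2, ← Real.rpow_mul (sobolevWeight_pos ξ).le]
    congr 1
    push_cast
    ring
  refine (m1.integrable_mul m2).congr (.of_forall fun ξ => ?_)
  simp only [Pi.mul_apply]
  rw [mul_right_comm, ← Real.rpow_add (sobolevWeight_pos ξ), mul_comm]
  congr 2
  ring

theorem eLpNorm_two_sq {f : Rn N → ℂ} : eLpNorm f 2 volume ^ 2 = ∫⁻ x, ‖f x‖ₑ ^ 2 := by
  rw [eLpNorm_eq_lintegral_rpow_enorm_toReal two_ne_zero ENNReal.ofNat_ne_top,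
    ← ENNReal.rpow_natCast, ← ENNReal.rpow_mul]
  norm_num

/-- The bound comes from splitting `f̂` into the frequencies with `T ≤ s`, where
`T = 2 C (1 + |2πξ|²)^{δ/2}`, which contribute at most `s / 2` to `|f|`,
and those with `s < T`, whose contribution is estimated by Chebyshev and Plancherel. -/
theorem meas_lt_norm_le {f : L2 N} {C δ : ℝ} (hC : 0 < C)
    (hJ : Integrable (fun ξ => ‖(𝓕 f : L2 N) ξ‖ * sobolevWeight ξ ^ (-(δ / 2))))
    (hJC : ∫ ξ, ‖(𝓕 f : L2 N) ξ‖ * sobolevWeight ξ ^ (-(δ / 2)) ≤ C) {s : ℝ} (hs : 0 < s) :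
    volume {x | s < ‖f x‖} ≤ ENNReal.ofReal (4 / s ^ 2) *
      volume.withDensity (fun ξ => ‖(𝓕 f : L2 N) ξ‖ₑ ^ 2)
        {ξ | s < 2 * C * sobolevWeight ξ ^ (δ / 2)} := by
  set S : Set (Rn N) := {ξ | s < 2 * C * sobolevWeight ξ ^ (δ / 2)}
  have hS : MeasurableSet S := measurableSet_lt measurable_const
    ((continuous_sobolevWeight_rpow _).measurable.const_mul _)
  obtain ⟨h, hh⟩ := exists_L2_fourier_eq (h := S.indicator fun ξ => (𝓕 f : L2 N) ξ)
    ((Lp.memLp (𝓕 f : L2 N)).indicator hS)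
  have hl : ∀ᵐ ξ, (𝓕 (f - h) : L2 N) ξ = Sᶜ.indicator (fun ξ => (𝓕 f : L2 N) ξ) ξ := by
    have e : (𝓕 (f - h) : L2 N) = 𝓕 f - 𝓕 h := map_sub (Lp.fourierTransformₗᵢ (Rn N) ℂ) _ _
    rw [e]
    filter_upwards [hh, Lp.coeFn_sub (𝓕 f : L2 N) (𝓕 h)] with ξ h1 h2
    rw [h2, Pi.sub_apply, h1]
    by_cases hξ : ξ ∈ S <;> simp [hξ]
  have hb : ∀ᵐ ξ, ‖(𝓕 (f - h) : L2 N) ξ‖ ≤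
      s / (2 * C) * (‖(𝓕 f : L2 N) ξ‖ * sobolevWeight ξ ^ (-(δ / 2))) := by
    filter_upwards [hl] with ξ h1
    rw [h1]
    have hw := Real.rpow_pos_of_pos (sobolevWeight_pos ξ) (δ / 2)
    have hw' := Real.rpow_pos_of_pos (sobolevWeight_pos ξ) (-(δ / 2))
    by_cases hξ : ξ ∈ S
    · simp only [mem_compl_iff, hξ, not_true_eq_false, not_false_eq_true, indicator_of_notMem,
        norm_zero]
      positivity
    · rw [indicator_of_mem (mem_compl hξ)]
      have h2 : 2 * C * sobolevWeight ξ ^ (δ / 2) ≤ s := not_lt.1 hξ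
      have h3 : sobolevWeight ξ ^ (δ / 2) ≤ s / (2 * C) := by
        rwa [le_div_iff₀' (by positivity)]
      calc ‖(𝓕 f : L2 N) ξ‖ = sobolevWeight ξ ^ (δ / 2) *
            (‖(𝓕 f : L2 N) ξ‖ * sobolevWeight ξ ^ (-(δ / 2))) := by
            rw [mul_left_comm, ← Real.rpow_add (sobolevWeight_pos ξ), add_neg_cancel,
              Real.rpow_zero, mul_one]
        _ ≤ _ := by gcongr
  have hint : Integrable (𝓕 (f - h) : L2 N) :=
    (hJ.const_mul _).mono' (Lp.memLp (𝓕 (f - h) : L2 N)).1 hb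
  have hsmall : ∫ ξ, ‖(𝓕 (f - h) : L2 N) ξ‖ ≤ s / 2 := by
    refine (integral_mono_ae hint.norm (hJ.const_mul _) hb).trans ?_
    rw [integral_const_mul]
    calc _ ≤ s / (2 * C) * C := by gcongr
      _ = s / 2 := by field_simp
  have hsub : {x | s < ‖f x‖} ≤ᵐ[volume] {x | ENNReal.ofReal (s / 2) ≤ ‖h x‖ₑ} := by
    filter_upwards [ae_norm_le_integral_fourier hint, Lp.coeFn_sub f h] with x h1 h2 hx
    have hx : s < ‖f x‖ := hx
    rw [h2, Pi.sub_apply] at h1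
    have h3 : ‖f x‖ ≤ ‖f x - h x‖ + ‖h x‖ := by
      simpa using norm_add_le (f x - h x) (h x)
    change ENNReal.ofReal (s / 2) ≤ ‖h x‖ₑ
    rw [← ofReal_norm]
    exact ENNReal.ofReal_le_ofReal (by linarith)
  have hs2 : ENNReal.ofReal (s / 2) ≠ 0 := by simpa using hs
  have hnorm : eLpNorm h 2 volume = eLpNorm (𝓕 h : L2 N) 2 volume := by
    rw [← Lp.enorm_def, ← Lp.enorm_def, ← ofReal_norm, ← ofReal_norm,
      Lp.norm_fourier_eq]
  calc volume {x | s < ‖f x‖} ≤ volume {x | ENNReal.ofReal (s / 2) ≤ ‖h x‖ₑ} :=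
        measure_mono_ae hsub
    _ ≤ _ := meas_ge_le_mul_pow_eLpNorm_enorm volume two_ne_zero ENNReal.ofNat_ne_top
        (Lp.memLp h).1 hs2 (by simp)
    _ = ENNReal.ofReal (4 / s ^ 2) * ∫⁻ ξ, ‖(𝓕 h : L2 N) ξ‖ₑ ^ 2 := by
        rw [hnorm, ← eLpNorm_two_sq]
        simp only [ENNReal.toReal_ofNat, ENNReal.rpow_ofNat]
        rw [← ENNReal.ofReal_inv_of_pos (by positivity), ← ENNReal.ofReal_pow (by positivity)]
        congr 2
        field_simp
        norm_num
    _ = _ := by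
        rw [withDensity_apply _ hS, ← lintegral_indicator hS]
        congr 1
        refine lintegral_congr_ae ?_
        filter_upwards [hh] with ξ h1
        rw [h1]
        by_cases hξ : ξ ∈ S <;> simp [hξ]

/-- The distributional estimate `meas_lt_norm_le`, integrated against `q s^{q-1} ds`. -/
theorem lintegral_norm_rpow_le {f : L2 N} {C δ q : ℝ} (hC : 0 < C) (hq : 2 < q)
    (hJ : Integrable (fun ξ => ‖(𝓕 f : L2 N) ξ‖ * sobolevWeight ξ ^ (-(δ / 2))))
    (hJC : ∫ ξ, ‖(𝓕 f : L2 N) ξ‖ * sobolevWeight ξ ^ (-(δ / 2)) ≤ C) :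
    ∫⁻ x, ENNReal.ofReal (‖f x‖ ^ q) ≤ ENNReal.ofReal (q * 4 / (q - 2)) *
      ∫⁻ ξ, ENNReal.ofReal ((2 * C * sobolevWeight ξ ^ (δ / 2)) ^ (q - 2))
        ∂(volume.withDensity fun ξ => ‖(𝓕 f : L2 N) ξ‖ₑ ^ 2) := by
  set ν := (volume : Measure (Rn N)).withDensity (fun ξ => ‖(𝓕 f : L2 N) ξ‖ₑ ^ 2) with hν
  set T : Rn N → ℝ := fun ξ => 2 * C * sobolevWeight ξ ^ (δ / 2)
  have hq2 : 0 < q - 2 := by linarith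
  have hq0 : 0 < q := by linarith
  have hT0 : ∀ ξ, 0 ≤ T ξ := fun ξ => by
    have := Real.rpow_nonneg (sobolevWeight_pos ξ).le (δ / 2)
    positivity
  have hTm : Measurable T := (continuous_sobolevWeight_rpow _).measurable.const_mul _
  -- the layer cake formula, for `f` and for `T`
  rw [lintegral_rpow_eq_lintegral_meas_lt_mul volume (.of_forall fun x => norm_nonneg (f x))
    (Lp.memLp f).1.norm.aemeasurable hq0,
    lintegral_rpow_eq_lintegral_meas_lt_mul ν (.of_forall hT0) hTm.aemeasurable hq2,
    ← mul_assoc, ← ENNReal.ofReal_mul (by positivity), div_mul_cancel₀ _ hq2.ne',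
    ENNReal.ofReal_mul hq0.le, mul_assoc]
  refine mul_le_mul_right ?_ _
  rw [← lintegral_const_mul' _ _ ENNReal.ofReal_ne_top]
  refine lintegral_mono_ae ((ae_restrict_iff' measurableSet_Ioi).2 (.of_forall fun s hs => ?_))
  have hs : 0 < s := hs
  have hmeas : volume {x | s < ‖f x‖} ≤ ENNReal.ofReal (4 / s ^ 2) * ν {ξ | s < T ξ} :=
    meas_lt_norm_le hC hJ hJC hs
  generalize ν {ξ | s < T ξ} = b at hmeas
  refine (mul_le_mul_left hmeas _).trans (le_of_eq ?_)
  have e : s ^ (q - 1) = s ^ 2 * s ^ (q - 2 - 1) := by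
    rw [← Real.rpow_natCast s 2, ← Real.rpow_add hs]
    congr 1
    push_cast; ring
  rw [mul_right_comm, ← ENNReal.ofReal_mul (by positivity), e, mul_comm b,
    ← mul_assoc (ENNReal.ofReal 4), ← ENNReal.ofReal_mul (by norm_num : (0 : ℝ) ≤ 4)]
  congr 2
  field_simp

theorem lintegral_sobolevWeight_lt_top {f : L2 N} {C δ r : ℝ} (hC : 0 < C) (hr : δ / 2 * r = 1)
    (hW : Integrable (fun ξ => sobolevWeight ξ * ‖(𝓕 f : L2 N) ξ‖ ^ 2)) :
    ∫⁻ ξ, ENNReal.ofReal ((2 * C * sobolevWeight ξ ^ (δ / 2)) ^ r)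
        ∂(volume.withDensity fun ξ => ‖(𝓕 f : L2 N) ξ‖ₑ ^ 2) < ⊤ := by
  have hd : AEMeasurable (fun ξ => ‖(𝓕 f : L2 N) ξ‖ₑ ^ 2) (volume : Measure (Rn N)) :=
    (Lp.memLp (𝓕 f : L2 N)).1.enorm.pow_const 2
  have hT : Measurable fun ξ : Rn N =>
      ENNReal.ofReal ((2 * C * sobolevWeight ξ ^ (δ / 2)) ^ r) :=
    (((continuous_sobolevWeight_rpow _).measurable.const_mul _).pow_const _).ennreal_ofReal
  rw [lintegral_withDensity_eq_lintegral_mul₀ hd hT.aemeasurable]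
  have h1 := (hW.const_mul ((2 * C) ^ r)).lintegral_lt_top
  refine lt_of_eq_of_lt (lintegral_congr fun ξ => ?_) h1
  have e1 : (2 * C * sobolevWeight ξ ^ (δ / 2)) ^ r = (2 * C) ^ r * sobolevWeight ξ := by
    rw [Real.mul_rpow (by positivity) (Real.rpow_nonneg (sobolevWeight_pos ξ).le _),
      ← Real.rpow_mul (sobolevWeight_pos ξ).le, hr, Real.rpow_one]
  rw [Pi.mul_apply, e1, ← ofReal_norm, ← ENNReal.ofReal_pow (norm_nonneg _),
    ← ENNReal.ofReal_mul (by positivity)]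
  congr 1
  ring

/-- The Sobolev embedding `H¹(ℝ^N) ⊆ L^q(ℝ^N)`, for `2 < q` and `(N - 2)(q - 2) < 4`. Each level
set of `|f|` is estimated by cutting `f̂` at a frequency that grows with the level. -/
theorem memLp_of_hasWeakPartial {q : ℝ} (hq : 2 < q) (hqN : ((N : ℝ) - 2) * (q - 2) < 4)
    {f : L2 N} {F : Fin N → L2 N} (h : ∀ i, HasWeakPartial i f (F i)) :
    MemLp f (ENNReal.ofReal q) volume := by
  have hq0 : 0 < q := by linarith
  have hq2 : 0 < q - 2 := by linarith
  -- the exponent for which `(2 C w ^ (δ / 2)) ^ (q - 2)` is a multiple of the weight `w`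
  set δ := 2 / (q - 2) with hδdef
  have hδ : (N : ℝ) < 2 + 2 * δ := by
    have : (N : ℝ) - 2 < 4 / (q - 2) := by rwa [lt_div_iff₀ hq2]
    have e : 4 / (q - 2) = 2 * δ := by rw [hδdef]; ring
    linarith
  have hW := integrable_sobolevWeight_mul h
  have hJ := integrable_fourier_mul_rpow hW hδ
  have hJ0 : 0 ≤ ∫ ξ, ‖(𝓕 f : L2 N) ξ‖ * sobolevWeight ξ ^ (-(δ / 2)) :=
    integral_nonneg fun ξ => mul_nonneg (norm_nonneg _)
      (Real.rpow_nonneg (sobolevWeight_pos ξ).le _)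
  have hC : 0 < (∫ ξ, ‖(𝓕 f : L2 N) ξ‖ * sobolevWeight ξ ^ (-(δ / 2))) + 1 := by linarith
  have key := lintegral_norm_rpow_le hC hq hJ (by linarith)
  have hfin := lintegral_sobolevWeight_lt_top (δ := δ) (r := q - 2) hC
    (by rw [hδdef]; field_simp) hW
  refine ⟨(Lp.memLp f).1, ?_⟩
  rw [eLpNorm_lt_top_iff_lintegral_rpow_enorm_lt_top (by simpa using hq0) ENNReal.ofReal_ne_top,
    ENNReal.toReal_ofReal hq0.le]
  refine lt_of_eq_of_lt (lintegral_congr fun x => ?_)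
    (key.trans_lt (ENNReal.mul_lt_top ENNReal.ofReal_lt_top hfin))
  rw [← ofReal_norm, ENNReal.ofReal_rpow_of_nonneg (norm_nonneg _) hq0.le]

/-! ### Integration by parts for `f ∈ L^q` with `∇f ∈ L²` -/

theorem expo_eq {p : ℝ} (hp : 1 < p) : expo p = ENNReal.ofReal (p + 1) := by
  rw [expo, ENNReal.ofReal_add (by linarith) one_pos.le, ENNReal.ofReal_one]

theorem two_le_expo {p : ℝ} (hp : 1 < p) : 2 ≤ expo p := by
  rw [expo_eq hp, ← ENNReal.ofReal_ofNat 2]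
  exact ENNReal.ofReal_le_ofReal (by linarith)

theorem expo_toReal {p : ℝ} (hp : 1 < p) : (expo p).toReal = p + 1 := by
  rw [expo_eq hp, ENNReal.toReal_ofReal (by linarith)]

theorem eLpNorm_mul_le_of_indicator {q : ℝ≥0∞} (hq : 2 ≤ q) {h : Rn N → ℝ} {c ρ : ℝ}
    (hh : ∀ x, |h x| ≤ (Metric.closedBall (0 : Rn N) ρ).indicator (fun _ => c) x)
    {f : Rn N → ℂ} (hf : MemLp f q volume) :
    eLpNorm (fun x => (h x : ℂ) * f x) 2 volume ≤ ENNReal.ofReal c *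
      (eLpNorm f q volume *
        volume (Metric.closedBall (0 : Rn N) ρ) ^ (1 / (2 : ℝ) - 1 / q.toReal)) := by
  set B := Metric.closedBall (0 : Rn N) ρ
  have hB : MeasurableSet B := measurableSet_closedBall
  calc eLpNorm (fun x => (h x : ℂ) * f x) 2 volume
      ≤ ENNReal.ofReal c * eLpNorm (B.indicator f) 2 volume := by
        refine eLpNorm_le_mul_eLpNorm_of_ae_le_mul (.of_forall fun x => ?_) 2
        rw [norm_mul, Complex.norm_real, Real.norm_eq_abs]
        by_cases hx : x ∈ B
        · rw [indicator_of_mem hx]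
          have := hh x
          rw [indicator_of_mem hx] at this
          gcongr
        · have := hh x
          rw [indicator_of_notMem hx] at this
          rw [indicator_of_notMem hx, le_antisymm this (abs_nonneg _)]
          simp
    _ = ENNReal.ofReal c * eLpNorm f 2 (volume.restrict B) := by
        rw [eLpNorm_indicator_eq_eLpNorm_restrict hB]
    _ ≤ _ := by
        gcongr
        refine (eLpNorm_le_eLpNorm_mul_rpow_measure_univ hq hf.1.restrict).trans ?_
        rw [Measure.restrict_apply_univ, ENNReal.toReal_ofNat]
        gcongr
        exact Measure.restrict_le_self

theorem memLp_mul_of_indicator {q : ℝ≥0∞} (hq : 2 ≤ q) {h : Rn N → ℝ}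
    (hc : Continuous h) {c ρ : ℝ}
    (hh : ∀ x, |h x| ≤ (Metric.closedBall (0 : Rn N) ρ).indicator (fun _ => c) x)
    {f : Rn N → ℂ} (hf : MemLp f q volume) : MemLp (fun x => (h x : ℂ) * f x) 2 volume := by
  refine ⟨(Complex.continuous_ofReal.comp hc).aestronglyMeasurable.mul hf.1,
    (eLpNorm_mul_le_of_indicator hq hh hf).trans_lt ?_⟩
  refine ENNReal.mul_lt_top ENNReal.ofReal_lt_top (ENNReal.mul_lt_top hf.2 ?_)
  refine ENNReal.rpow_lt_top_of_nonneg ?_ measure_closedBall_lt_top.ne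
  rcases eq_or_ne q ∞ with rfl | hq'
  · simp
  · have h2 : (2 : ℝ) ≤ q.toReal := by
      rw [← ENNReal.toReal_ofNat]
      exact ENNReal.toReal_mono hq' hq
    have := one_div_le_one_div_of_le two_pos h2
    linarith

theorem cutoff_le_indicator {R : ℝ} (hR : 0 < R) (x : Rn N) :
    |cutoff N R x| ≤ (Metric.closedBall (0 : Rn N) (2 * R)).indicator (fun _ => 1) x := by
  by_cases hx : x ∈ Metric.closedBall (0 : Rn N) (2 * R)
  · rw [indicator_of_mem hx, abs_of_nonneg (cutoff_nonneg R x)]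
    exact cutoff_le_one R x
  · rw [indicator_of_notMem hx, cutoff, (unitBump N).zero_of_le_dist, abs_zero]
    rw [mem_closedBall_zero_iff] at hx
    rw [dist_zero_right, norm_smul, norm_inv, Real.norm_eq_abs, abs_of_pos hR,
      le_inv_mul_iff₀ hR]
    change R * 2 ≤ ‖x‖
    linarith

/-- `‖f ∂ᵢχ_R‖₂ → 0` for the cutoffs `χ_R` and `f ∈ L^q`, `q < 2N/(N-2)`. -/
theorem tendsto_eLpNorm_partial_cutoff_mul (i : Fin N) {q : ℝ≥0∞} (hq : 2 ≤ q)
    (hqN : (N : ℝ) * (1 / 2 - 1 / q.toReal) < 1) {f : Rn N → ℂ}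
    (hf : MemLp f q volume) :
    Tendsto (fun R : ℝ => eLpNorm
      (fun x => ((fderiv ℝ (cutoff N R) x (coordVec i) : ℝ) : ℂ) * f x) 2 volume)
      atTop (𝓝 0) := by
  obtain ⟨C, hC0, hC⟩ := exists_abs_partial_cutoff_le (N := N) i
  set θ := 1 / (2 : ℝ) - 1 / q.toReal
  by_cases hθ : θ < 0
  · exfalso
    rcases eq_or_ne q ∞ with rfl | hq'
    · norm_num [θ] at hθ
    · have h2 : (2 : ℝ) ≤ q.toReal := by
        rw [← ENNReal.toReal_ofNat]
        exact ENNReal.toReal_mono hq' hq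
      have := one_div_le_one_div_of_le two_pos h2
      simp only [θ] at hθ
      linarith
  have hθ : 0 ≤ θ := not_lt.1 hθ
  set v := volume (Metric.ball (0 : Rn N) 1)
  have hv : v ≠ ⊤ := measure_ball_lt_top.ne
  set K : ℝ≥0∞ := eLpNorm f q volume * (ENNReal.ofReal (2 ^ N) * v) ^ θ
  have hK : K ≠ ⊤ := (ENNReal.mul_lt_top hf.2 (ENNReal.rpow_lt_top_of_nonneg hθ
    (ENNReal.mul_lt_top ENNReal.ofReal_lt_top hv.lt_top).ne)).ne
  have hb : ∀ᶠ R : ℝ in atTop, eLpNorm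
      (fun x => ((fderiv ℝ (cutoff N R) x (coordVec i) : ℝ) : ℂ) * f x) 2 volume
      ≤ ENNReal.ofReal (C * R ^ (-(1 - N * θ))) * K := by
    filter_upwards [eventually_gt_atTop 0] with R hR
    refine (eLpNorm_mul_le_of_indicator hq (hC R hR) hf).trans (le_of_eq ?_)
    rw [Measure.addHaar_closedBall _ _ (by positivity), finrank_euclideanSpace_fin, mul_pow,
      ENNReal.ofReal_mul (by positivity), mul_right_comm,
      ENNReal.mul_rpow_of_nonneg _ _ hθ, ENNReal.ofReal_rpow_of_nonneg (p := θ) (by positivity) hθ]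
    have e : R ^ (-(1 - N * θ)) = R⁻¹ * (R ^ N) ^ θ := by
      rw [show -(1 - (N : ℝ) * θ) = -1 + N * θ by ring, Real.rpow_add hR, Real.rpow_neg_one,
        Real.rpow_mul hR.le, Real.rpow_natCast]
    rw [e, div_eq_mul_inv, ← mul_assoc C, ENNReal.ofReal_mul (by positivity : 0 ≤ C * R⁻¹)]
    simp only [K]
    ring
  have hlim : Tendsto (fun R : ℝ => ENNReal.ofReal (C * R ^ (-(1 - N * θ))) * K) atTop
      (𝓝 0) := by
    have h1 := (tendsto_rpow_neg_atTop (y := 1 - N * θ) (by linarith)).const_mul C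
    rw [mul_zero] at h1
    have h2 := ENNReal.Tendsto.mul_const (ENNReal.tendsto_ofReal h1) (b := K) (.inr hK)
    simpa using h2
  exact tendsto_of_tendsto_of_tendsto_of_le_of_le' tendsto_const_nhds hlim
    (.of_forall fun _ => zero_le) hb

/-- `⟨∇f, E⟩ = -⟨f, div E⟩` for a field `E ∈ L²` with `∂ᵢEᵢ = Kᵢ ∈ L²`. The function `f` need not be
in `L²`; it is truncated, and the commutators `f ∂ᵢχ_R` vanish in the limit. -/
theorem integral_weakGrad_mul {q : ℝ≥0∞} (hq : 2 ≤ q)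
    (hqN : (N : ℝ) * (1 / 2 - 1 / q.toReal) < 1) {f : Rn N → ℂ} (hf : MemLp f q volume)
    {F : L2vec N} (hF : HasWeakGrad f F) {E K : Fin N → L2 N}
    (hE : ∀ i, HasWeakPartial i (E i) (K i))
    (hint : Integrable (fun x => f x * conj ((∑ i, K i : L2 N) x))) :
    ∑ i, ∫ x, F x i * conj (E i x) = - ∫ x, f x * conj ((∑ i, K i : L2 N) x) := by
  set L : L2 N := ∑ i, K i with hL
  have hFi : ∀ i, Integrable (fun x => F x i * conj (E i x)) := fun i =>
    (memLp_comp F i).integrable_mul (Lp.memLp (E i)).star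
  have hfl : LocallyIntegrable f volume := hf.locallyIntegrable (one_le_two.trans hq)
  -- the truncated functions and the commutators, in `L²`
  have mχ : ∀ R : ℝ, 0 < R → MemLp (fun x => (cutoff N R x : ℂ) * f x) 2 volume := fun R hR =>
    memLp_mul_of_indicator hq (cutoff_isTest hR).1.continuous (cutoff_le_indicator hR) hf
  have mD : ∀ i, ∀ R : ℝ, 0 < R → MemLp
      (fun x => ((fderiv ℝ (cutoff N R) x (coordVec i) : ℝ) : ℂ) * f x) 2 volume := fun i R hR => by
    obtain ⟨C, hC0, hC⟩ := exists_abs_partial_cutoff_le (N := N) i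
    exact memLp_mul_of_indicator hq ((cutoff_isTest hR).partial i).1 (hC R hR) hf
  have mF : ∀ i, ∀ R : ℝ, 0 < R → MemLp (fun x => (cutoff N R x : ℂ) * F x i) 2 volume :=
    fun i R hR => (memLp_comp F i).mono
      ((Complex.continuous_ofReal.comp (cutoff_isTest hR).1.continuous).aestronglyMeasurable.mul
        (memLp_comp F i).1) (.of_forall fun x => norm_cutoff_mul_le R x _)
  have step : ∀ R : ℝ, 0 < R →
      ∑ i, ((∫ x, (cutoff N R x : ℂ) * (F x i * conj (E i x)))
        + ∫ x, ((fderiv ℝ (cutoff N R) x (coordVec i) : ℝ) : ℂ) * f x * conj (E i x))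
      = - ∫ x, (cutoff N R x : ℂ) * (f x * conj (L x)) := by
    intro R hR
    set fR : L2 N := (mχ R hR).toLp _
    have h1 : ∀ i, ((∫ x, (cutoff N R x : ℂ) * (F x i * conj (E i x)))
        + ∫ x, ((fderiv ℝ (cutoff N R) x (coordVec i) : ℝ) : ℂ) * f x * conj (E i x))
        = - ⟪K i, fR⟫_ℂ := by
      intro i
      set gR : L2 N := ((mF i R hR).add (mD i R hR)).toLp _
      have hw : HasWeakPartial i fR gR :=
        ((hasWeakGrad_iff.1 hF i).cutoff_mul hfl (locInt_comp F i) (cutoff_isTest hR)).congr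
          (MemLp.coeFn_toLp _) (MemLp.coeFn_toLp _)
      have h2 := (hE i).inner_eq hw
      rw [h2, neg_neg, inner_L2_eq, ← integral_add]
      · refine integral_congr_ae ?_
        filter_upwards [MemLp.coeFn_toLp ((mF i R hR).add (mD i R hR))] with x hx
        rw [hx, Pi.add_apply]
        ring
      · simp only [← mul_assoc]
        exact (mF i R hR).integrable_mul (Lp.memLp (E i)).star
      · exact (mD i R hR).integrable_mul (Lp.memLp (E i)).star
    rw [Finset.sum_congr rfl fun i _ => h1 i, Finset.sum_neg_distrib, ← sum_inner, ← hL,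
      inner_L2_eq]
    congr 1
    refine integral_congr_ae ?_
    filter_upwards [MemLp.coeFn_toLp (mχ R hR)] with x hx
    rw [hx, mul_assoc]
  have l0 : ∀ i, Tendsto (fun R : ℝ =>
      ∫ x, ((fderiv ℝ (cutoff N R) x (coordVec i) : ℝ) : ℂ) * f x * conj (E i x)) atTop
      (𝓝 0) := by
    intro i
    have h1 := (ENNReal.tendsto_toReal ENNReal.zero_ne_top).comp
      (tendsto_eLpNorm_partial_cutoff_mul i hq hqN hf)
    have h2 := h1.mul_const ‖E i‖
    rw [ENNReal.toReal_zero, zero_mul] at h2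
    refine squeeze_zero_norm' ?_ h2
    filter_upwards [eventually_gt_atTop 0] with R hR
    have h3 : ∫ x, ((fderiv ℝ (cutoff N R) x (coordVec i) : ℝ) : ℂ) * f x * conj (E i x)
        = ⟪E i, (mD i R hR).toLp _⟫_ℂ := by
      rw [inner_L2_eq]
      refine integral_congr_ae ?_
      filter_upwards [MemLp.coeFn_toLp (mD i R hR)] with x hx
      rw [hx]
    rw [h3]
    refine (norm_inner_le_norm _ _).trans (le_of_eq ?_)
    rw [Lp.norm_toLp, mul_comm]
    rfl
  have l1 : Tendsto (fun R : ℝ =>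
      ∑ i, ((∫ x, (cutoff N R x : ℂ) * (F x i * conj (E i x)))
        + ∫ x, ((fderiv ℝ (cutoff N R) x (coordVec i) : ℝ) : ℂ) * f x * conj (E i x))) atTop
      (𝓝 (∑ i, ((∫ x, F x i * conj (E i x)) + 0))) :=
    tendsto_finsetSum _ fun i _ => (tendsto_integral_cutoff_mul (hFi i)).add (l0 i)
  have l2 := (tendsto_integral_cutoff_mul hint).neg
  simp only [add_zero] at l1
  refine tendsto_nhds_unique l1 (l2.congr' ?_)
  filter_upwards [eventually_gt_atTop 0] with R hR
  rw [step R hR]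

/-! ### Change of the parameter `λ` -/

theorem inner_L2vec_eq (F H : L2vec N) : ⟪H, F⟫_ℂ = gradPairing F H := by
  rw [L2.inner_def, gradPairing]
  refine integral_congr_ae (.of_forall fun x => ?_)
  simp [PiLp.inner_apply]

theorem gradPairing_eq_sum (F H : L2vec N) :
    gradPairing F H = ∑ i, ∫ x, F x i * conj (H x i) := by
  rw [gradPairing, integral_finsetSum]
  exact fun i _ => (memLp_comp F i).integrable_mul (memLp_comp H i).star

theorem exists_L2vec (E : Fin N → L2 N) : ∃ F : L2vec N, ∀ i, (fun x => F x i) =ᵐ[volume] E i := by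
  have h : MemLp (fun x => (WithLp.toLp 2 fun i => E i x : Cn N)) 2 (volume : Measure (Rn N)) :=
    MemLp.of_eval_piLp fun i => Lp.memLp (E i)
  refine ⟨h.toLp _, fun i => ?_⟩
  filter_upwards [h.coeFn_toLp] with x hx
  rw [hx]

/-- The components of a vector field in `L²`, as elements of `L²`. -/
def L2vec.comp (F : L2vec N) (i : Fin N) : L2 N := (memLp_comp F i).toLp _

theorem L2vec.coeFn_comp (F : L2vec N) (i : Fin N) :
    F.comp i =ᵐ[volume] fun x => F x i := MemLp.coeFn_toLp _

theorem exists_gradient_greenDiff (h23 : N = 2 ∨ N = 3) {lam mu : ℝ} (hl : 0 < lam)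
    (hm : 0 < mu) :
    ∃ (E : L2vec N) (K : Fin N → Fin N → L2 N),
      HasWeakGrad (greenDiffL2 h23 hl hm) E ∧
      (∀ i j, HasWeakPartial j (E.comp i) (K i j)) ∧
      ∑ i, K i i = (lam : ℂ) • greenL2 h23 hl - (mu : ℂ) • greenL2 h23 hm := by
  obtain ⟨E, K, h1, h2, h3⟩ := exists_weakPartial_greenDiff h23 hl hm
  obtain ⟨F, hF⟩ := exists_L2vec E
  exact ⟨F, K, hasWeakGrad_iff.2 fun i => (h1 i).congr .rfl (hF i),
    fun i j => (h2 i j).congr ((F.coeFn_comp i).trans (hF i)) .rfl, h3⟩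

theorem integrable_L2_mul_conj_green (h23 : N = 2 ∨ N = 3) {lam : ℝ} (hl : 0 < lam)
    {f : Rn N → ℂ} (hf : MemLp f 2 volume) : Integrable (fun x => f x * conj (green N lam x)) :=
  hf.integrable_mul (memLp_green_two h23 hl).star

theorem pairing_L2_green (h23 : N = 2 ∨ N = 3) {lam : ℝ} (hl : 0 < lam) (f : L2 N) :
    pairing f (green N lam) = ⟪greenL2 h23 hl, f⟫_ℂ := by
  rw [inner_L2_eq, pairing]
  refine integral_congr_ae ?_
  filter_upwards [coeFn_greenL2 h23 hl] with x hx
  rw [hx]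

theorem pairing_congr {f f' g : Rn N → ℂ} (h : f =ᵐ[volume] f') : pairing f g = pairing f' g :=
  integral_congr_ae (by filter_upwards [h] with x hx; rw [hx])

/-- `⟨∇f, ∇(G_λ - G_μ)⟩ = -⟨f, λG_λ - μG_μ⟩`. -/
theorem inner_gradient_greenDiff (h23 : N = 2 ∨ N = 3) {lam mu : ℝ} (hl : 0 < lam) (hm : 0 < mu)
    {E : L2vec N} {K : Fin N → Fin N → L2 N} (hK : ∀ i j, HasWeakPartial j (E.comp i) (K i j))
    (hsum : ∑ i, K i i = (lam : ℂ) • greenL2 h23 hl - (mu : ℂ) • greenL2 h23 hm)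
    {q : ℝ≥0∞} (hq : 2 ≤ q) (hqN : (N : ℝ) * (1 / 2 - 1 / q.toReal) < 1) {f : Rn N → ℂ}
    (hf : MemLp f q volume) {F : L2vec N} (hF : HasWeakGrad f F)
    (i1 : Integrable (fun x => f x * conj (green N lam x)))
    (i2 : Integrable (fun x => f x * conj (green N mu x))) :
    ⟪E, F⟫_ℂ = -(lam * pairing f (green N lam) - mu * pairing f (green N mu)) := by
  have hL : (fun x => f x * conj ((∑ i, K i i : L2 N) x)) =ᵐ[volume] fun x =>
      (lam : ℂ) * (f x * conj (green N lam x)) - (mu : ℂ) * (f x * conj (green N mu x)) := by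
    rw [hsum]
    filter_upwards [Lp.coeFn_sub ((lam : ℂ) • greenL2 h23 hl) ((mu : ℂ) • greenL2 h23 hm),
      Lp.coeFn_smul (lam : ℂ) (greenL2 h23 hl), Lp.coeFn_smul (mu : ℂ) (greenL2 h23 hm),
      coeFn_greenL2 h23 hl, coeFn_greenL2 h23 hm] with x h1 h2 h3 h4 h5
    rw [h1, Pi.sub_apply, h2, h3, Pi.smul_apply, Pi.smul_apply, h4, h5]
    simp only [smul_eq_mul, map_sub, map_mul, Complex.conj_ofReal]
    ring
  have h := integral_weakGrad_mul hq hqN hf hF (E := fun i => E.comp i) (K := fun i => K i i)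
    (fun i => hK i i) (((i1.const_mul _).sub (i2.const_mul _)).congr hL.symm)
  rw [integral_congr_ae hL, integral_sub (i1.const_mul _) (i2.const_mul _), integral_const_mul,
    integral_const_mul] at h
  rw [inner_L2vec_eq, gradPairing_eq_sum, pairing, pairing, ← h]
  refine Finset.sum_congr rfl fun i _ => integral_congr_ae ?_
  filter_upwards [E.coeFn_comp i] with x hx
  rw [hx]

/-! ### The exponents -/

theorem memLp_green_expo (h23 : N = 2 ∨ N = 3) {p : ℝ} (hp : 1 < p) (hp' : N = 3 → p < 2)
    {lam : ℝ} (hl : 0 < lam) : MemLp (green N lam) (expo p) volume := by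
  rw [expo_eq hp]
  refine memLp_green (by omega) hl (by linarith) ?_
  rcases h23 with rfl | rfl
  · norm_num
  · have := hp' rfl
    push_cast; linarith

theorem memLp_green_conj (h23 : N = 2 ∨ N = 3) {p : ℝ} (hp : 1 < p) {lam : ℝ} (hl : 0 < lam) :
    MemLp (green N lam) (ENNReal.ofReal (p + 1).conjExponent) volume := by
  have hp0 : p ≠ 0 := by linarith
  have e : (p + 1).conjExponent = 1 + 1 / p := by
    rw [Real.conjExponent, add_sub_cancel_right, add_div, div_self hp0]
  have h1 : 1 / p < 1 := by rw [div_lt_one (by linarith)]; exact hp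
  have h0 : 0 < 1 / p := by positivity
  rw [e]
  refine memLp_green (by omega) hl (by linarith) ?_
  rcases h23 with rfl | rfl
  · norm_num
  · push_cast; linarith

theorem holderConjugate_expo {p : ℝ} (hp : 1 < p) :
    (expo p).HolderConjugate (ENNReal.ofReal (p + 1).conjExponent) := by
  rw [expo_eq hp]
  exact (Real.HolderConjugate.conjExponent (by linarith)).ennrealOfReal

theorem integrable_Lpp_mul_conj_green (h23 : N = 2 ∨ N = 3) {p : ℝ} (hp : 1 < p) {lam : ℝ}
    (hl : 0 < lam) (u : Lpp N p) : Integrable (fun x => u x * conj (green N lam x)) := by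
  have := holderConjugate_expo hp
  exact (Lp.memLp u).integrable_mul (memLp_green_conj h23 hp hl).star

theorem expo_sobolev (h23 : N = 2 ∨ N = 3) {p : ℝ} (hp : 1 < p) (hp' : N = 3 → p < 2) :
    (N : ℝ) * (1 / 2 - 1 / (expo p).toReal) < 1 := by
  rw [expo_toReal hp]
  have h0 : 0 < 1 / (p + 1) := by
    have : 0 < p + 1 := by linarith
    positivity
  rcases h23 with rfl | rfl
  · push_cast; linarith
  · have h3 : 1 / 3 < 1 / (p + 1) :=
      one_div_lt_one_div_of_lt (by linarith) (by linarith [hp' rfl])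
    push_cast; linarith

/-! ### Independence of `λ` -/

/-- `G_λ - G_μ` as an element of `L^{p+1}`. -/
def greenDiffLpp (h23 : N = 2 ∨ N = 3) {p : ℝ} (hp : 1 < p) (hp' : N = 3 → p < 2) {lam mu : ℝ}
    (hl : 0 < lam) (hm : 0 < mu) : Lpp N p :=
  ((memLp_green_expo h23 hp hp' hl).sub (memLp_green_expo h23 hp hp' hm)).toLp _

theorem coeFn_greenDiffLpp (h23 : N = 2 ∨ N = 3) {p : ℝ} (hp : 1 < p) (hp' : N = 3 → p < 2)
    {lam mu : ℝ} (hl : 0 < lam) (hm : 0 < mu) :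
    greenDiffLpp h23 hp hp' hl hm =ᵐ[volume] fun x => green N lam x - green N mu x :=
  MemLp.coeFn_toLp _

/-- Passing from `λ` to `μ` replaces `f` by `f + c (G_λ - G_μ)`. -/
theorem IsDecomp.change (h23 : N = 2 ∨ N = 3) {p : ℝ} (hp : 1 < p) (hp' : N = 3 → p < 2)
    {lam mu : ℝ} (hl : 0 < lam) (hm : 0 < mu) {E : L2vec N}
    (hE : HasWeakGrad (greenDiffL2 h23 hl hm) E) {u f : Lpp N p} {F : L2vec N} {c : ℂ}
    (h : IsDecomp lam u f F c) :
    IsDecomp mu u (f + c • greenDiffLpp h23 hp hp' hl hm) (F + c • E) c := by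
  set D := greenDiffLpp h23 hp hp' hl hm
  have hD : IsDecomp mu D D E 0 := by
    refine ⟨hE.congr ?_ .rfl, by simp⟩
    exact (coeFn_greenDiffLpp h23 hp hp' hl hm).trans (coeFn_greenDiffL2 h23 hl hm).symm
  have h1 : IsDecomp mu (u - c • D) f F c := by
    refine ⟨h.1, ?_⟩
    filter_upwards [h.2, Lp.coeFn_sub u (c • D), Lp.coeFn_smul c D,
      coeFn_greenDiffLpp h23 hp hp' hl hm] with x h1 h2 h3 h4
    rw [h2, Pi.sub_apply, h3, Pi.smul_apply, h4, h1, smul_eq_mul]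
    ring
  have h2 := h1.add (hD.smul c)
  rwa [sub_add_cancel, mul_zero, add_zero] at h2

theorem X0Submodule_le (h23 : N = 2 ∨ N = 3) {p : ℝ} (hp : 1 < p) (hp' : N = 3 → p < 2)
    {lam mu : ℝ} (hl : 0 < lam) (hm : 0 < mu) : X0Submodule N p lam ≤ X0Submodule N p mu := by
  rintro u ⟨f, F, c, h⟩
  obtain ⟨E, K, hE, -, -⟩ := exists_gradient_greenDiff h23 hl hm
  exact ⟨_, _, _, h.change h23 hp hp' hl hm hE⟩

/-- `β(μ) - β(λ) = (μ - λ) ⟨G_λ, G_μ⟩`, by evaluating `G_λ - G_μ` at the origin. -/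
theorem beta_sub_eq (h23 : N = 2 ∨ N = 3) {lam mu : ℝ} (hl : 0 < lam) (hm : 0 < mu) :
    ((beta N mu - beta N lam : ℝ) : ℂ)
      = (mu - lam) * ⟪greenL2 h23 hl, greenL2 h23 hm⟫_ℂ := by
  obtain ⟨E, K, hE, hK, hs⟩ := exists_gradient_greenDiff h23 hl hm
  have h := inner_greenL2_eq h23 hl (f := greenDiffL2 h23 hl hm)
    (f₀ := fun x => (greenDiff N lam mu x : ℂ))
    (Complex.continuous_ofReal.comp (continuous_greenDiff h23 hl hm))
    ((coeFn_greenDiffL2 h23 hl hm).trans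
      (by filter_upwards [greenDiff_ae (by omega) hl hm] with x hx using hx.symm))
    (F := fun i => E.comp i) (H := fun i => K i i)
    (fun i => (hasWeakGrad_iff.1 hE i).congr .rfl (E.coeFn_comp i)) (fun i => hK i i)
  simp only [greenDiff_zero h23 hl hm] at h
  rw [← h, hs, greenDiffL2, smul_sub, sub_sub_sub_cancel_left, inner_sub_right, inner_smul_right,
    inner_smul_right]
  ring

theorem inner_greenL2_comm (h23 : N = 2 ∨ N = 3) {lam mu : ℝ} (hl : 0 < lam) (hm : 0 < mu) :
    ⟪greenL2 h23 hl, greenL2 h23 hm⟫_ℂ = ⟪greenL2 h23 hm, greenL2 h23 hl⟫_ℂ := by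
  rw [inner_L2_eq, inner_L2_eq]
  refine integral_congr_ae ?_
  filter_upwards [coeFn_greenL2 h23 hl, coeFn_greenL2 h23 hm] with x h1 h2
  rw [h1, h2, conj_green, conj_green, mul_comm]

theorem conj_inner_greenL2 (h23 : N = 2 ∨ N = 3) {lam mu : ℝ} (hl : 0 < lam) (hm : 0 < mu) :
    conj ⟪greenL2 h23 hl, greenL2 h23 hm⟫_ℂ = ⟪greenL2 h23 hl, greenL2 h23 hm⟫_ℂ := by
  rw [inner_conj_symm, inner_greenL2_comm]

theorem greenNormSq_eq (h23 : N = 2 ∨ N = 3) {lam : ℝ} (hl : 0 < lam) :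
    (greenNormSq N lam : ℂ) = ⟪greenL2 h23 hl, greenL2 h23 hl⟫_ℂ := by
  rw [inner_L2_eq, greenNormSq, ← integral_complex_ofReal]
  refine integral_congr_ae ?_
  filter_upwards [coeFn_greenL2 h23 hl] with x h1
  rw [h1, Complex.mul_conj, Complex.normSq_eq_norm_sq]

/-- The right-hand side of the formula for `⟨-Δ̃_α u, v⟩`. -/
def formExpr {p : ℝ} (α lam : ℝ) (u v : Lpp N p) (F H : L2vec N) (c d : ℂ) : ℂ :=
  gradPairing F H + ((α + beta N lam + lam * greenNormSq N lam : ℝ) : ℂ) * c * conj d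
    - (lam : ℂ) * conj d * pairing u (green N lam)
    - (lam : ℂ) * c * conj (pairing v (green N lam))

theorem IsDecomp.pairing_eq (h23 : N = 2 ∨ N = 3) {p : ℝ} (hp : 1 < p)
    {lam mu : ℝ} (hl : 0 < lam) (hm : 0 < mu) {u f : Lpp N p} {F : L2vec N} {c : ℂ}
    (h : IsDecomp lam u f F c) :
    pairing f (green N mu) = pairing u (green N mu)
      - c * ⟪greenL2 h23 hm, greenL2 h23 hl⟫_ℂ := by
  have i1 := integrable_Lpp_mul_conj_green h23 hp hm u
  have i2 := (integrable_L2_mul_conj_green h23 hm (memLp_green_two h23 hl)).const_mul c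
  rw [← pairing_L2_green h23 hm, pairing_congr (coeFn_greenL2 h23 hl), pairing, pairing, pairing,
    ← integral_const_mul, ← integral_sub i1 i2]
  refine integral_congr_ae ?_
  filter_upwards [h.2] with x hx
  rw [hx]
  ring

theorem formExpr_change (h23 : N = 2 ∨ N = 3) {p : ℝ} (hp : 1 < p) (hp' : N = 3 → p < 2)
    (α : ℝ) {lam mu : ℝ} (hl : 0 < lam) (hm : 0 < mu) {u v f g : Lpp N p} {F H : L2vec N}
    {c d : ℂ} (hu : IsDecomp lam u f F c) (hv : IsDecomp lam v g H d) {f' g' : Lpp N p}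
    {F' H' : L2vec N} {c' d' : ℂ} (hu' : IsDecomp mu u f' F' c') (hv' : IsDecomp mu v g' H' d') :
    formExpr α mu u v F' H' c' d' = formExpr α lam u v F H c d := by
  obtain ⟨E, K, hE, hK, hs⟩ := exists_gradient_greenDiff h23 hl hm
  obtain ⟨-, rfl, rfl⟩ := hu'.unique h23 hm (hu.change h23 hp hp' hl hm hE)
  obtain ⟨-, rfl, rfl⟩ := hv'.unique h23 hm (hv.change h23 hp hp' hl hm hE)
  have key : ∀ {w k : Lpp N p} {P : L2vec N} {e : ℂ}, IsDecomp lam w k P e → ⟪E, P⟫_ℂ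
      = -(lam * pairing k (green N lam) - mu * pairing k (green N mu)) := fun h =>
    inner_gradient_greenDiff h23 hl hm hK hs (two_le_expo hp) (expo_sobolev h23 hp hp')
      (Lp.memLp _) h.1 (integrable_Lpp_mul_conj_green h23 hp hl _)
      (integrable_Lpp_mul_conj_green h23 hp hm _)
  have k1 := key hu
  have k2 := key hv
  have k3 := inner_gradient_greenDiff h23 hl hm hK hs le_rfl (by norm_num)
    (Lp.memLp (greenDiffL2 h23 hl hm)) hE
    (integrable_L2_mul_conj_green h23 hl (Lp.memLp _))
    (integrable_L2_mul_conj_green h23 hm (Lp.memLp _))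
  rw [hu.pairing_eq h23 hp hl hl, hu.pairing_eq h23 hp hl hm] at k1
  rw [hv.pairing_eq h23 hp hl hl, hv.pairing_eq h23 hp hl hm] at k2
  rw [pairing_L2_green h23 hl, pairing_L2_green h23 hm, greenDiffL2, inner_sub_right,
    inner_sub_right, inner_greenL2_comm h23 hm hl] at k3
  rw [inner_greenL2_comm h23 hm hl] at k1 k2
  have k4 := congrArg conj k2
  rw [inner_conj_symm] at k4
  simp only [map_neg, map_sub, map_mul, Complex.conj_ofReal, conj_inner_greenL2] at k4
  have kb := beta_sub_eq h23 hl hm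
  simp only [formExpr, ← inner_L2vec_eq, inner_add_left, inner_add_right, inner_smul_left,
    inner_smul_right]
  push_cast at kb ⊢
  rw [greenNormSq_eq h23 hl, greenNormSq_eq h23 hm]
  generalize ⟪greenL2 h23 hl, greenL2 h23 hl⟫_ℂ = S1 at *
  generalize ⟪greenL2 h23 hl, greenL2 h23 hm⟫_ℂ = S2 at *
  generalize ⟪greenL2 h23 hm, greenL2 h23 hm⟫_ℂ = S3 at *
  linear_combination conj d' * k1 + c' * k4 + c' * conj d' * k3 + c' * conj d' * kb

/-! ### The quadratic form of the point interaction -/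

/-- The description of `-Δ_α u = w` with parameter `λ`, in terms of elements of `L²`: one has
`u = f + c G_λ` and `λ u + w = λ f - Δ f`, where `f` has the gradient `F` and the continuous
representative `f₀`, and `(α + β(λ)) c = f₀(0)`. -/
def IsDomainDecomp (h23 : N = 2 ∨ N = 3) {lam : ℝ} (hl : 0 < lam) (α : ℝ) (u w f : L2 N)
    (F : L2vec N) (c : ℂ) : Prop :=
  HasWeakGrad f F ∧ u = f + c • greenL2 h23 hl ∧
    ∃ (f₀ : Rn N → ℂ) (K : Fin N → L2 N), Continuous f₀ ∧ f =ᵐ[volume] f₀ ∧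
      (∀ i, HasWeakPartial i (F.comp i) (K i)) ∧
      ((α + beta N lam : ℝ) : ℂ) * c = f₀ 0 ∧
      (lam : ℂ) • u + w = (lam : ℂ) • f - ∑ i, K i

theorem IsPointLaplacian.exists_domainDecomp (h23 : N = 2 ∨ N = 3) {lam : ℝ} (hl : 0 < lam)
    {α : ℝ} {u w : L2 N} (h : IsPointLaplacian α lam u w) :
    ∃ f F c, IsDomainDecomp h23 hl α u w f F c := by
  obtain ⟨f, c, F, H, hfc, hf, hF, hfF, hH, hu, hc, hw⟩ := h
  have hHi : ∀ i, MemLp (fun x => H i x i) 2 (volume : Measure (Rn N)) := fun i =>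
    (EuclideanSpace.proj (𝕜 := ℂ) i : Cn N →L[ℂ] ℂ).comp_memLp' (hH i).1
  refine ⟨hf.toLp f, hF.toLp F, c, hfF.congr hf.coeFn_toLp hF.coeFn_toLp, ?_, f,
    fun i => (hHi i).toLp _, hfc, hf.coeFn_toLp, fun i => ?_, hc, ?_⟩
  · refine Lp.ext ?_
    filter_upwards [hu, hf.coeFn_toLp, Lp.coeFn_add (hf.toLp f) (c • greenL2 h23 hl),
      Lp.coeFn_smul c (greenL2 h23 hl), coeFn_greenL2 h23 hl] with x h1 h2 h3 h4 h5
    rw [h3, Pi.add_apply, h4, Pi.smul_apply, h5, h2, h1, smul_eq_mul]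
  · refine (hasWeakGrad_iff.1 (hH i).2 i).congr ?_ (hHi i).coeFn_toLp
    filter_upwards [L2vec.coeFn_comp (hF.toLp F) i, hF.coeFn_toLp] with x h1 h2
    rw [h1, h2]
  · refine Lp.ext ?_
    have hs := Lp.coeFn_finsetSum (s := Finset.univ) (fun i => (hHi i).toLp _)
    filter_upwards [hw, hf.coeFn_toLp, Lp.coeFn_add ((lam : ℂ) • u) w, Lp.coeFn_smul (lam : ℂ) u,
      Lp.coeFn_sub ((lam : ℂ) • hf.toLp f) (∑ i, (hHi i).toLp _),
      Lp.coeFn_smul (lam : ℂ) (hf.toLp f), hs, ae_all_iff.2 fun i => (hHi i).coeFn_toLp]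
      with x h1 h2 h3 h4 h5 h6 h7 h8
    rw [h3, Pi.add_apply, h4, Pi.smul_apply, h5, Pi.sub_apply, h6, Pi.smul_apply, h7, h2,
      smul_eq_mul, smul_eq_mul, h1]
    simp [h8]

/-- The operator does not depend on the parameter: `f` becomes `f + c (G_λ - G_μ)`, and the
boundary condition is preserved since `(G_λ - G_μ)(0) = β(μ) - β(λ)`. -/
theorem IsDomainDecomp.change (h23 : N = 2 ∨ N = 3) {lam mu : ℝ} (hl : 0 < lam) (hm : 0 < mu)
    {α : ℝ} {u w f : L2 N} {F : L2vec N} {c : ℂ} (h : IsDomainDecomp h23 hl α u w f F c) :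
    ∃ f' F', IsDomainDecomp h23 hm α u w f' F' c := by
  obtain ⟨hF, hu, f₀, K, hf₀, hff, hK, hc, hw⟩ := h
  obtain ⟨E, L, hE, hL, hs⟩ := exists_gradient_greenDiff h23 hl hm
  have hadd : ∀ i, (F + c • E).comp i =ᵐ[volume] fun x => F.comp i x + c * E.comp i x := fun i => by
    filter_upwards [(F + c • E).coeFn_comp i, F.coeFn_comp i, E.coeFn_comp i,
      Lp.coeFn_add F (c • E), Lp.coeFn_smul c E] with x h1 h2 h3 h4 h5
    rw [h1, h2, h3, h4, Pi.add_apply, h5]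
    simp
  have hadd2 : ∀ a b : L2 N, (a + c • b : L2 N) =ᵐ[volume] fun x => a x + c * b x :=
    fun a b => by
      filter_upwards [Lp.coeFn_add a (c • b), Lp.coeFn_smul c b] with x h1 h2
      rw [h1, Pi.add_apply, h2, Pi.smul_apply, smul_eq_mul]
  refine ⟨f + c • greenDiffL2 h23 hl hm, F + c • E, hasWeakGrad_iff.2 fun i => ?_, ?_,
    fun x => f₀ x + c * greenDiff N lam mu x, fun i => K i + c • L i i, ?_, ?_, fun i => ?_, ?_, ?_⟩
  · have h1 := (hasWeakGrad_iff.1 hF i).add ((hasWeakGrad_iff.1 hE i).const_smul c)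
      (locInt _) (locInt_comp F i) ((locInt _).smul c) ((locInt_comp E i).smul c)
    refine h1.congr (hadd2 _ _) ?_
    filter_upwards [Lp.coeFn_add F (c • E), Lp.coeFn_smul c E] with x h4 h5
    rw [h4, Pi.add_apply, h5]
    simp
  · rw [hu, greenDiffL2, smul_sub]
    abel
  · exact hf₀.add (continuous_const.mul
      (Complex.continuous_ofReal.comp (continuous_greenDiff h23 hl hm)))
  · refine (hadd2 _ _).trans ?_
    filter_upwards [hff, coeFn_greenDiffL2 h23 hl hm, greenDiff_ae (by omega) hl hm]
      with x h1 h2 h3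
    rw [h1, h2, h3]
  · have h1 := (hK i).add ((hL i i).const_smul c)
      (locInt _) (locInt _) ((locInt _).smul c) ((locInt _).smul c)
    exact h1.congr (hadd i) (hadd2 _ _)
  · beta_reduce
    rw [greenDiff_zero h23 hl hm, ← hc]
    push_cast
    ring
  · have e : (mu : ℂ) • u + w = ((lam : ℂ) • u + w) + ((mu : ℂ) - lam) • u := by module
    rw [e, hw, Finset.sum_add_distrib, ← Finset.smul_sum, hs, hu, greenDiffL2]
    module

/-- Integration by parts in the form: for `u` in the domain of `-Δ_α` and `v = g + d G_λ` with
`g ∈ H¹`, one has `⟨-Δ_α u, v⟩ = ⟨∇f, ∇g⟩ + λ⟨f, g⟩ + (α + β(λ)) c d̄ - λ⟨u, v⟩`. -/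
theorem IsDomainDecomp.pairing_eq (h23 : N = 2 ∨ N = 3) {lam : ℝ} (hl : 0 < lam)
    {α : ℝ} {u w f v g : L2 N} {F H : L2vec N} {c d : ℂ}
    (h : IsDomainDecomp h23 hl α u w f F c) (hH : HasWeakGrad g H)
    (hv : v = g + d • greenL2 h23 hl) :
    ⟪v, w⟫_ℂ = ⟪H, F⟫_ℂ + lam * ⟪g, f⟫_ℂ + ((α + beta N lam : ℝ) : ℂ) * c * conj d
      - lam * ⟪v, u⟫_ℂ := by
  obtain ⟨hF, hu, f₀, K, hf₀, hff, hK, hc, hw⟩ := h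
  have h1 := inner_greenL2_eq h23 hl hf₀ hff (F := fun i => F.comp i)
    (fun i => (hasWeakGrad_iff.1 hF i).congr .rfl (F.coeFn_comp i)) hK
  have h2 : ∀ i, ⟪g, K i⟫_ℂ = -⟪H.comp i, F.comp i⟫_ℂ := fun i => by
    have := HasWeakPartial.inner_eq (hK i)
      ((hasWeakGrad_iff.1 hH i).congr .rfl (H.coeFn_comp i))
    rw [← inner_conj_symm, this, map_neg, inner_conj_symm]
  have h3 : ⟪H, F⟫_ℂ = ∑ i, ⟪H.comp i, F.comp i⟫_ℂ := by
    rw [inner_L2vec_eq, gradPairing_eq_sum]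
    refine Finset.sum_congr rfl fun i _ => ?_
    rw [inner_L2_eq]
    refine integral_congr_ae ?_
    filter_upwards [F.coeFn_comp i, H.coeFn_comp i] with x h1 h2
    rw [h1, h2]
  have hw' : w = ((lam : ℂ) • f - ∑ i, K i) - (lam : ℂ) • u := by rw [← hw]; abel
  have h4 : ⟪v, (lam : ℂ) • f - ∑ i, K i⟫_ℂ
      = lam * ⟪g, f⟫_ℂ + ⟪H, F⟫_ℂ + conj d * f₀ 0 := by
    rw [hv, inner_add_left, inner_smul_left, h1, inner_sub_right, inner_sum, inner_smul_right, h3]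
    simp only [h2, Finset.sum_neg_distrib]
    ring
  rw [hw', inner_sub_right, h4, inner_smul_right, ← hc]
  ring

/-- For large `λ` the form is coercive. -/
theorem exists_beta_pos (h23 : N = 2 ∨ N = 3) (α : ℝ) : ∃ mu : ℝ, 0 < mu ∧ 0 < α + beta N mu := by
  -- `β` is increasing and unbounded; `μ` is a solution of `β(μ) = |α| + γ / (2π)` for `N = 2`,
  -- and of `β(μ) = |α| + 1` for `N = 3`
  have hα := neg_abs_le α
  have hpi := Real.pi_pos
  rcases h23 with rfl | rfl
  · refine ⟨(2 * Real.exp (2 * Real.pi * |α|)) ^ 2, by positivity, ?_⟩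
    rw [beta, if_pos rfl, Real.sqrt_sq (by positivity), mul_div_cancel_left₀ _ two_ne_zero,
      Real.log_exp, mul_add, one_div, inv_mul_cancel_left₀ (by positivity)]
    have : 0 < (2 * Real.pi)⁻¹ * Real.eulerMascheroniConstant :=
      mul_pos (by positivity) (one_half_pos.trans Real.one_half_lt_eulerMascheroniConstant)
    linarith
  · refine ⟨(4 * Real.pi * (|α| + 1)) ^ 2, by positivity, ?_⟩
    rw [beta, if_neg (by norm_num), Real.sqrt_sq (by positivity),
      mul_div_cancel_left₀ _ (by positivity)]
    linarith

theorem pairing_L2_eq (w v : L2 N) : pairing w v = ⟪v, w⟫_ℂ := (inner_L2_eq v w).symm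

/-- Weak differentiation is a closed operator in `L²`. -/
theorem HasWeakPartial.of_tendsto {i : Fin N} {fn gn : ℕ → L2 N} {f g : L2 N}
    (h : ∀ n, HasWeakPartial i (fn n) (gn n)) (hf : Tendsto fn atTop (𝓝 f))
    (hg : Tendsto gn atTop (𝓝 g)) : HasWeakPartial i f g := by
  have key : ∀ ψ : Rn N → ℝ, Continuous ψ → HasCompactSupport ψ → ∀ {kn : ℕ → L2 N} {k : L2 N},
      Tendsto kn atTop (𝓝 k) →
      Tendsto (fun n => ∫ x, ((ψ x : ℝ) : ℂ) * kn n x) atTop (𝓝 (∫ x, ((ψ x : ℝ) : ℂ) * k x)) := by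
    intro ψ hc hs kn k hk
    have hm : MemLp (fun x => (ψ x : ℂ)) 2 (volume : Measure (Rn N)) :=
      (Complex.continuous_ofReal.comp hc).memLp_of_hasCompactSupport
        (hs.comp_left (g := ((↑) : ℝ → ℂ)) Complex.ofReal_zero)
    have e : ∀ a : L2 N, ∫ x, ((ψ x : ℝ) : ℂ) * a x = ⟪hm.toLp _, a⟫_ℂ := fun a => by
      rw [inner_L2_eq]
      refine integral_congr_ae ?_
      filter_upwards [hm.coeFn_toLp] with x hx
      rw [hx, Complex.conj_ofReal, mul_comm]
    simp only [e]
    exact tendsto_const_nhds.inner hk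
  intro φ hφ
  obtain ⟨hc, hs⟩ := hφ.partial i
  have h1 := key _ hc hs hf
  have h2 := (key _ hφ.1.continuous hφ.2 hg).neg
  refine tendsto_nhds_unique h1 (h2.congr fun n => (h n φ hφ).symm)

theorem L2vec.norm_comp_sub_le (F H : L2vec N) (i : Fin N) :
    ‖F.comp i - H.comp i‖ ≤ ‖F - H‖ := by
  refine Lp.norm_le_norm_of_ae_le ?_
  filter_upwards [Lp.coeFn_sub (F.comp i) (H.comp i), Lp.coeFn_sub F H, F.coeFn_comp i,
    H.coeFn_comp i] with x h1 h2 h3 h4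
  rw [h1, h2, Pi.sub_apply, Pi.sub_apply, h3, h4]
  exact PiLp.norm_apply_le (F x - H x) i

theorem HasWeakGrad.of_tendsto {fn : ℕ → L2 N} {Fn : ℕ → L2vec N} {f : L2 N} {F : L2vec N}
    (h : ∀ n, HasWeakGrad (fn n) (Fn n)) (hf : Tendsto fn atTop (𝓝 f))
    (hF : Tendsto Fn atTop (𝓝 F)) : HasWeakGrad f F := by
  refine hasWeakGrad_iff.2 fun i => ?_
  have h1 : HasWeakPartial i f (F.comp i) :=
    HasWeakPartial.of_tendsto (gn := fun n => (Fn n).comp i)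
      (fun n => (hasWeakGrad_iff.1 (h n) i).congr .rfl ((Fn n).coeFn_comp i)) hf <|
    tendsto_iff_norm_sub_tendsto_zero.2 <|
      squeeze_zero (fun _ => norm_nonneg _) (fun n => (Fn n).norm_comp_sub_le F i)
        (tendsto_iff_norm_sub_tendsto_zero.1 hF)
  exact h1.congr .rfl (F.coeFn_comp i).symm

theorem cauchySeq_of_norm_sq_le {E : Type*} [SeminormedAddCommGroup E] {a : ℕ → E} {b : ℝ}
    (hb : 0 < b) {q : ℕ × ℕ → ℝ} (hq : Tendsto q atTop (𝓝 0))
    (h : ∀ k, b * ‖a k.1 - a k.2‖ ^ 2 ≤ q k) : CauchySeq a := by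
  rw [cauchySeq_iff_tendsto_dist_atTop_0]
  have h1 : Tendsto (fun k => Real.sqrt (b⁻¹ * q k)) atTop (𝓝 0) := by
    have := (hq.const_mul b⁻¹).sqrt
    rwa [mul_zero, Real.sqrt_zero] at this
  refine squeeze_zero (fun _ => dist_nonneg) (fun k => ?_) h1
  rw [dist_eq_norm]
  refine Real.le_sqrt_of_sq_le ?_
  rw [le_inv_mul_iff₀ hb]
  exact h k

/-- A sequence that converges in the sense of the form has convergent decompositions, if
`μ` is so large that the form is coercive. -/
theorem FormConverges.exists_tendsto (h23 : N = 2 ∨ N = 3) {lam mu : ℝ} (hl : 0 < lam)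
    (hm : 0 < mu) {α : ℝ} (hb : 0 < α + beta N mu) {un wn : ℕ → L2 N} {u : L2 N}
    (h : FormConverges α lam un wn u) :
    ∃ (fn : ℕ → L2 N) (Fn : ℕ → L2vec N) (cn : ℕ → ℂ) (f : L2 N) (F : L2vec N) (c : ℂ),
      (∀ n, IsDomainDecomp h23 hm α (un n) (wn n) (fn n) (Fn n) (cn n)) ∧
      Tendsto fn atTop (𝓝 f) ∧ Tendsto Fn atTop (𝓝 F) ∧ Tendsto cn atTop (𝓝 c) ∧
      HasWeakGrad f F ∧ u = f + c • greenL2 h23 hm := by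
  obtain ⟨hD, hu, hq⟩ := h
  have hD' : ∀ n, ∃ f F c, IsDomainDecomp h23 hm α (un n) (wn n) f F c := fun n => by
    obtain ⟨f, F, c, h1⟩ := (hD n).exists_domainDecomp h23 hl
    obtain ⟨f', F', h2⟩ := h1.change h23 hl hm
    exact ⟨f', F', c, h2⟩
  choose fn Fn cn hn using hD'
  set b := α + beta N mu
  -- the form, shifted by `μ`, at the differences of the sequence
  set q : ℕ × ℕ → ℝ := fun k => ‖Fn k.1 - Fn k.2‖ ^ 2 + mu * ‖fn k.1 - fn k.2‖ ^ 2
    + b * ‖cn k.1 - cn k.2‖ ^ 2 with hqdef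
  have hqk : ∀ k : ℕ × ℕ, (q k : ℂ) = pairing (wn k.1 - wn k.2 : L2 N) (un k.1 - un k.2 : L2 N)
      + mu * ((‖un k.1 - un k.2‖ ^ 2 : ℝ) : ℂ) := fun k => by
    have hg : HasWeakGrad (fn k.1 - fn k.2 : L2 N) (Fn k.1 - Fn k.2 : L2vec N) := by
      refine hasWeakGrad_iff.2 fun i => ?_
      have h1 := (hasWeakGrad_iff.1 (hn k.1).1 i).add
        ((hasWeakGrad_iff.1 (hn k.2).1 i).const_smul (-1))
        (locInt _) (locInt_comp _ i) ((locInt _).smul (-1 : ℂ)) ((locInt_comp _ i).smul (-1 : ℂ))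
      refine h1.congr ?_ ?_
      · filter_upwards [Lp.coeFn_sub (fn k.1) (fn k.2)] with x h1
        rw [h1, Pi.sub_apply]; ring
      · filter_upwards [Lp.coeFn_sub (Fn k.1) (Fn k.2)] with x h1
        rw [h1, Pi.sub_apply, PiLp.sub_apply]; ring
    have hv : un k.1 - un k.2
        = (fn k.1 - fn k.2) + (cn k.1 - cn k.2) • greenL2 h23 hm := by
      rw [(hn k.1).2.1, (hn k.2).2.1]; module
    have e1 := (hn k.1).pairing_eq h23 hm hg hv
    have e2 := (hn k.2).pairing_eq h23 hm hg hv
    have s1 := inner_self_eq_norm_sq_to_K (𝕜 := ℂ) (Fn k.1 - Fn k.2)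
    have s2 := inner_self_eq_norm_sq_to_K (𝕜 := ℂ) (fn k.1 - fn k.2)
    have s3 := inner_self_eq_norm_sq_to_K (𝕜 := ℂ) (un k.1 - un k.2)
    have s4 := Complex.mul_conj' (cn k.1 - cn k.2)
    rw [inner_sub_right] at s1 s2 s3
    rw [pairing_L2_eq, inner_sub_right, e1, e2]
    simp only [hqdef]
    have hbe : (b : ℂ) = ((α + beta N mu : ℝ) : ℂ) := rfl
    rw [← hbe]
    push_cast at s1 s2 s3 ⊢
    linear_combination -s1 - mu * s2 + mu * s3 - b * s4
  have hq0 : Tendsto q atTop (𝓝 0) := by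
    have h1 : Tendsto (fun k : ℕ × ℕ => ‖un k.1 - un k.2‖ ^ 2) atTop (𝓝 0) := by
      have := (cauchySeq_iff_tendsto_dist_atTop_0.1 hu.cauchySeq).pow 2
      simpa [dist_eq_norm] using this
    have h2 : Tendsto (fun k => (q k : ℂ)) atTop (𝓝 0) := by
      have h3 := hq.add ((((Complex.continuous_ofReal.tendsto _).comp h1)).const_mul (mu : ℂ))
      rw [Complex.ofReal_zero, mul_zero, add_zero] at h3
      exact h3.congr fun k => (hqk k).symm
    exact ((Complex.continuous_re.tendsto _).comp h2).congr fun k => Complex.ofReal_re _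
  obtain ⟨F, hF⟩ := cauchySeq_tendsto_of_complete
    (cauchySeq_of_norm_sq_le (a := Fn) one_pos hq0 fun k => by
      simp only [hqdef]; nlinarith [mul_nonneg hm.le (sq_nonneg ‖fn k.1 - fn k.2‖),
        mul_nonneg hb.le (sq_nonneg ‖cn k.1 - cn k.2‖)])
  obtain ⟨f, hf⟩ := cauchySeq_tendsto_of_complete
    (cauchySeq_of_norm_sq_le (a := fn) hm hq0 fun k => by
      simp only [hqdef]; nlinarith [sq_nonneg ‖Fn k.1 - Fn k.2‖,
        mul_nonneg hb.le (sq_nonneg ‖cn k.1 - cn k.2‖)])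
  obtain ⟨c, hc⟩ := cauchySeq_tendsto_of_complete
    (cauchySeq_of_norm_sq_le (a := cn) hb hq0 fun k => by
      simp only [hqdef]; nlinarith [sq_nonneg ‖Fn k.1 - Fn k.2‖,
        mul_nonneg hm.le (sq_nonneg ‖fn k.1 - fn k.2‖)])
  refine ⟨fn, Fn, cn, f, F, c, hn, hf, hF, hc, HasWeakGrad.of_tendsto (fun n => (hn n).1) hf hF,
    tendsto_nhds_unique hu ?_⟩
  exact (hf.add (hc.smul_const _)).congr fun n => ((hn n).2.1).symm

/-- The limit of a form-convergent sequence has a decomposition with `f ∈ L^{p+1}`, by the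
Sobolev embedding of `H¹`. -/
theorem exists_isDecomp (h23 : N = 2 ∨ N = 3) {p : ℝ} (hp : 1 < p) (hp' : N = 3 → p < 2)
    {mu : ℝ} (hm : 0 < mu) {u f : L2 N} {F : L2vec N} {c : ℂ} (hF : HasWeakGrad f F)
    (hu : u = f + c • greenL2 h23 hm) :
    ∃ U f' : Lpp N p, U =ᵐ[volume] u ∧ IsDecomp mu U f' F c := by
  have h1 : MemLp f (expo p) volume := by
    rw [expo_eq hp]
    refine memLp_of_hasWeakPartial (by linarith) ?_ (F := fun i => F.comp i)
      fun i => (hasWeakGrad_iff.1 hF i).congr .rfl (F.coeFn_comp i)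
    rcases h23 with rfl | rfl
    · norm_num
    · push_cast; linarith [hp' rfl]
  have h2 := h1.add ((memLp_green_expo h23 hp hp' hm).const_mul c)
  refine ⟨h2.toLp _, h1.toLp _, ?_, hF.congr h1.coeFn_toLp .rfl, ?_⟩
  · filter_upwards [h2.coeFn_toLp, Lp.coeFn_add f (c • greenL2 h23 hm),
      Lp.coeFn_smul c (greenL2 h23 hm), coeFn_greenL2 h23 hm] with x e1 e2 e3 e4
    rw [e1, hu, e2, Pi.add_apply, Pi.add_apply, e3, Pi.smul_apply, e4, smul_eq_mul]
  · filter_upwards [h2.coeFn_toLp, h1.coeFn_toLp] with x e1 e2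
    rw [e1, e2, Pi.add_apply]

/-- The closed form of `-Δ_α` at a coercive `μ` is given by the formula for `⟨-Δ̃_α u, v⟩`. -/
theorem tendsto_pairing (h23 : N = 2 ∨ N = 3) {lam mu : ℝ} (hl : 0 < lam)
    (hm : 0 < mu) {α : ℝ} (hb : 0 < α + beta N mu) {p : ℝ} (hp : 1 < p) (hp' : N = 3 → p < 2)
    {un wn vn zn : ℕ → L2 N} {u v : L2 N} (hu : FormConverges α lam un wn u)
    (hv : FormConverges α lam vn zn v) {U V f' g' : Lpp N p} {F' H' : L2vec N} {c' d' : ℂ}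
    (hU : U =ᵐ[volume] u) (hV : V =ᵐ[volume] v)
    (hdU : IsDecomp mu U f' F' c') (hdV : IsDecomp mu V g' H' d') :
    Tendsto (fun n => pairing (wn n) (vn n)) atTop (𝓝 (formExpr α mu U V F' H' c' d')) := by
  obtain ⟨fn, Fn, cn, f, F, c, hn, hf, hF, hc, hg, e⟩ := hu.exists_tendsto h23 hl hm hb
  obtain ⟨gn, Hn, dn, g, H, d, hn', hg', hH, hd, hk, e'⟩ := hv.exists_tendsto h23 hl hm hb
  obtain ⟨U', f1, hU', hdU'⟩ := exists_isDecomp h23 hp hp' hm hg e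
  obtain ⟨V', g1, hV', hdV'⟩ := exists_isDecomp h23 hp hp' hm hk e'
  obtain rfl : U' = U := Lp.ext (hU'.trans hU.symm)
  obtain rfl : V' = V := Lp.ext (hV'.trans hV.symm)
  obtain ⟨-, rfl, rfl⟩ := hdU.unique h23 hm hdU'
  obtain ⟨-, rfl, rfl⟩ := hdV.unique h23 hm hdV'
  have key : formExpr α mu U' V' F' H' c' d' = ⟪H', F'⟫_ℂ + mu * ⟪g, f⟫_ℂ
      + ((α + beta N mu : ℝ) : ℂ) * c' * conj d' - mu * ⟪v, u⟫_ℂ := by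
    have ef : f = u - c' • greenL2 h23 hm := by rw [e]; abel
    have eg : g = v - d' • greenL2 h23 hm := by rw [e']; abel
    rw [formExpr, pairing_congr hU', pairing_congr hV', pairing_L2_green h23 hm,
      pairing_L2_green h23 hm, ← inner_L2vec_eq, ef, eg, inner_conj_symm]
    simp only [inner_sub_left, inner_sub_right, inner_smul_left, inner_smul_right]
    have hS := greenNormSq_eq h23 hm
    push_cast
    rw [hS]
    ring
  rw [key]
  have h1 := (((hH.inner hF (𝕜 := ℂ)).add ((hg'.inner hf (𝕜 := ℂ)).const_mul (mu : ℂ))).add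
    ((hc.const_mul ((α + beta N mu : ℝ) : ℂ)).mul
      ((Complex.continuous_conj.tendsto _).comp hd))).sub
    ((hv.2.1.inner hu.2.1 (𝕜 := ℂ)).const_mul (mu : ℂ))
  refine h1.congr fun n => ?_
  rw [pairing_L2_eq, (hn n).pairing_eq h23 hm (hn' n).1 (hn' n).2.1]
  rfl

/-! ### The form as a bounded operator from `X₀` to its antidual -/

/-- By Hölder's inequality, `u ↦ ⟨u, G_λ⟩` is a bounded functional on `L^{p+1}`. -/
theorem exists_pairing_clm (h23 : N = 2 ∨ N = 3) {p : ℝ} (hp : 1 < p) {lam : ℝ} (hl : 0 < lam) :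
    ∃ L : Lpp N p →L[ℂ] ℂ, ∀ u : Lpp N p, pairing u (green N lam) = L u := by
  have hpq := holderConjugate_expo hp
  set q := ENNReal.ofReal (p + 1).conjExponent
  have : Fact (1 ≤ q) := ⟨ENNReal.HolderConjugate.one_le q (expo p)⟩
  have hG : MemLp (green N lam) q volume := memLp_green_conj h23 hp hl
  refine ⟨((ContinuousLinearMap.mul ℂ ℂ).lpPairing volume (expo p) q).flip (hG.toLp _),
    fun u => ?_⟩
  rw [ContinuousLinearMap.flip_apply, ContinuousLinearMap.lpPairing_eq_integral, pairing]
  refine integral_congr_ae ?_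
  filter_upwards [hG.coeFn_toLp] with x hx
  rw [hx, conj_green, ContinuousLinearMap.mul_apply']

theorem X0.norm_eq (h23 : N = 2 ∨ N = 3) {p lam : ℝ} (hl : 0 < lam) (u : X0 N p lam)
    {f : Lpp N p} {F : L2vec N} {c : ℂ} (h : IsDecomp lam u.toLp f F c) :
    ‖u‖ = ‖F‖ + ‖c‖ + ‖u.toLp‖ := by
  have : X0.normSet u = {‖F‖ + ‖c‖} := by
    refine Set.eq_singleton_iff_unique_mem.2 ⟨⟨f, F, c, h, rfl⟩, ?_⟩
    rintro _ ⟨f', F', c', h', rfl⟩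
    obtain ⟨-, rfl, rfl⟩ := h.unique h23 hl h'
    rfl
  rw [X0.norm_def, this, csInf_singleton]

theorem norm_formExpr_le (h23 : N = 2 ∨ N = 3) {p : ℝ} {lam : ℝ}
    (hl : 0 < lam) (α : ℝ) {L : Lpp N p →L[ℂ] ℂ}
    (hL : ∀ u : Lpp N p, pairing u (green N lam) = L u) {u v : X0 N p lam}
    {f g : Lpp N p} {F H : L2vec N} {c d : ℂ}
    (hu : IsDecomp lam u.toLp f F c) (hv : IsDecomp lam v.toLp g H d) :
    ‖formExpr α lam u.toLp v.toLp F H c d‖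
      ≤ (1 + |α + beta N lam + lam * greenNormSq N lam| + 2 * (lam * ‖L‖)) * ‖u‖ * ‖v‖ := by
  have eu := X0.norm_eq h23 hl u hu
  have ev := X0.norm_eq h23 hl v hv
  set k := α + beta N lam + lam * greenNormSq N lam
  have hF : ‖F‖ ≤ ‖u‖ := by rw [eu]; linarith [norm_nonneg c, norm_nonneg u.toLp]
  have hc : ‖c‖ ≤ ‖u‖ := by rw [eu]; linarith [norm_nonneg F, norm_nonneg u.toLp]
  have hU : ‖u.toLp‖ ≤ ‖u‖ := by rw [eu]; linarith [norm_nonneg F, norm_nonneg c]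
  have hH : ‖H‖ ≤ ‖v‖ := by rw [ev]; linarith [norm_nonneg d, norm_nonneg v.toLp]
  have hd : ‖d‖ ≤ ‖v‖ := by rw [ev]; linarith [norm_nonneg H, norm_nonneg v.toLp]
  have hV : ‖v.toLp‖ ≤ ‖v‖ := by rw [ev]; linarith [norm_nonneg H, norm_nonneg d]
  have hu0 := norm_nonneg u
  have hv0 := norm_nonneg v
  have t1 : ‖⟪H, F⟫_ℂ‖ ≤ ‖u‖ * ‖v‖ := by
    rw [mul_comm]
    exact (norm_inner_le_norm H F).trans (mul_le_mul hH hF (norm_nonneg _) hv0)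
  have t2 : ‖(k : ℂ) * c * conj d‖ ≤ |k| * (‖u‖ * ‖v‖) := by
    rw [norm_mul, norm_mul, RCLike.norm_conj, Complex.norm_real, Real.norm_eq_abs, mul_assoc]
    gcongr
  have t3 : ‖(lam : ℂ) * conj d * L u.toLp‖ ≤ lam * ‖L‖ * (‖u‖ * ‖v‖) := by
    rw [norm_mul, norm_mul, RCLike.norm_conj, Complex.norm_real, Real.norm_of_nonneg hl.le]
    calc lam * ‖d‖ * ‖L u.toLp‖ ≤ lam * ‖v‖ * (‖L‖ * ‖u‖) := by
          gcongr
          exact L.le_opNorm_of_le hU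
      _ = _ := by ring
  have t4 : ‖(lam : ℂ) * c * conj (L v.toLp)‖ ≤ lam * ‖L‖ * (‖u‖ * ‖v‖) := by
    rw [norm_mul, norm_mul, RCLike.norm_conj, Complex.norm_real, Real.norm_of_nonneg hl.le]
    calc lam * ‖c‖ * ‖L v.toLp‖ ≤ lam * ‖u‖ * (‖L‖ * ‖v‖) := by
          gcongr
          exact L.le_opNorm_of_le hV
      _ = _ := by ring
  rw [formExpr, ← inner_L2vec_eq, hL, hL]
  refine (norm_sub_le _ _).trans ?_
  refine (add_le_add (norm_sub_le _ _) le_rfl).trans ?_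
  refine (add_le_add (add_le_add (norm_add_le _ _) le_rfl) le_rfl).trans ?_
  linarith

/-- The right-hand side of the formula, at a fixed `λ`, is a bounded sesquilinear form. -/
theorem exists_formExpr_clm (h23 : N = 2 ∨ N = 3) {p : ℝ} (hp : 1 < p) {lam : ℝ} (hl : 0 < lam)
    (α : ℝ) : ∃ A : X0 N p lam →L[ℂ] X0Dual N p lam,
      ∀ (u v : X0 N p lam) (f g : Lpp N p) (F H : L2vec N) (c d : ℂ),
        IsDecomp lam u.toLp f F c → IsDecomp lam v.toLp g H d →
        A u v = formExpr α lam u.toLp v.toLp F H c d := by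
  obtain ⟨L, hL⟩ := exists_pairing_clm h23 hp hl
  choose f F c h using fun u : X0 N p lam => u.exists_decomp
  have hadd : ∀ u v, F (u + v) = F u + F v ∧ c (u + v) = c u + c v := fun u v => by
    have h1 := (h u).add (h v)
    rw [← map_add] at h1
    exact ((h (u + v)).unique h23 hl h1).2
  have hsmul : ∀ (a : ℂ) u, F (a • u) = a • F u ∧ c (a • u) = a * c u := fun a u => by
    have h1 := (h u).smul a
    rw [← map_smul] at h1
    exact ((h (a • u)).unique h23 hl h1).2
  have e : ∀ (U V : Lpp N p) (P Q : L2vec N) (a b : ℂ), formExpr α lam U V P Q a b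
      = ⟪Q, P⟫_ℂ + ((α + beta N lam + lam * greenNormSq N lam : ℝ) : ℂ) * a * conj b
        - (lam : ℂ) * conj b * L U - (lam : ℂ) * a * conj (L V) :=
    fun U V P Q a b => by rw [formExpr, hL, hL, inner_L2vec_eq]
  let B : X0 N p lam →ₗ[ℂ] X0 N p lam →ₗ⋆[ℂ] ℂ :=
    LinearMap.mk₂'ₛₗ (RingHom.id ℂ) (starRingEnd ℂ)
      (fun u v => formExpr α lam (X0.toLp u) (X0.toLp v) (F u) (F v) (c u) (c v))
      (fun u u' v => by
        rw [map_add, (hadd u u').1, (hadd u u').2]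
        simp only [e, map_add, inner_add_right]
        ring)
      (fun a u v => by
        rw [map_smul, (hsmul a u).1, (hsmul a u).2]
        simp only [e, map_smul, inner_smul_right, smul_eq_mul,
          RingHom.id_apply]
        ring)
      (fun u v v' => by
        rw [map_add, (hadd v v').1, (hadd v v').2]
        simp only [e, map_add, inner_add_left]
        ring)
      (fun a u v => by
        rw [map_smul, (hsmul a v).1, (hsmul a v).2]
        simp only [e, map_smul, inner_smul_left, smul_eq_mul,
          map_mul]
        ring)
  refine ⟨B.mkContinuous₂ _ fun u v => norm_formExpr_le h23 hl α hL (h u) (h v),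
    fun u v f' g' F' H' c' d' hu hv => ?_⟩
  obtain ⟨-, rfl, rfl⟩ := hu.unique h23 hl (h u)
  obtain ⟨-, rfl, rfl⟩ := hv.unique h23 hl (h v)
  rfl

end PointInteraction

end

open PointInteraction in
theorem proposition1p2 (N : ℕ) (hN : N = 2 ∨ N = 3) (α p : ℝ)
    (hα : N = 3 → α < 0) (hp : 1 < p) (hp' : N = 3 → p < 2) :
    -- `G_λ` is the `L²` fundamental solution of `λ - Δ`
    (∀ lam : ℝ, 0 < lam → IsFundamentalSolution lam (green N lam)) ∧
    -- the reference parameter `lam0` fixes the presentation and the norm of `X₀`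
    ∀ lam0 : ℝ, 0 < lam0 →
      -- membership in `X₀` and unique decomposition hold for every `λ`
      (∀ lam : ℝ, 0 < lam → X0Submodule N p lam = X0Submodule N p lam0) ∧
      (∀ lam : ℝ, 0 < lam → ∀ u : X0 N p lam0,
        ∃! d : Lpp N p × L2vec N × ℂ, IsDecomp lam u.toLp d.1 d.2.1 d.2.2) ∧
      (∀ (u : X0 N p lam0) (f : Lpp N p) (F : L2vec N) (c : ℂ),
        IsDecomp lam0 u.toLp f F c → ‖u‖ = ‖F‖ + ‖c‖ + ‖u.toLp‖) ∧
      -- the pairings `⟨u, G_λ⟩` are absolutely convergent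
      (∀ lam : ℝ, 0 < lam → ∀ u : X0 N p lam0,
        MeasureTheory.Integrable
          (fun x => u.toLp x * (starRingEnd ℂ) (green N lam x))) ∧
      -- the energy space is contained in `X₀`
      (∀ lam : ℝ, 0 < lam → ∀ u' ∈ energySpace N α lam,
        ∃ u : X0 N p lam0, u.toLp =ᵐ[MeasureTheory.volume] u') ∧
      ∃ A : X0 N p lam0 →L[ℂ] X0Dual N p lam0,
        -- the formula, for every `λ` and all decompositions
        (∀ lam : ℝ, 0 < lam → ∀ (u v : X0 N p lam0) (f g : Lpp N p) (F H : L2vec N) (c d : ℂ),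
          IsDecomp lam u.toLp f F c → IsDecomp lam v.toLp g H d →
          A u v = gradPairing F H
            + ((α + beta N lam + lam * greenNormSq N lam : ℝ) : ℂ) * c * (starRingEnd ℂ) d
            - (lam : ℂ) * (starRingEnd ℂ) d * pairing u.toLp (green N lam)
            - (lam : ℂ) * c * (starRingEnd ℂ) (pairing v.toLp (green N lam))) ∧
        -- on the energy space `A` is the closed form of `-Δ_α`
        (∀ lam : ℝ, 0 < lam → ∀ u' ∈ energySpace N α lam, ∀ v' ∈ energySpace N α lam,
          ∀ u v : X0 N p lam0, u.toLp =ᵐ[MeasureTheory.volume] u' →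
            v.toLp =ᵐ[MeasureTheory.volume] v' → HasFormValue α lam u' v' (A u v)) := by
  refine ⟨fun lam hl => isFundamentalSolution_green hN hl, fun lam0 h0 => ?_⟩
  have hX : ∀ lam : ℝ, 0 < lam → X0Submodule N p lam = X0Submodule N p lam0 := fun lam hl =>
    le_antisymm (X0Submodule_le hN hp hp' hl h0) (X0Submodule_le hN hp hp' h0 hl)
  have hdec : ∀ lam : ℝ, 0 < lam → ∀ u : X0 N p lam0, ∃ f F c, IsDecomp lam u.toLp f F c :=
    fun lam hl u => X0Submodule_le hN hp hp' h0 hl u.2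
  refine ⟨hX, fun lam hl u => ?_, fun u f F c h => X0.norm_eq hN h0 u h,
    fun lam hl u => integrable_Lpp_mul_conj_green hN hp hl u.toLp, fun lam hl u' hu' => ?_, ?_⟩
  · obtain ⟨f, F, c, h⟩ := hdec lam hl u
    refine ⟨(f, F, c), h, fun d hd => ?_⟩
    obtain ⟨h1, h2, h3⟩ := IsDecomp.unique hN hl hd h
    exact Prod.ext h1 (Prod.ext h2 h3)
  · obtain ⟨mu, hm, hb⟩ := exists_beta_pos hN α
    obtain ⟨un, wn, hu⟩ := hu'
    obtain ⟨-, -, -, f, F, c, -, -, -, -, hg, e⟩ := hu.exists_tendsto hN hl hm hb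
    obtain ⟨U, f', hU, hdU⟩ := exists_isDecomp hN hp hp' hm hg e
    exact ⟨⟨U, X0Submodule_le hN hp hp' hm h0 ⟨f', F, c, hdU⟩⟩, hU⟩
  · obtain ⟨A, hA⟩ := exists_formExpr_clm hN hp h0 α
    have hform : ∀ lam : ℝ, 0 < lam → ∀ (u v : X0 N p lam0) (f g : Lpp N p) (F H : L2vec N)
        (c d : ℂ), IsDecomp lam u.toLp f F c → IsDecomp lam v.toLp g H d →
        A u v = formExpr α lam u.toLp v.toLp F H c d := by
      intro lam hl u v f g F H c d hu hv
      obtain ⟨f', F', c', hu'⟩ := u.exists_decomp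
      obtain ⟨g', H', d', hv'⟩ := v.exists_decomp
      rw [hA u v _ _ _ _ _ _ hu' hv']
      exact formExpr_change hN hp hp' α hl h0 hu hv hu' hv'
    refine ⟨A, hform, fun lam hl u' hu' v' hv' u v hu hv => ⟨hu', hv', ?_⟩⟩
    intro un wn vn zn hun hvn
    -- the formula is evaluated at a parameter for which the form is coercive
    obtain ⟨mu, hm, hb⟩ := exists_beta_pos hN α
    obtain ⟨f, F, c, hdu⟩ := hdec mu hm u
    obtain ⟨g, H, d, hdv⟩ := hdec mu hm v
    rw [hform mu hm u v _ _ _ _ _ _ hdu hdv]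
    exact tendsto_pairing hN hl hm hb hp hp' hun hvn hu hv hdu hdv
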